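/- Setting. Let $V$ be a finite-dimensional Hermitian vector space and $G\subset U(V)$ a compact connected Lie group, realised as a group of unitary matrices (every compact connected Lie group has such a realisation). Let $\mathfrak g$ be its Lie algebra, equipped with an $\mathrm{Ad}$-invariant inner product by which $\mathfrak g\cong\mathfrak g^*$, and let $G_{\mathbb C}\subset GL(V)$ be its complexification, the connected complex Lie subgroup with Lie algebra $\mathfrak g\oplus i\mathfrak g$. Let $(X,\omega,J)$ be a compact Kähler manifold on which $G$ acts, the action being extended to a holomorphic action of $G_{\mathbb C}$, with a smooth $G$-equivariant moment map $\Phi:X\to\mathfrak g$, $\iota(\xi_X)\omega=d\langle\Phi,\xi\rangle$ for all $\xi\in\mathfrak g$. Let $(\Sigma,j)$ be a compact connected Riemann surface, possibly with boundary, with a positive area form $d\mathrm{vol}_\Sigma$, and let $P\to\Sigma$ be a smooth principal $G$-bundle. Let $\mathcal H(P,X)$ be the set of pairs $(A,u)$ of a smooth connection $A$ on $P$ and a smooth section $u$ of $P(X)=P\times_G X$ with $\overline\partial_A u=\tfrac12(d_Au+J\,d_Au\circ j)=0$. A pair $(A,u)\in\mathcal H(P,X)$ is a *vortex* if $F_A+\Phi(u)\,d\mathrm{vol}_\Sigma=0$.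 A complex gauge transformation is a smooth section $g\in\mathcal G_{\mathbb C}$ of $P\times_G G_{\mathbb C}$ ($G$ acting by conjugation); it acts by $g(A,u)=(g(A),gu)$, where $g(A)$ is the connection with $\overline\partial_{g(A)}=g\circ\overline\partial_A\circ g^{-1}$. The gauge group $\mathcal G\subset\mathcal G_{\mathbb C}$ consists of the sections with values in $G$. Proposition. Let $(A,u),(A',u')\in\mathcal H(P,X)$ be vortices with $(A',u')=g(A,u)$ for some $g\in\mathcal G_{\mathbb C}$ such that $g(x)\in G$ over every $x\in\partial\Sigma$. Then $(A,u)$ and $(A',u')$ are gauge equivalent, i.e. $(A',u')=k(A,u)$ for some $k\in\mathcal G$. If moreover $\partial\Sigma\neq\emptyset$, then $g\in\mathcal G$. -/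

import Mathlib

open Set Function
open scoped Manifold ContDiff Topology

noncomputable section

/-! ## Differential forms on manifolds (possibly with boundary) -/

section Forms

variable {W : Type*} [NormedAddCommGroup W] [NormedSpace ℝ W] {H : Type*} [TopologicalSpace H]
  (I : ModelWithCorners ℝ W H) {M : Type*} [TopologicalSpace M] [ChartedSpace H M]
  {F : Type*} [NormedAddCommGroup F] [NormedSpace ℝ F] {k : ℕ}

/-- The coordinate expression, in the preferred chart at `x₀`, of an `F`-valued `k`-form `η` on
`M`: the pull-back of `η` under the inverse of the chart. -/
def chartForm (η : ∀ x : M, TangentSpace I x [⋀^Fin k]→L[ℝ] F) (x₀ : M) :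
    W → W [⋀^Fin k]→L[ℝ] F :=
  fun z => (η ((extChartAt I x₀).symm z)).compContinuousLinearMap
    (mfderivWithin 𝓘(ℝ, W) I (extChartAt I x₀).symm (range I) z)

/-- Smoothness of a differential form on an open set `s` (up to the boundary of `M`). -/
def SmoothFormOn (η : ∀ x : M, TangentSpace I x [⋀^Fin k]→L[ℝ] F) (s : Set M) : Prop :=
  ∀ x₀ ∈ s, ContDiffWithinAt ℝ ∞ (chartForm I η x₀) (range I) (extChartAt I x₀ x₀)

/-- The exterior derivative at `x₀`, computed in the preferred chart at `x₀` (in which the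
tangent space at `x₀` is the model vector space). -/
def formDeriv (η : ∀ x : M, TangentSpace I x [⋀^Fin k]→L[ℝ] F) (x₀ : M) :
    TangentSpace I x₀ [⋀^Fin (k + 1)]→L[ℝ] F :=
  (extDerivWithin (chartForm I η x₀) (range I) (extChartAt I x₀ x₀) :
    W [⋀^Fin (k + 1)]→L[ℝ] F)

end Forms

/-- Multiplication by `i` on the tangent spaces of a complex manifold (possibly with boundary),
whose real tangent spaces are modelled on the complex vector space `W`. -/
def tangentJ {W : Type*} [NormedAddCommGroup W] [NormedSpace ℂ W] {H : Type*}
    [TopologicalSpace H] (I : ModelWithCorners ℝ W H) {M : Type*} [TopologicalSpace M]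
    [ChartedSpace H M] (x : M) (v : TangentSpace I x) : TangentSpace I x :=
  let w : W := v
  (Complex.I • w : W)

/-! ## Riemann surfaces with boundary -/

/-- The closed upper half plane. -/
abbrev HalfPlane : Type := {z : ℂ // 0 ≤ z.im}

/-- The inclusion of the closed upper half plane into the complex plane. -/
def halfPlaneEquiv : PartialEquiv HalfPlane ℂ where
  toFun := Subtype.val
  invFun z := ⟨⟨z.re, max z.im 0⟩, le_max_right _ _⟩
  source := univ
  target := {z | 0 ≤ z.im}
  map_source' x _ := x.2
  map_target' _ _ := mem_univ _
  left_inv' x _ := Subtype.ext (Complex.ext rfl (max_eq_left x.2))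
  right_inv' _ hz := Complex.ext rfl (max_eq_left hz)

theorem halfPlane_range : range halfPlaneEquiv = {z : ℂ | 0 ≤ z.im} :=
  Subtype.range_val

theorem halfPlane_convex : Convex ℝ {z : ℂ | 0 ≤ z.im} :=
  convex_halfSpace_ge Complex.imLm.isLinear 0

theorem halfPlane_interior : (interior {z : ℂ | 0 ≤ z.im}).Nonempty :=
  ⟨Complex.I, interior_maximal (s := {z : ℂ | 0 ≤ z.im}) (t := {z : ℂ | 0 < z.im})
    (fun z (hz : 0 < z.im) => (le_of_lt hz : 0 ≤ z.im)) (isOpen_lt continuous_const Complex.continuous_im)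
    (show 0 < Complex.I.im by simp)⟩

theorem halfPlane_continuous_inv : Continuous halfPlaneEquiv.symm := by
  refine Continuous.subtype_mk ?_ _
  have h : (fun z : ℂ => (⟨z.re, max z.im 0⟩ : ℂ))
      = fun z : ℂ => ((z.re : ℝ) : ℂ) + ((max z.im 0 : ℝ) : ℂ) * Complex.I := by
    funext z
    exact Complex.mk_eq_add_mul_I _ _
  rw [h]
  fun_prop

/-- The closed upper half plane as a model for complex one-dimensional manifolds with boundary:
a manifold over this model has coordinate changes that are holomorphic (in the interior, and with
complex-linear derivatives up to the boundary). -/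
def halfPlaneℂ : ModelWithCorners ℂ ℂ HalfPlane where
  toPartialEquiv := halfPlaneEquiv
  source_eq := rfl
  convex_range' := by
    simp only [instIsRCLikeNormedField, ↓reduceDIte, halfPlane_range]
    exact halfPlane_convex.convex_isRCLikeNormedField
  nonempty_interior' := by
    rw [halfPlane_range]; exact halfPlane_interior
  continuous_toFun := continuous_subtype_val
  continuous_invFun := halfPlane_continuous_inv

/-- The closed upper half plane as a model for the underlying smooth surfaces with boundary. -/
def halfPlaneℝ : ModelWithCorners ℝ ℂ HalfPlane :=
  ModelWithCorners.ofConvexRange halfPlaneEquiv rfl halfPlane_convex continuous_subtype_val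
    halfPlane_continuous_inv halfPlane_interior

/-- An area form on a Riemann surface: a smooth `2`-form which is positive for the orientation
given by the complex structure. Equivalently, a Riemannian metric in the conformal class. -/
structure AreaForm (S : Type*) [TopologicalSpace S] [ChartedSpace HalfPlane S] where
  form : ∀ x : S, TangentSpace halfPlaneℝ x [⋀^Fin 2]→L[ℝ] ℝ
  smooth : SmoothFormOn halfPlaneℝ form univ
  pos : ∀ (x : S) (v : TangentSpace halfPlaneℝ x), v ≠ 0 →
    0 < form x ![v, tangentJ halfPlaneℝ x v]

/-! ## The compact group, its Lie algebra and its complexification -/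

section Group

variable {V : Type*} [NormedAddCommGroup V] [InnerProductSpace ℂ V] [FiniteDimensional ℂ V]
  [CompleteSpace V]

/-- `exp ξ` as an element of `GL(V)`. -/
def expGL (ξ : V →L[ℂ] V) : (V →L[ℂ] V)ˣ where
  val := NormedSpace.exp ξ
  inv := NormedSpace.exp (-ξ)
  val_inv := by
    let _ : NormedAlgebra ℚ (V →L[ℂ] V) := NormedAlgebra.restrictScalars ℚ ℂ _
    rw [← NormedSpace.exp_add_of_commute ((Commute.refl ξ).neg_right), add_neg_cancel,
      NormedSpace.exp_zero]
  inv_val := by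
    let _ : NormedAlgebra ℚ (V →L[ℂ] V) := NormedAlgebra.restrictScalars ℚ ℂ _
    rw [← NormedSpace.exp_add_of_commute ((Commute.refl ξ).neg_left), neg_add_cancel,
      NormedSpace.exp_zero]

/-- `G` is a compact connected group of unitary transformations of `V`. -/
structure IsCompactConnectedUnitary (G : Subgroup (V →L[ℂ] V)ˣ) : Prop where
  unitary : ∀ k ∈ G, (k : V →L[ℂ] V) ∈ unitary (V →L[ℂ] V)
  compact : IsCompact (G : Set (V →L[ℂ] V)ˣ)
  connected : IsConnected (G : Set (V →L[ℂ] V)ˣ)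

/-- The Lie algebra of a closed linear group. -/
def lieAlg (G : Subgroup (V →L[ℂ] V)ˣ) : Set (V →L[ℂ] V) :=
  {ξ | ∀ t : ℝ, expGL (t • ξ) ∈ G}

/-- The complexification of the compact connected linear group `G` with Lie algebra `𝔤`: the
subgroup of `GL(V)` generated by `G` and `exp (i𝔤)`, i.e. the connected complex Lie subgroup of
`GL(V)` with Lie algebra `𝔤 ⊕ i𝔤`. -/
def complexification (G : Subgroup (V →L[ℂ] V)ˣ) : Subgroup (V →L[ℂ] V)ˣ :=
  Subgroup.closure ((G : Set (V →L[ℂ] V)ˣ) ∪ {g | ∃ ξ ∈ lieAlg G, g = expGL (Complex.I • ξ)})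

/-- An `Ad`-invariant inner product on the Lie algebra of `G` (only the values on the Lie algebra
are relevant). -/
structure InvariantInnerProduct (G : Subgroup (V →L[ℂ] V)ˣ) where
  form : LinearMap.BilinForm ℝ (V →L[ℂ] V)
  symm : ∀ ξ ∈ lieAlg G, ∀ η ∈ lieAlg G, form ξ η = form η ξ
  pos : ∀ ξ ∈ lieAlg G, ξ ≠ 0 → 0 < form ξ ξ
  invariant : ∀ k ∈ G, ∀ ξ ∈ lieAlg G, ∀ η ∈ lieAlg G,
    form ((k : V →L[ℂ] V) * ξ * ((k⁻¹ : (V →L[ℂ] V)ˣ) : V →L[ℂ] V))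
      ((k : V →L[ℂ] V) * η * ((k⁻¹ : (V →L[ℂ] V)ˣ) : V →L[ℂ] V)) = form ξ η

end Group

/-! ## Kähler manifolds and Hamiltonian actions -/

section Target

variable (E : Type*) [NormedAddCommGroup E] [NormedSpace ℂ E]
  (X : Type*) [TopologicalSpace X] [ChartedSpace E X]

/-- A Kähler form on the complex manifold `X`: a closed smooth real `2`-form which is compatible
with the complex structure `J`, i.e. `ω (J v, J w) = ω (v, w)` and `ω (v, J v) > 0`. -/
structure KahlerForm where
  form : ∀ x : X, TangentSpace 𝓘(ℝ, E) x [⋀^Fin 2]→L[ℝ] ℝ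
  smooth : SmoothFormOn 𝓘(ℝ, E) form univ
  closed : ∀ x : X, formDeriv 𝓘(ℝ, E) form x = 0
  compatible : ∀ (x : X) (v w : TangentSpace 𝓘(ℝ, E) x),
    form x ![tangentJ 𝓘(ℝ, E) x v, tangentJ 𝓘(ℝ, E) x w] = form x ![v, w]
  pos : ∀ (x : X) (v : TangentSpace 𝓘(ℝ, E) x), v ≠ 0 →
    0 < form x ![v, tangentJ 𝓘(ℝ, E) x v]

variable {V : Type*} [NormedAddCommGroup V] [InnerProductSpace ℂ V] [FiniteDimensional ℂ V]
  [CompleteSpace V]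

/-- A holomorphic left action of the complex linear group `L ⊆ GL(V)` on the complex manifold `X`
(the values `act g x` for `g ∉ L` are irrelevant). -/
structure HolomorphicAction (L : Subgroup (V →L[ℂ] V)ˣ) where
  act : (V →L[ℂ] V)ˣ → X → X
  one_act : ∀ x, act 1 x = x
  mul_act : ∀ g ∈ L, ∀ h ∈ L, ∀ x, act (g * h) x = act g (act h x)
  holomorphic : ContMDiffOn (𝓘(ℂ, V →L[ℂ] V).prod 𝓘(ℂ, E)) 𝓘(ℂ, E) ∞
    (fun p : (V →L[ℂ] V)ˣ × X => act p.1 p.2) ((L : Set (V →L[ℂ] V)ˣ) ×ˢ univ)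

variable {E X}

/-- The value at `x` of the vector field generated by `ξ`, i.e. the velocity at `t = 0` of
`t ↦ exp (t ξ) x`. -/
def infinitesimalAction {L : Subgroup (V →L[ℂ] V)ˣ} (ρ : HolomorphicAction E X L)
    (ξ : V →L[ℂ] V) (x : X) : TangentSpace 𝓘(ℝ, E) x :=
  (mfderiv 𝓘(ℝ, ℝ) 𝓘(ℝ, E) (fun t : ℝ => ρ.act (expGL (t • ξ)) x) 0 (1 : ℝ) : E)

/-- A moment map for the action of `G` on the Kähler manifold `X`, with values in the Lie algebra
`𝔤`, which is identified with its dual by the chosen invariant inner product: `Φ` is smooth,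
`G`-equivariant and satisfies `d⟨Φ, ξ⟩ = ω(ξ_X, ·)` for all `ξ ∈ 𝔤`. -/
structure MomentMap {G : Subgroup (V →L[ℂ] V)ˣ} (B : InvariantInnerProduct G)
    (Ω : KahlerForm E X) (ρ : HolomorphicAction E X (complexification G)) where
  map : X → (V →L[ℂ] V)
  mem : ∀ x, map x ∈ lieAlg G
  smooth : ContMDiff 𝓘(ℝ, E) 𝓘(ℝ, V →L[ℂ] V) ∞ map
  equivariant : ∀ k ∈ G, ∀ x,
    map (ρ.act k x) = (k : V →L[ℂ] V) * map x * ((k⁻¹ : (V →L[ℂ] V)ˣ) : V →L[ℂ] V)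
  hamiltonian : ∀ ξ ∈ lieAlg G, ∀ (x : X) (v : TangentSpace 𝓘(ℝ, E) x),
    mfderiv 𝓘(ℝ, E) 𝓘(ℝ, ℝ) (fun y => B.form (map y) ξ) x v
      = Ω.form x ![infinitesimalAction ρ ξ x, v]

end Target

/-! ## Principal bundles, connections, gauge transformations -/

section Bundle

variable {V : Type*} [NormedAddCommGroup V] [InnerProductSpace ℂ V] [FiniteDimensional ℂ V]
  [CompleteSpace V]

/-- A smooth principal `G`-bundle on `S`, given by an open cover `U α` with local sections
`s_α : U α → P` and transition functions `trans α β : U α ∩ U β → G`, `s_β = s_α · trans α β`. -/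
structure PrincipalBundle (G : Subgroup (V →L[ℂ] V)ˣ) (S : Type*) [TopologicalSpace S]
    [ChartedSpace HalfPlane S] (ι : Type*) where
  U : ι → Set S
  isOpen : ∀ α, IsOpen (U α)
  cover : ∀ x, ∃ α, x ∈ U α
  trans : ι → ι → S → (V →L[ℂ] V)ˣ
  mem : ∀ α β, ∀ x ∈ U α ∩ U β, trans α β x ∈ G
  smooth : ∀ α β, ContMDiffOn halfPlaneℝ 𝓘(ℝ, V →L[ℂ] V) ∞
    (fun x => (trans α β x : V →L[ℂ] V)) (U α ∩ U β)
  cocycle : ∀ α β γ, ∀ x ∈ U α ∩ U β ∩ U γ, trans α β x * trans β γ x = trans α γ x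

variable {G : Subgroup (V →L[ℂ] V)ˣ} {S : Type*} [TopologicalSpace S] [ChartedSpace HalfPlane S]
  {ι : Type*}

/-- The derivative of an `End(V)`-valued function, as an `End(V)`-valued `1`-form. -/
def dEnd (f : S → (V →L[ℂ] V)ˣ) (x : S) (v : TangentSpace halfPlaneℝ x) : V →L[ℂ] V :=
  mfderiv halfPlaneℝ 𝓘(ℝ, V →L[ℂ] V) (fun y => (f y : V →L[ℂ] V)) x v

/-- The connection form `g A g⁻¹ - (dg) g⁻¹` evaluated on a tangent vector; here `a` is the value
of `A` on that vector. -/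
def gaugeForm (g : S → (V →L[ℂ] V)ˣ) (x : S) (a dg : V →L[ℂ] V) : V →L[ℂ] V :=
  (g x : V →L[ℂ] V) * a * (((g x)⁻¹ : (V →L[ℂ] V)ˣ) : V →L[ℂ] V)
    - dg * (((g x)⁻¹ : (V →L[ℂ] V)ˣ) : V →L[ℂ] V)

/-- A smooth connection on `P`, given by its local `𝔤`-valued `1`-forms `A_α = s_α^* A`. -/
structure PrincipalBundle.Connection (P : PrincipalBundle G S ι) where
  form : ι → ∀ x : S, TangentSpace halfPlaneℝ x [⋀^Fin 1]→L[ℝ] (V →L[ℂ] V)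
  mem : ∀ α, ∀ x ∈ P.U α, ∀ v : TangentSpace halfPlaneℝ x, form α x ![v] ∈ lieAlg G
  smooth : ∀ α, SmoothFormOn halfPlaneℝ (form α) (P.U α)
  compat : ∀ α β, ∀ x ∈ P.U α ∩ P.U β, ∀ v : TangentSpace halfPlaneℝ x,
    form α x ![v] = gaugeForm (P.trans α β) x (form β x ![v]) (dEnd (P.trans α β) x v)

/-- The curvature `F_A = dA + ½[A ∧ A]` in the local trivialisation `α`. -/
def PrincipalBundle.Connection.curvature {P : PrincipalBundle G S ι} (A : P.Connection) (α : ι)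
    (x : S) (v w : TangentSpace halfPlaneℝ x) : V →L[ℂ] V :=
  formDeriv halfPlaneℝ (A.form α) x ![v, w]
    + (A.form α x ![v] * A.form α x ![w] - A.form α x ![w] * A.form α x ![v])

/-- The `(0,1)`-part `A^{0,1} = ½ (A + i A ∘ j)` of the local connection form. -/
def PrincipalBundle.Connection.form01 {P : PrincipalBundle G S ι} (A : P.Connection) (α : ι)
    (x : S) (v : TangentSpace halfPlaneℝ x) : V →L[ℂ] V :=
  (1 / 2 : ℂ) • (A.form α x ![v] + Complex.I • A.form α x ![tangentJ halfPlaneℝ x v])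

/-- `∂̄ f = ½ (df + i df ∘ j)` for an `End(V)`-valued function. -/
def dbarEnd (f : S → (V →L[ℂ] V)ˣ) (x : S) (v : TangentSpace halfPlaneℝ x) : V →L[ℂ] V :=
  (1 / 2 : ℂ) • (dEnd f x v + Complex.I • dEnd f x (tangentJ halfPlaneℝ x v))

/-- A complex gauge transformation: a smooth section `g` of `P ×_G G_ℂ`, where `G` acts on `G_ℂ` by
conjugation, given by its local representatives `g_α : U α → G_ℂ`. -/
structure PrincipalBundle.ComplexGauge (P : PrincipalBundle G S ι) where
  map : ι → S → (V →L[ℂ] V)ˣ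
  mem : ∀ α, ∀ x ∈ P.U α, map α x ∈ complexification G
  smooth : ∀ α, ContMDiffOn halfPlaneℝ 𝓘(ℝ, V →L[ℂ] V) ∞
    (fun x => (map α x : V →L[ℂ] V)) (P.U α)
  compat : ∀ α β, ∀ x ∈ P.U α ∩ P.U β,
    map α x = P.trans α β x * map β x * (P.trans α β x)⁻¹

/-- `g` takes values in `G` over the set `s`. For `s = univ` this says that `g` is a (unitary) gauge
transformation. -/
def PrincipalBundle.ComplexGauge.IsUnitaryOn {P : PrincipalBundle G S ι} (g : P.ComplexGauge)
    (s : Set S) : Prop :=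
  ∀ α, ∀ x ∈ P.U α ∩ s, g.map α x ∈ G

variable {E : Type*} [NormedAddCommGroup E] [NormedSpace ℂ E]
  {X : Type*} [TopologicalSpace X] [ChartedSpace E X]

/-- A smooth section of the associated bundle `P(X) = (P × X) / G`, given by its local
representatives `u_α : U α → X`. -/
structure PrincipalBundle.AssocSection (P : PrincipalBundle G S ι)
    (ρ : HolomorphicAction E X (complexification G)) where
  map : ι → S → X
  smooth : ∀ α, ContMDiffOn halfPlaneℝ 𝓘(ℝ, E) ∞ (map α) (P.U α)
  compat : ∀ α β, ∀ x ∈ P.U α ∩ P.U β, map α x = ρ.act (P.trans α β x) (map β x)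

variable {P : PrincipalBundle G S ι} {ρ : HolomorphicAction E X (complexification G)}

/-- The twisted derivative `d_A u = du + A_u` in the local trivialisation `α`. -/
def twistedDeriv (A : P.Connection) (u : P.AssocSection ρ) (α : ι) (x : S)
    (v : TangentSpace halfPlaneℝ x) : TangentSpace 𝓘(ℝ, E) (u.map α x) :=
  mfderiv halfPlaneℝ 𝓘(ℝ, E) (u.map α) x v
    + infinitesimalAction ρ (A.form α x ![v]) (u.map α x)

/-- `(A, u)` is a gauged holomorphic map: `∂̄_A u = ½ (d_A u + J d_A u ∘ j) = 0`. -/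
def IsGaugedHolomorphic (A : P.Connection) (u : P.AssocSection ρ) : Prop :=
  ∀ α, ∀ x ∈ P.U α, ∀ v : TangentSpace halfPlaneℝ x,
    (1 / 2 : ℝ) • (twistedDeriv A u α x v
      + tangentJ 𝓘(ℝ, E) (u.map α x) (twistedDeriv A u α x (tangentJ halfPlaneℝ x v))) = 0

/-- `(A, u)` is a symplectic vortex: a gauged holomorphic map with
`F_{A,u} = F_A + Φ(u) dvol = 0`. -/
structure IsVortex {B : InvariantInnerProduct G} {Ω : KahlerForm E X} (Φ : MomentMap B Ω ρ)
    (dvol : AreaForm S) (A : P.Connection) (u : P.AssocSection ρ) : Prop where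
  holomorphic : IsGaugedHolomorphic A u
  curvature_eq : ∀ α, ∀ x ∈ P.U α, ∀ v w : TangentSpace halfPlaneℝ x,
    A.curvature α x v w + dvol.form x ![v, w] • Φ.map (u.map α x) = 0

/-- `(A', u') = g (A, u)` for a complex gauge transformation `g`: `u' = g u`, and `A'` is the
connection with `∂̄_{A'} = g ∘ ∂̄_A ∘ g⁻¹`, i.e. its local `(0,1)`-forms are
`g A^{0,1} g⁻¹ - (∂̄g) g⁻¹`. (A `𝔤`-valued form is determined by its `(0,1)`-part.) -/
def PrincipalBundle.ComplexGauge.Maps (g : P.ComplexGauge) (A : P.Connection)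
    (u : P.AssocSection ρ) (A' : P.Connection) (u' : P.AssocSection ρ) : Prop :=
  ∀ α, ∀ x ∈ P.U α, u'.map α x = ρ.act (g.map α x) (u.map α x) ∧
    ∀ v : TangentSpace halfPlaneℝ x,
      A'.form01 α x v = gaugeForm (g.map α) x (A.form01 α x v) (dbarEnd (g.map α) x v)

/-- `(A, u)` and `(A', u')` are gauge equivalent: there is a gauge transformation `k` (with values
in `G`) such that `A' = k A k⁻¹ - (dk) k⁻¹` and `u' = k u`. -/
def GaugeEquivalent (A : P.Connection) (u : P.AssocSection ρ) (A' : P.Connection)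
    (u' : P.AssocSection ρ) : Prop :=
  ∃ k : P.ComplexGauge, k.IsUnitaryOn univ ∧
    ∀ α, ∀ x ∈ P.U α, u'.map α x = ρ.act (k.map α x) (u.map α x) ∧
      ∀ v : TangentSpace halfPlaneℝ x,
        A'.form α x ![v] = gaugeForm (k.map α) x (A.form α x ![v]) (dEnd (k.map α) x v)

end Bundle

end

/-!
A complex gauge transformation relating two symplectic vortices is compared with its unitary part.

Every `g ∈ G_ℂ` has a polar decomposition `g = k e^{iξ}` with `k ∈ G` and `ξ ∈ 𝔤`
(`polarLog_mem`, `mul_expGL_neg_polarLog_mem`). It is derived from two facts about the Zariski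
closure `Z` of `G` in `GL(V)`. First, `Z ∩ U(V) = G` (`mem_of_mem_zariskiClosure`): a regular
function which nearly separates `G` from a coset `k G` becomes, after averaging, constant on `G`
with a different value at `k`. Second, `G_ℂ ⊆ Z`, because regular functions restrict to exponential
polynomials on one-parameter groups `e^{zχ}`, `χ` self-adjoint, and such a function vanishes
identically as soon as it vanishes for `z ∈ iℝ` or for `z ∈ 2ℕ` (`expPolynomials_eq_zero`). If `g ∈ G_ℂ` and `g* g = e^{2χ}`, all
powers of `g* g` lie in `Z`, hence so does every `e^{zχ}`; for `z ∈ iℝ` these are unitary, so that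
`χ ∈ i𝔤`.

Now let `g = k e^{iξ}` map the vortex `(A, u)` to the vortex `(A', u')`. The squared length `|ξ|²`
is a well-defined function on the surface. In a holomorphic coordinate it satisfies the identity
`planeLaplacian_normSq_polarLog`, which has the shape
`¼ Δ|ξ|² = ½ λ (⟨Φ(e^{iξ} u), ξ⟩ - ⟨Φ(u), ξ⟩) + 2 |e^{-sχ} (∂_A χ) e^{sχ}|²`, where `χ = iξ`,
`dvol = λ dx ∧ dy` and `s` is a real number which depends on the point. The first term comes from
the vortex equations: if `h = e^{2χ} = g* g`, the curvature of `A'`, transported back by `g`,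
differs from that of `A` by `∂̄_A (h⁻¹ ∂_A h)`, and pairing `h⁻¹ ∂_A h` with `ξ` yields the
derivative of `|ξ|²`. The difference of moment maps is nonnegative, since `s ↦ ⟨Φ(e^{isξ} x), ξ⟩`
has derivative `|ξ_X|²`, and it vanishes only if `e^{iξ}` fixes `u` (`MomentMap.complexForm_le`).
So `|ξ|²` is subharmonic, and by the strong maximum principle (`eqOn_of_planeLaplacian_nonneg`) the
set where it attains its maximum over the compact connected surface is open and closed, unless it
meets the boundary (`isUnitaryOn_or_const`).

If the boundary meets that set, in particular if there is any boundary at all, then `ξ = 0` and `g`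
is unitary. Otherwise `|ξ|²` is constant, both terms on the right vanish, `ξ` is covariantly
constant and `e^{iξ}` fixes `u`; hence `k` acts on `(A, u)` in the same way as `g`
(`unitaryPart_maps_of_eventually_eq`). For a unitary gauge transformation, the `(0,1)`-part of the
transformed connection determines the connection (`eq_gaugeForm_of_form01`).
-/

noncomputable section

set_option linter.unusedSectionVars false
set_option linter.unusedSimpArgs false

/-! ### The exponential in a Banach algebra -/

section ExpCalculus

variable {𝔸 : Type*} [NormedRing 𝔸] [NormedAlgebra ℂ 𝔸] [CompleteSpace 𝔸]

theorem exp_add_of_comm {a b : 𝔸} (h : Commute a b) :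
    NormedSpace.exp (a + b) = NormedSpace.exp a * NormedSpace.exp b := by
  let _ : NormedAlgebra ℚ 𝔸 := NormedAlgebra.restrictScalars ℚ ℂ _
  exact NormedSpace.exp_add_of_commute h

theorem exp_neg_mul_exp (a : 𝔸) : NormedSpace.exp (-a) * NormedSpace.exp a = 1 := by
  rw [← exp_add_of_comm ((Commute.refl a).neg_left), neg_add_cancel, NormedSpace.exp_zero]

theorem exp_mul_exp_neg (a : 𝔸) : NormedSpace.exp a * NormedSpace.exp (-a) = 1 := by
  rw [← exp_add_of_comm ((Commute.refl a).neg_right), add_neg_cancel, NormedSpace.exp_zero]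

theorem contDiff_exp_complex {n : ℕ∞ω} : ContDiff ℂ n (NormedSpace.exp : 𝔸 → 𝔸) :=
  contDiff_iff_contDiffAt.2 fun x => (NormedSpace.exp_analytic (𝕂 := ℂ) x).contDiffAt

theorem contDiff_exp_real {n : ℕ∞ω} : ContDiff ℝ n (NormedSpace.exp : 𝔸 → 𝔸) :=
  contDiff_exp_complex.restrict_scalars ℝ

theorem hasFDerivAt_exp_fderiv (a : 𝔸) :
    HasFDerivAt NormedSpace.exp (fderiv ℂ (NormedSpace.exp : 𝔸 → 𝔸) a) a :=
  ((contDiff_exp_complex (n := 1)).differentiable one_ne_zero a).hasFDerivAt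

theorem hasDerivAt_exp_smul (a : 𝔸) (s : ℝ) :
    HasDerivAt (fun s : ℝ => NormedSpace.exp (s • a)) (a * NormedSpace.exp (s • a)) s :=
  hasDerivAt_exp_smul_const' a s

theorem commute_exp_smul (a : 𝔸) (s : ℝ) : Commute a (NormedSpace.exp (s • a)) :=
  ((Commute.refl a).smul_right s).exp_right

theorem fderiv_exp_apply_self (a : 𝔸) :
    fderiv ℂ (NormedSpace.exp : 𝔸 → 𝔸) a a = a * NormedSpace.exp a := by
  have h1 : HasDerivAt (fun s : ℂ => NormedSpace.exp (s • a)) (a * NormedSpace.exp a) 1 := by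
    simpa using hasDerivAt_exp_smul_const' a (1 : ℂ)
  have h2 : HasDerivAt (fun s : ℂ => s • a) a 1 := by
    simpa using (hasDerivAt_id (1 : ℂ)).smul_const a
  have h3 := (hasFDerivAt_exp_fderiv ((1 : ℂ) • a)).comp_hasDerivAt (1 : ℂ) h2
  simpa using h3.unique h1

theorem differentiable_fderiv_exp : Differentiable ℂ (fderiv ℂ (NormedSpace.exp : 𝔸 → 𝔸)) :=
  ((contDiff_exp_complex (n := 2)).fderiv_right (m := 1) (by norm_num)).differentiable one_ne_zero

theorem fderiv_fderiv_exp_symm (a v w : 𝔸) :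
    fderiv ℂ (fderiv ℂ (NormedSpace.exp : 𝔸 → 𝔸)) a v w
      = fderiv ℂ (fderiv ℂ (NormedSpace.exp : 𝔸 → 𝔸)) a w v :=
  second_derivative_symmetric_of_eventually
    (Filter.Eventually.of_forall fun y => hasFDerivAt_exp_fderiv y)
    (differentiable_fderiv_exp a).hasFDerivAt v w

/-- The derivative of the identity `D exp (b) b = b exp b` in the direction `η`. -/
theorem fderiv_fderiv_exp_apply_self (b η : 𝔸) :
    fderiv ℂ (fderiv ℂ (NormedSpace.exp : 𝔸 → 𝔸)) b η b
      + fderiv ℂ (NormedSpace.exp : 𝔸 → 𝔸) b η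
      = η * NormedSpace.exp b + b * fderiv ℂ (NormedSpace.exp : 𝔸 → 𝔸) b η := by
  have e : HasDerivAt (fun t : ℂ => b + t • η) η 0 := by
    simpa using ((hasDerivAt_id (0 : ℂ)).smul_const η).const_add b
  have e0 : b + (0 : ℂ) • η = b := by simp
  have h1 : HasDerivAt (fun t : ℂ => fderiv ℂ (NormedSpace.exp : 𝔸 → 𝔸) (b + t • η))
      (fderiv ℂ (fderiv ℂ (NormedSpace.exp : 𝔸 → 𝔸)) b η) 0 :=
    HasFDerivAt.comp_hasDerivAt (0 : ℂ)
      (by rw [e0]; exact (differentiable_fderiv_exp b).hasFDerivAt) e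
  have h2 : HasDerivAt (fun t : ℂ => NormedSpace.exp (b + t • η))
      (fderiv ℂ (NormedSpace.exp : 𝔸 → 𝔸) b η) 0 :=
    HasFDerivAt.comp_hasDerivAt (0 : ℂ) (by rw [e0]; exact hasFDerivAt_exp_fderiv b) e
  have h3 := h1.clm_apply e
  have h4 := e.mul h2
  simp only [fderiv_exp_apply_self] at h3
  have h5 := h3.unique h4
  rwa [e0] at h5

theorem hasDerivAt_fderiv_exp_smul (a η : 𝔸) (s : ℂ) :
    HasDerivAt (fun s : ℂ => fderiv ℂ (NormedSpace.exp : 𝔸 → 𝔸) (s • a) (s • η))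
      (η * NormedSpace.exp (s • a)
        + a * fderiv ℂ (NormedSpace.exp : 𝔸 → 𝔸) (s • a) (s • η)) s := by
  have e1 : HasDerivAt (fun s : ℂ => s • a) a s := by simpa using (hasDerivAt_id s).smul_const a
  have e2 : HasDerivAt (fun s : ℂ => s • η) η s := by simpa using (hasDerivAt_id s).smul_const η
  have h0 : HasDerivAt (fun s : ℂ => fderiv ℂ (NormedSpace.exp : 𝔸 → 𝔸) (s • a))
      (fderiv ℂ (fderiv ℂ (NormedSpace.exp : 𝔸 → 𝔸)) (s • a) a) s :=
    (differentiable_fderiv_exp (s • a)).hasFDerivAt.comp_hasDerivAt s e1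
  have h1 := h0.clm_apply e2
  refine h1.congr_deriv ?_
  have h6 := fderiv_fderiv_exp_symm (s • a) a (s • η)
  have h7 := fderiv_fderiv_exp_apply_self (s • a) η
  rw [h6, map_smul, map_smul, smul_apply, mul_smul_comm, ← smul_mul_assoc, ← h7,
    map_smul]

/-- Duhamel's formula for the derivative of the exponential, in differentiated form. -/
theorem hasDerivAt_exp_neg_mul_fderiv_exp (a η : 𝔸) (s : ℝ) :
    HasDerivAt (fun s : ℝ => NormedSpace.exp (-(s • a))
        * fderiv ℂ (NormedSpace.exp : 𝔸 → 𝔸) (s • a) (s • η))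
      (NormedSpace.exp (-(s • a)) * η * NormedSpace.exp (s • a)) s := by
  have h1 : HasDerivAt (fun s : ℝ => fderiv ℂ (NormedSpace.exp : 𝔸 → 𝔸) (s • a) (s • η))
      (η * NormedSpace.exp (s • a)
        + a * fderiv ℂ (NormedSpace.exp : 𝔸 → 𝔸) (s • a) (s • η)) s :=
    ((hasDerivAt_fderiv_exp_smul a η (s : ℂ)).scomp s Complex.ofRealCLM.hasDerivAt).congr_deriv
      (by rw [Complex.ofRealCLM_apply, Complex.ofReal_one, one_smul]; rfl)
  have h2 : HasDerivAt (fun s : ℝ => NormedSpace.exp (-(s • a)))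
      (-a * NormedSpace.exp (-(s • a))) s := by
    simpa using hasDerivAt_exp_smul (-a) s
  have hc : Commute a (NormedSpace.exp (-(s • a))) := by
    simpa using commute_exp_smul (-a) s
  refine (h2.mul h1).congr_deriv ?_
  rw [neg_mul, hc.eq]
  noncomm_ring

/-- The logarithmic derivative `h⁻¹ (∂h) + h⁻¹ β h - β` of `h = exp (s a)`, where `η = ∂a`, has
`s`-derivative `h⁻¹ (∂a + [β, a]) h`. -/
theorem hasDerivAt_logDeriv_exp (a η β : 𝔸) (s : ℝ) :
    HasDerivAt (fun s : ℝ => NormedSpace.exp (-(s • a))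
        * fderiv ℂ (NormedSpace.exp : 𝔸 → 𝔸) (s • a) (s • η)
        + (NormedSpace.exp (-(s • a)) * β * NormedSpace.exp (s • a) - β))
      (NormedSpace.exp (-(s • a)) * (η + (β * a - a * β)) * NormedSpace.exp (s • a)) s := by
  have h2 : HasDerivAt (fun s : ℝ => NormedSpace.exp (-(s • a)))
      (-a * NormedSpace.exp (-(s • a))) s := by
    simpa using hasDerivAt_exp_smul (-a) s
  have hc : Commute a (NormedSpace.exp (-(s • a))) := by
    simpa using commute_exp_smul (-a) s
  refine ((hasDerivAt_exp_neg_mul_fderiv_exp a η s).add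
    (((h2.mul_const β).mul (hasDerivAt_exp_smul a s)).sub_const β)).congr_deriv ?_
  rw [neg_mul, hc.eq]
  noncomm_ring

theorem hasDerivAt_exp_conj (a η : 𝔸) (s : ℝ) :
    HasDerivAt (fun s : ℝ => NormedSpace.exp (s • a) * η * NormedSpace.exp (-(s • a)))
      (a * (NormedSpace.exp (s • a) * η * NormedSpace.exp (-(s • a)))
        - NormedSpace.exp (s • a) * η * NormedSpace.exp (-(s • a)) * a) s := by
  have h2 : HasDerivAt (fun s : ℝ => NormedSpace.exp (-(s • a)))
      (-a * NormedSpace.exp (-(s • a))) s := by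
    simpa using hasDerivAt_exp_smul (-a) s
  have hc : Commute a (NormedSpace.exp (-(s • a))) := by
    simpa using commute_exp_smul (-a) s
  refine (((hasDerivAt_exp_smul a s).mul_const η).mul h2).congr_deriv ?_
  rw [neg_mul, hc.eq]
  noncomm_ring

/-- A closed subspace which is stable under the bracket with `a` is stable under conjugation by
`e^a`, because this conjugation is the exponential of the bracket with `a`. -/
theorem exp_conj_mem {W : Submodule ℂ 𝔸} (hW : IsClosed (W : Set 𝔸)) {a : 𝔸}
    (ha : ∀ w ∈ W, a * w - w * a ∈ W) {w : 𝔸} (hw : w ∈ W) :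
    NormedSpace.exp a * w * NormedSpace.exp (-a) ∈ W := by
  let L : 𝔸 →L[ℂ] 𝔸 := ContinuousLinearMap.mul ℂ 𝔸 a
  let R : 𝔸 →L[ℂ] 𝔸 := (ContinuousLinearMap.mul ℂ 𝔸).flip a
  have hLR : Commute L (-R) := by
    have h : Commute L R := by
      ext x
      simp [L, R, mul_assoc]
    exact h.neg_right
  have hexp : ∀ (T : 𝔸 →L[ℂ] 𝔸) (x : 𝔸),
      HasSum (fun n : ℕ => (n.factorial⁻¹ : ℂ) • (T ^ n) x) (NormedSpace.exp T x) := fun T x => by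
    have h := NormedSpace.exp_series_hasSum_exp' (𝕂 := ℂ) T
    simpa using (ContinuousLinearMap.apply ℂ 𝔸 x).hasSum h
  have hL : NormedSpace.exp L = ContinuousLinearMap.mul ℂ 𝔸 (NormedSpace.exp a) := by
    ext x
    refine (hexp L x).unique ?_
    have h := (NormedSpace.exp_series_hasSum_exp' (𝕂 := ℂ) a).mul_right x
    have hp : ∀ n : ℕ, (L ^ n) x = a ^ n * x := fun n => by
      induction n with
      | zero => simp
      | succ n ih => rw [pow_succ', mul_apply_eq_comp, ih, pow_succ', mul_assoc]; rfl
    simpa [hp] using h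
  have hR : NormedSpace.exp (-R) = (ContinuousLinearMap.mul ℂ 𝔸).flip (NormedSpace.exp (-a)) := by
    ext x
    refine (hexp (-R) x).unique ?_
    have h := (NormedSpace.exp_series_hasSum_exp' (𝕂 := ℂ) (-a)).mul_left x
    have hp : ∀ n : ℕ, ((-R) ^ n) x = x * (-a) ^ n := fun n => by
      induction n with
      | zero => simp
      | succ n ih =>
        rw [pow_succ', mul_apply_eq_comp, ih, pow_succ, ← mul_assoc, mul_neg]; rfl
    simpa [hp] using h
  have hsum := hexp (L + -R) w
  rw [exp_add_of_comm hLR, hL, hR] at hsum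
  have hmem : ∀ n : ℕ, ((L + -R) ^ n) w ∈ W := fun n => by
    induction n with
    | zero => simpa using hw
    | succ n ih =>
      rw [pow_succ', mul_apply_eq_comp]
      simpa [L, R, sub_eq_add_neg] using ha _ ih
  have := hW.mem_of_tendsto hsum (Filter.Eventually.of_forall fun s =>
    W.sum_mem fun n _ => W.smul_mem _ (hmem n))
  simpa [mul_assoc] using this

end ExpCalculus

/-! ### Smoothness of the logarithm of positive operators -/

section Log

variable {𝔸 : Type*} [CStarAlgebra 𝔸] [FiniteDimensional ℂ 𝔸]

/-- The exponential is an immersion at the self-adjoint elements. -/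
theorem fderiv_exp_injective {a : 𝔸} (ha : IsSelfAdjoint a) :
    Injective (fderiv ℂ (NormedSpace.exp : 𝔸 → 𝔸) a) := by
  refine (injective_iff_map_eq_zero _).2 fun η hη => ?_
  -- Differentiating `x * exp x = exp x * x` shows that `η` commutes with `exp a`, hence with `a`.
  have h3 : HasFDerivAt (fun b : 𝔸 => b * NormedSpace.exp b) _ a :=
    (hasFDerivAt_id (𝕜 := ℂ) a).mul' (hasFDerivAt_exp_fderiv a)
  have h4 : HasFDerivAt (fun b : 𝔸 => NormedSpace.exp b * b) _ a :=
    (hasFDerivAt_exp_fderiv a).mul' (hasFDerivAt_id (𝕜 := ℂ) a)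
  have h5 : (fun b : 𝔸 => b * NormedSpace.exp b) = fun b : 𝔸 => NormedSpace.exp b * b :=
    funext fun b => (Commute.refl b).exp_right.eq
  rw [h5] at h3
  have h6 := congrArg (fun T : 𝔸 →L[ℂ] 𝔸 => T η) (h3.unique h4)
  simp [hη] at h6
  have hcomm : Commute (NormedSpace.exp a) η := h6.symm
  have hcomm' : Commute a η := by
    rw [← CFC.log_exp a ha]
    exact hcomm.cfc_real _
  have h7 : HasDerivAt (fun t : ℂ => NormedSpace.exp (a + t • η)) 0 0 := by
    have e : HasDerivAt (fun t : ℂ => a + t • η) η 0 := by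
      simpa using ((hasDerivAt_id (0 : ℂ)).smul_const η).const_add a
    have := (by simpa using hasFDerivAt_exp_fderiv a : HasFDerivAt NormedSpace.exp
      (fderiv ℂ (NormedSpace.exp : 𝔸 → 𝔸) a) (a + (0 : ℂ) • η)).comp_hasDerivAt (0 : ℂ) e
    rwa [hη] at this
  have h8 : HasDerivAt (fun t : ℂ => NormedSpace.exp (a + t • η)) (NormedSpace.exp a * η) 0 := by
    have e : (fun t : ℂ => NormedSpace.exp (a + t • η))
        = fun t : ℂ => NormedSpace.exp a * NormedSpace.exp (t • η) :=
      funext fun t => exp_add_of_comm (hcomm'.smul_right t)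
    rw [e]
    simpa using (hasDerivAt_exp_smul_const' η (0 : ℂ)).const_mul (NormedSpace.exp a)
  have h9 := h8.unique h7
  calc η = NormedSpace.exp (-a) * (NormedSpace.exp a * η) := by
        rw [← mul_assoc, exp_neg_mul_exp, one_mul]
    _ = 0 := by rw [h9, mul_zero]

/-- Near the exponential of a self-adjoint element, the self-adjoint logarithm is given by a smooth
function. -/
theorem exists_contDiffAt_log {a : 𝔸} (ha : IsSelfAdjoint a) :
    ∃ l : 𝔸 → 𝔸, ContDiffAt ℝ ∞ l (NormedSpace.exp a) ∧
      ∀ᶠ b in 𝓝 (NormedSpace.exp a), ∀ c, IsSelfAdjoint c → NormedSpace.exp c = b → l b = c := by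
  have hexp : ContDiffAt ℝ ∞ (NormedSpace.exp : 𝔸 → 𝔸) a := contDiff_exp_real.contDiffAt
  let D := (fderiv ℂ (NormedSpace.exp : 𝔸 → 𝔸) a).restrictScalars ℝ
  have hinj : Injective D := fderiv_exp_injective ha
  have _ : FiniteDimensional ℝ 𝔸 := FiniteDimensional.complexToReal 𝔸
  let e : 𝔸 ≃L[ℝ] 𝔸 :=
    (LinearEquiv.ofInjectiveEndo (D : 𝔸 →ₗ[ℝ] 𝔸) hinj).toContinuousLinearEquiv
  have he : HasFDerivAt (NormedSpace.exp : 𝔸 → 𝔸) (e : 𝔸 →L[ℝ] 𝔸) a := by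
    have h := (hasFDerivAt_exp_fderiv a).restrictScalars ℝ
    exact h
  have hn : (∞ : ℕ∞ω) ≠ 0 := by simp
  set l := hexp.localInverse he hn with hl
  have hcd : ContDiffAt ℝ ∞ l (NormedSpace.exp a) := hexp.to_localInverse he hn
  have hs := hexp.hasStrictFDerivAt' he hn
  have hla : l (NormedSpace.exp a) = a := hs.localInverse_apply_image
  have hright : ∀ᶠ b in 𝓝 (NormedSpace.exp a), NormedSpace.exp (l b) = b :=
    hs.eventually_right_inverse
  have hleft : ∀ᶠ x in 𝓝 a, l (NormedSpace.exp x) = x := hs.eventually_left_inverse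
  have ht : Filter.Tendsto l (𝓝 (NormedSpace.exp a)) (𝓝 a) := by
    simpa [hla] using hcd.continuousAt.tendsto
  have ht' : Filter.Tendsto (fun b => star (l b)) (𝓝 (NormedSpace.exp a)) (𝓝 a) := by
    have := (continuous_star.tendsto a).comp ht
    rwa [ha.star_eq] at this
  refine ⟨l, hcd, ?_⟩
  filter_upwards [hright, ht'.eventually hleft] with b hb1 hb2 c hc hcb
  have hsb : IsSelfAdjoint b := hcb ▸ hc.exp
  have h1 : IsSelfAdjoint (l b) := by
    rw [← NormedSpace.star_exp, hb1, hsb.star_eq] at hb2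
    exact hb2.symm
  rw [← CFC.log_exp c hc, ← CFC.log_exp (l b) h1, hb1, hcb]

end Log

/-! ### Derivatives and subspaces -/

section Subspace

variable {𝔸 : Type*} [NormedAddCommGroup 𝔸] [NormedSpace ℝ 𝔸]

theorem hasDerivAt_mem_of_eventually_mem {W : Submodule ℝ 𝔸} (hW : IsClosed (W : Set 𝔸))
    {c : ℝ → 𝔸} {c' : 𝔸} {t : ℝ} (h : HasDerivAt c c' t) (hc : ∀ᶠ s in 𝓝 t, c s ∈ W) : c' ∈ W := by
  have h1 := h.tendsto_slope_zero
  have h2 : ∀ᶠ s in 𝓝[≠] (0 : ℝ), s⁻¹ • (c (t + s) - c t) ∈ (W : Set 𝔸) := by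
    have h3 : Filter.Tendsto (fun s : ℝ => t + s) (𝓝[≠] 0) (𝓝 t) := by
      have : Filter.Tendsto (fun s : ℝ => t + s) (𝓝 0) (𝓝 (t + 0)) :=
        (continuous_const.add continuous_id).tendsto 0
      rw [add_zero] at this
      exact this.mono_left nhdsWithin_le_nhds
    filter_upwards [h3.eventually hc] with s hs
    exact W.smul_mem _ (W.sub_mem hs hc.self_of_nhds)
  exact hW.mem_of_tendsto h1 h2

theorem hasFDerivAt_mem_of_eventually_mem {F : Type*} [NormedAddCommGroup F] [NormedSpace ℝ F]
    {W : Submodule ℝ 𝔸} (hW : IsClosed (W : Set 𝔸))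
    {c : F → 𝔸} {c' : F →L[ℝ] 𝔸} {x : F} (h : HasFDerivAt c c' x) (hc : ∀ᶠ y in 𝓝 x, c y ∈ W)
    (v : F) : c' v ∈ W := by
  have e : HasDerivAt (fun t : ℝ => x + t • v) v 0 := by
    simpa using ((hasDerivAt_id (0 : ℝ)).smul_const v).const_add x
  have e0 : x + (0 : ℝ) • v = x := by simp
  have h1 : HasDerivAt (fun t : ℝ => c (x + t • v)) (c' v) 0 :=
    HasFDerivAt.comp_hasDerivAt (0 : ℝ) (by rwa [e0]) e
  refine hasDerivAt_mem_of_eventually_mem hW h1 ?_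
  have h2 : Filter.Tendsto (fun t : ℝ => x + t • v) (𝓝 0) (𝓝 x) := by
    have := e.continuousAt.tendsto
    rwa [e0] at this
  exact h2.eventually hc

/-- A curve which starts in a subspace and whose velocity stays in it remains in the subspace. -/
theorem mem_of_hasDerivAt_mem [FiniteDimensional ℝ 𝔸] (W : Submodule ℝ 𝔸) {c c' : ℝ → 𝔸}
    (h : ∀ t, HasDerivAt c (c' t) t) (hc' : ∀ t, c' t ∈ W) (h0 : c 0 ∈ W) (t : ℝ) : c t ∈ W := by
  by_contra hn
  obtain ⟨f, hf, hW⟩ := W.exists_le_ker_of_notMem hn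
  let l := LinearMap.toContinuousLinearMap f
  have h1 : ∀ t, HasDerivAt (fun s => l (c s)) 0 t := fun t => by
    have := l.hasFDerivAt.comp_hasDerivAt t (h t)
    have h2 : l (c' t) = 0 := hW (hc' t)
    rwa [h2] at this
  have h3 := is_const_of_deriv_eq_zero (fun t => (h1 t).differentiableAt)
    (fun t => (h1 t).deriv) t 0
  have h4 : l (c 0) = 0 := hW h0
  exact hf (h3.trans h4)

end Subspace

/-! ### The Lie algebra of a compact linear group -/

section LieAlgebra

variable {V : Type*} [NormedAddCommGroup V] [InnerProductSpace ℂ V] [FiniteDimensional ℂ V]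
  [CompleteSpace V] {G : Subgroup (V →L[ℂ] V)ˣ}

theorem expGL_coe (ξ : V →L[ℂ] V) : (expGL ξ : V →L[ℂ] V) = NormedSpace.exp ξ := rfl

theorem expGL_inv_coe (ξ : V →L[ℂ] V) :
    (((expGL ξ)⁻¹ : (V →L[ℂ] V)ˣ) : V →L[ℂ] V) = NormedSpace.exp (-ξ) := rfl

theorem expGL_zero : expGL (0 : V →L[ℂ] V) = 1 := Units.ext NormedSpace.exp_zero

theorem expGL_add_of_comm {a b : V →L[ℂ] V} (h : Commute a b) :
    expGL (a + b) = expGL a * expGL b := Units.ext (exp_add_of_comm h)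

theorem expGL_conj (k : (V →L[ℂ] V)ˣ) (ξ : V →L[ℂ] V) :
    expGL ((k : V →L[ℂ] V) * ξ * ((k⁻¹ : (V →L[ℂ] V)ˣ) : V →L[ℂ] V)) = k * expGL ξ * k⁻¹ := by
  let _ : NormedAlgebra ℚ (V →L[ℂ] V) := NormedAlgebra.restrictScalars ℚ ℂ _
  exact Units.ext (NormedSpace.exp_units_conj k ξ)

theorem star_mul_self_of_mem (hG : IsCompactConnectedUnitary G) {k : (V →L[ℂ] V)ˣ} (hk : k ∈ G) :
    star (k : V →L[ℂ] V) * k = 1 := (Unitary.mem_iff.1 (hG.unitary k hk)).1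

theorem star_eq_inv_of_mem (hG : IsCompactConnectedUnitary G) {k : (V →L[ℂ] V)ˣ} (hk : k ∈ G) :
    star (k : V →L[ℂ] V) = ((k⁻¹ : (V →L[ℂ] V)ˣ) : V →L[ℂ] V) :=
  (Units.inv_eq_of_mul_eq_one_left (star_mul_self_of_mem hG hk)).symm

theorem norm_le_one_of_star_mul_self {k : V →L[ℂ] V} (h : star k * k = 1) : ‖k‖ ≤ 1 := by
  have h1 : ‖k‖ * ‖k‖ ≤ 1 := by
    rw [← CStarRing.norm_star_mul_self, h]
    exact ContinuousLinearMap.norm_id_le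
  nlinarith [norm_nonneg k]

theorem norm_pow_sub_pow_le {𝔸 : Type*} [NormedRing 𝔸] {a b : 𝔸} (ha : ‖a‖ ≤ 1)
    (hb : ‖b‖ ≤ 1) (h1 : ‖(1 : 𝔸)‖ ≤ 1) (n : ℕ) : ‖a ^ n - b ^ n‖ ≤ n * ‖a - b‖ := by
  have hbn : ∀ n : ℕ, ‖b ^ n‖ ≤ 1 := fun n => by
    induction n with
    | zero => simpa using h1
    | succ n ih =>
      rw [pow_succ]
      exact (norm_mul_le _ _).trans (mul_le_one₀ ih (norm_nonneg _) hb)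
  induction n with
  | zero => simp
  | succ n ih =>
    have e : a ^ (n + 1) - b ^ (n + 1) = a * (a ^ n - b ^ n) + (a - b) * b ^ n := by
      rw [pow_succ', pow_succ']; noncomm_ring
    rw [e]
    calc _ ≤ ‖a‖ * ‖a ^ n - b ^ n‖ + ‖a - b‖ * ‖b ^ n‖ :=
          (norm_add_le _ _).trans (add_le_add (norm_mul_le _ _) (norm_mul_le _ _))
      _ ≤ 1 * (n * ‖a - b‖) + ‖a - b‖ * 1 := by gcongr; exact hbn n
      _ = _ := by push_cast; ring

theorem star_mul_self_exp_of_skew {ξ : V →L[ℂ] V} (h : star ξ = -ξ) :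
    star (NormedSpace.exp ξ) * NormedSpace.exp ξ = 1 := by
  rw [NormedSpace.star_exp, h, exp_neg_mul_exp]

theorem star_eq_neg_of_hasDerivAt {c : ℝ → V →L[ℂ] V} {ξ : V →L[ℂ] V}
    (hc : ∀ t, star (c t) * c t = 1) (h0 : c 0 = 1) (h : HasDerivAt c ξ 0) : star ξ = -ξ := by
  have h1 := h.star.fun_mul h
  simp only [hc, h0, star_one, mul_one, one_mul] at h1
  exact eq_neg_of_add_eq_zero_left (h1.unique (hasDerivAt_const (0 : ℝ) (1 : V →L[ℂ] V)))

/-- The velocity at `1` of a curve in the compact group `G` belongs to the Lie algebra of `G`. -/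
theorem mem_lieAlg_of_hasDerivAt (hG : IsCompactConnectedUnitary G) {c : ℝ → (V →L[ℂ] V)ˣ}
    {ξ : V →L[ℂ] V} (hc : ∀ t, c t ∈ G) (h0 : c 0 = 1)
    (h : HasDerivAt (fun t => (c t : V →L[ℂ] V)) ξ 0) : ξ ∈ lieAlg G := by
  have hskew : star ξ = -ξ :=
    star_eq_neg_of_hasDerivAt (fun t => star_mul_self_of_mem hG (hc t)) (by simp [h0]) h
  intro t
  have hcomp : IsCompact ((fun k : (V →L[ℂ] V)ˣ => (k : V →L[ℂ] V)) '' G) :=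
    hG.compact.image Units.continuous_val
  -- `exp (t ξ)` is the limit of the powers `c (t / n) ^ n`.
  have hlim : Filter.Tendsto (fun n : ℕ => ((c (t * (n + 1 : ℝ)⁻¹) ^ (n + 1) : (V →L[ℂ] V)ˣ) :
      V →L[ℂ] V)) Filter.atTop (𝓝 (NormedSpace.exp (t • ξ))) := by
    have hd : HasDerivAt (fun s : ℝ => (c (t * s) : V →L[ℂ] V) - NormedSpace.exp (s • (t • ξ)))
        0 0 := by
      have e : HasDerivAt (fun s : ℝ => t * s) t 0 := by
        simpa using (hasDerivAt_id (0 : ℝ)).const_mul t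
      have h1 : HasDerivAt (fun s : ℝ => (c (t * s) : V →L[ℂ] V)) (t • ξ) 0 := by
        refine HasDerivAt.scomp (h := fun s : ℝ => t * s)
          (g₁ := fun t => (c t : V →L[ℂ] V)) (0 : ℝ) ?_ e
        simpa using h
      refine (h1.sub (hasDerivAt_exp_smul (t • ξ) 0)).congr_deriv ?_
      simp
    have h1 := hd.tendsto_slope_zero
    have h2 : Filter.Tendsto (fun n : ℕ => ((n + 1 : ℝ)⁻¹)) Filter.atTop (𝓝[≠] 0) := by
      refine tendsto_nhdsWithin_iff.2 ⟨?_, Filter.Eventually.of_forall fun n => ?_⟩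
      · simpa using tendsto_one_div_add_atTop_nhds_zero_nat (𝕜 := ℝ)
      · exact inv_ne_zero (by positivity)
    have h3 := (h1.comp h2).norm
    rw [norm_zero] at h3
    refine tendsto_iff_norm_sub_tendsto_zero.2 (squeeze_zero (fun _ => norm_nonneg _) ?_ h3)
    intro n
    have h4 : NormedSpace.exp (t • ξ) = NormedSpace.exp ((n + 1 : ℝ)⁻¹ • (t • ξ)) ^ (n + 1) := by
      let _ : NormedAlgebra ℚ (V →L[ℂ] V) := NormedAlgebra.restrictScalars ℚ ℂ _
      rw [← NormedSpace.exp_nsmul, ← Nat.cast_smul_eq_nsmul ℝ, smul_smul]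
      push_cast
      rw [mul_inv_cancel₀ (by positivity), one_smul]
    have hn : ‖(1 : V →L[ℂ] V)‖ ≤ 1 := ContinuousLinearMap.norm_id_le
    rw [h4, Units.val_pow_eq_pow_val]
    refine (norm_pow_sub_pow_le (norm_le_one_of_star_mul_self (star_mul_self_of_mem hG (hc _)))
      (norm_le_one_of_star_mul_self (star_mul_self_exp_of_skew ?_)) hn _).trans ?_
    · simp [star_smul, hskew]
    · have hp : (0 : ℝ) < n + 1 := by positivity
      simp only [comp_apply, zero_add, mul_zero, h0, zero_smul, NormedSpace.exp_zero,
        Units.val_one, sub_self, sub_zero, inv_inv, norm_smul, Real.norm_of_nonneg hp.le]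
      push_cast
      exact le_rfl
  obtain ⟨k, hk, hk'⟩ := hcomp.isClosed.mem_of_tendsto hlim
    (Filter.Eventually.of_forall fun n => ⟨_, G.pow_mem (hc _) _, rfl⟩)
  have : expGL (t • ξ) = k := Units.ext hk'.symm
  rw [this]
  exact hk

theorem star_eq_neg_of_mem_lieAlg (hG : IsCompactConnectedUnitary G) {ξ : V →L[ℂ] V}
    (hξ : ξ ∈ lieAlg G) : star ξ = -ξ := by
  have h : HasDerivAt (fun t : ℝ => NormedSpace.exp (t • ξ)) ξ 0 :=
    (hasDerivAt_exp_smul ξ 0).congr_deriv (by rw [zero_smul, NormedSpace.exp_zero, mul_one])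
  have h1 : ∀ t : ℝ, star (NormedSpace.exp (t • ξ)) * NormedSpace.exp (t • ξ) = 1 :=
    fun t => star_mul_self_of_mem hG (k := expGL (t • ξ)) (hξ t)
  exact star_eq_neg_of_hasDerivAt h1 (by rw [zero_smul, NormedSpace.exp_zero]) h

/-- The Lie algebra of the compact group `G`, as a real subspace of `End(V)`. -/
def lieSubmodule (hG : IsCompactConnectedUnitary G) : Submodule ℝ (V →L[ℂ] V) where
  carrier := lieAlg G
  add_mem' {ξ η} hξ hη := by
    refine mem_lieAlg_of_hasDerivAt hG (c := fun t => expGL (t • ξ) * expGL (t • η))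
      (fun t => G.mul_mem (hξ t) (hη t)) (by simp [expGL_zero]) ?_
    refine ((hasDerivAt_exp_smul ξ 0).mul (hasDerivAt_exp_smul η 0)).congr_deriv ?_
    simp
  zero_mem' := fun t => by rw [smul_zero, expGL_zero]; exact G.one_mem
  smul_mem' r ξ hξ := fun t => by rw [smul_smul]; exact hξ _

theorem isClosed_lieSubmodule (hG : IsCompactConnectedUnitary G) :
    IsClosed (lieSubmodule hG : Set (V →L[ℂ] V)) := Submodule.closed_of_finiteDimensional _

theorem conj_mem_lieAlg {k : (V →L[ℂ] V)ˣ} (hk : k ∈ G) {ξ : V →L[ℂ] V} (hξ : ξ ∈ lieAlg G) :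
    (k : V →L[ℂ] V) * ξ * ((k⁻¹ : (V →L[ℂ] V)ˣ) : V →L[ℂ] V) ∈ lieAlg G := fun t => by
  rw [← smul_mul_assoc, ← mul_smul_comm, expGL_conj]
  exact G.mul_mem (G.mul_mem hk (hξ t)) (G.inv_mem hk)

theorem bracket_mem_lieAlg (hG : IsCompactConnectedUnitary G) {ξ η : V →L[ℂ] V}
    (hξ : ξ ∈ lieAlg G) (hη : η ∈ lieAlg G) : ξ * η - η * ξ ∈ lieAlg G := by
  have h := hasDerivAt_exp_conj ξ η 0
  simp only [zero_smul, NormedSpace.exp_zero, one_mul, neg_zero, mul_one] at h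
  refine hasDerivAt_mem_of_eventually_mem (isClosed_lieSubmodule hG) h
    (Filter.Eventually.of_forall fun t => ?_)
  exact conj_mem_lieAlg (hξ t) hη

end LieAlgebra

/-! ### Regular functions on the general linear group -/

section Regular

variable (V : Type*) [NormedAddCommGroup V] [InnerProductSpace ℂ V] [FiniteDimensional ℂ V]
  [CompleteSpace V]

/-- The algebra of regular functions on `GL(V)`: the complex polynomials in the matrix entries of
`g` and of `g⁻¹`. -/
def regularFunctions : Subalgebra ℂ ((V →L[ℂ] V)ˣ → ℂ) :=
  Algebra.adjoin ℂ ({f | ∃ φ : (V →L[ℂ] V) →L[ℂ] ℂ, f = fun g : (V →L[ℂ] V)ˣ => φ (g : V →L[ℂ] V)} ∪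
    {f | ∃ φ : (V →L[ℂ] V) →L[ℂ] ℂ, f = fun g => φ ((g⁻¹ : (V →L[ℂ] V)ˣ) : V →L[ℂ] V)})

variable {V}

theorem coeff_mem_regularFunctions (φ : (V →L[ℂ] V) →L[ℂ] ℂ) :
    (fun g : (V →L[ℂ] V)ˣ => φ (g : V →L[ℂ] V)) ∈ regularFunctions V :=
  Algebra.subset_adjoin (Or.inl ⟨φ, rfl⟩)

theorem coeff_inv_mem_regularFunctions (φ : (V →L[ℂ] V) →L[ℂ] ℂ) :
    (fun g : (V →L[ℂ] V)ˣ => φ ((g⁻¹ : (V →L[ℂ] V)ˣ) : V →L[ℂ] V)) ∈ regularFunctions V :=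
  Algebra.subset_adjoin (Or.inr ⟨φ, rfl⟩)

theorem regularFunctions_induction {p : ((V →L[ℂ] V)ˣ → ℂ) → Prop}
    (coeff : ∀ φ : (V →L[ℂ] V) →L[ℂ] ℂ, p fun g => φ (g : V →L[ℂ] V))
    (coeff_inv : ∀ φ : (V →L[ℂ] V) →L[ℂ] ℂ, p fun g => φ ((g⁻¹ : (V →L[ℂ] V)ˣ) : V →L[ℂ] V))
    (const : ∀ c : ℂ, p fun _ => c) (add : ∀ f g, p f → p g → p (f + g))
    (mul : ∀ f g, p f → p g → p (f * g)) {f : (V →L[ℂ] V)ˣ → ℂ} (hf : f ∈ regularFunctions V) :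
    p f := by
  refine Algebra.adjoin_induction (p := fun f _ => p f) ?_ (fun c => const c)
    (fun f g _ _ => add f g) (fun f g _ _ => mul f g) hf
  rintro f (⟨φ, rfl⟩ | ⟨φ, rfl⟩)
  exacts [coeff φ, coeff_inv φ]

theorem continuous_of_mem_regularFunctions {f : (V →L[ℂ] V)ˣ → ℂ} (hf : f ∈ regularFunctions V) :
    Continuous f :=
  regularFunctions_induction (fun φ => φ.continuous.comp Units.continuous_val)
    (fun φ => φ.continuous.comp (Units.continuous_val.comp continuous_inv))
    (fun _ => continuous_const) (fun _ _ => Continuous.add) (fun _ _ => Continuous.mul) hf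

theorem const_mem_regularFunctions (c : ℂ) :
    (fun _ => c : (V →L[ℂ] V)ˣ → ℂ) ∈ regularFunctions V :=
  (regularFunctions V).algebraMap_mem c

theorem left_translate_mem_regularFunctions (a : (V →L[ℂ] V)ˣ) {f : (V →L[ℂ] V)ˣ → ℂ}
    (hf : f ∈ regularFunctions V) : (fun x => f (a * x)) ∈ regularFunctions V := by
  refine regularFunctions_induction (p := fun f => (fun x => f (a * x)) ∈ regularFunctions V)
    (fun φ => ?_) (fun φ => ?_) (fun c => const_mem_regularFunctions c)
    (fun _ _ => (regularFunctions V).add_mem) (fun _ _ => (regularFunctions V).mul_mem) hf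
  · exact coeff_mem_regularFunctions (φ ∘L ContinuousLinearMap.mul ℂ (V →L[ℂ] V) a)
  · simpa using coeff_inv_mem_regularFunctions
      (φ ∘L (ContinuousLinearMap.mul ℂ (V →L[ℂ] V)).flip ((a⁻¹ : (V →L[ℂ] V)ˣ) : V →L[ℂ] V))

theorem right_translate_mem_regularFunctions (a : (V →L[ℂ] V)ˣ) {f : (V →L[ℂ] V)ˣ → ℂ}
    (hf : f ∈ regularFunctions V) : (fun x => f (x * a)) ∈ regularFunctions V := by
  refine regularFunctions_induction (p := fun f => (fun x => f (x * a)) ∈ regularFunctions V)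
    (fun φ => ?_) (fun φ => ?_) (fun c => const_mem_regularFunctions c)
    (fun _ _ => (regularFunctions V).add_mem) (fun _ _ => (regularFunctions V).mul_mem) hf
  · exact coeff_mem_regularFunctions (φ ∘L (ContinuousLinearMap.mul ℂ (V →L[ℂ] V)).flip a)
  · simpa using coeff_inv_mem_regularFunctions
      (φ ∘L ContinuousLinearMap.mul ℂ (V →L[ℂ] V) ((a⁻¹ : (V →L[ℂ] V)ˣ) : V →L[ℂ] V))

theorem comp_inv_mem_regularFunctions {f : (V →L[ℂ] V)ˣ → ℂ}
    (hf : f ∈ regularFunctions V) : (fun x => f x⁻¹) ∈ regularFunctions V := by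
  refine regularFunctions_induction (p := fun f => (fun x => f x⁻¹) ∈ regularFunctions V)
    (fun φ => ?_) (fun φ => ?_) (fun c => const_mem_regularFunctions c)
    (fun _ _ => (regularFunctions V).add_mem) (fun _ _ => (regularFunctions V).mul_mem) hf
  · exact coeff_inv_mem_regularFunctions φ
  · simpa using coeff_mem_regularFunctions φ

/-- On unitary operators the complex conjugate of a regular function is again given by a regular
function. -/
theorem exists_conj_mem_regularFunctions {f : (V →L[ℂ] V)ˣ → ℂ} (hf : f ∈ regularFunctions V) :
    ∃ f' ∈ regularFunctions V, ∀ x : (V →L[ℂ] V)ˣ,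
      star (x : V →L[ℂ] V) = ((x⁻¹ : (V →L[ℂ] V)ˣ) : V →L[ℂ] V) → f' x = star (f x) := by
  have key : ∀ φ : (V →L[ℂ] V) →L[ℂ] ℂ, ∃ φ' : (V →L[ℂ] V) →L[ℂ] ℂ, ∀ T, φ' T = star (φ (star T)) :=
    fun φ => by
      refine ⟨LinearMap.toContinuousLinearMap
        { toFun := fun T => star (φ (star T)), map_add' := ?_, map_smul' := ?_ }, fun T => rfl⟩
      · intro S T; simp
      · intro c T; simp
  refine regularFunctions_induction (p := fun f => ∃ f' ∈ regularFunctions V,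
    ∀ x : (V →L[ℂ] V)ˣ, star (x : V →L[ℂ] V) = ((x⁻¹ : (V →L[ℂ] V)ˣ) : V →L[ℂ] V) →
      f' x = star (f x)) (fun φ => ?_) (fun φ => ?_) (fun c => ?_) ?_ ?_ hf
  · obtain ⟨φ', h⟩ := key φ
    exact ⟨_, coeff_inv_mem_regularFunctions φ', fun x hx => by rw [h, ← hx, star_star]⟩
  · obtain ⟨φ', h⟩ := key φ
    exact ⟨_, coeff_mem_regularFunctions φ', fun x hx => by rw [h, hx]⟩
  · exact ⟨_, const_mem_regularFunctions (star c), fun x _ => rfl⟩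
  · rintro f g ⟨f', hf', h1⟩ ⟨g', hg', h2⟩
    exact ⟨_, (regularFunctions V).add_mem hf' hg', fun x hx => by simp [h1 x hx, h2 x hx]⟩
  · rintro f g ⟨f', hf', h1⟩ ⟨g', hg', h2⟩
    exact ⟨_, (regularFunctions V).mul_mem hf' hg', fun x hx => by simp [h1 x hx, h2 x hx]⟩

/-- The comultiplication of regular functions. -/
theorem exists_regularFunctions_mul {f : (V →L[ℂ] V)ˣ → ℂ} (hf : f ∈ regularFunctions V) :
    ∃ (ι : Type) (_ : Fintype ι) (F c : ι → (V →L[ℂ] V)ˣ → ℂ), (∀ i, F i ∈ regularFunctions V) ∧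
      (∀ i, c i ∈ regularFunctions V) ∧ ∀ x y, f (x * y) = ∑ i, F i x * c i y := by
  let b := Module.finBasis ℂ (V →L[ℂ] V)
  let co : Fin _ → (V →L[ℂ] V) →L[ℂ] ℂ := fun i => LinearMap.toContinuousLinearMap (b.coord i)
  have hb : ∀ T, ∑ i, co i T • b i = T := fun T => b.sum_repr T
  refine regularFunctions_induction (p := fun f => ∃ (ι : Type) (_ : Fintype ι)
    (F c : ι → (V →L[ℂ] V)ˣ → ℂ), (∀ i, F i ∈ regularFunctions V) ∧
      (∀ i, c i ∈ regularFunctions V) ∧ ∀ x y, f (x * y) = ∑ i, F i x * c i y)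
    (fun φ => ?_) (fun φ => ?_) (fun c => ?_) ?_ ?_ hf
  · refine ⟨Fin _, inferInstance, fun i x => φ (x * b i), fun i y => co i y,
      fun i => coeff_mem_regularFunctions
        (φ ∘L (ContinuousLinearMap.mul ℂ (V →L[ℂ] V)).flip (b i)),
      fun i => coeff_mem_regularFunctions (co i), fun x y => ?_⟩
    beta_reduce
    conv_lhs => rw [Units.val_mul, ← hb (y : V →L[ℂ] V)]
    simp [Finset.mul_sum, mul_comm]
  · refine ⟨Fin _, inferInstance, fun i x => φ (b i * ((x⁻¹ : (V →L[ℂ] V)ˣ) : V →L[ℂ] V)),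
      fun i y => co i ((y⁻¹ : (V →L[ℂ] V)ˣ) : V →L[ℂ] V),
      fun i => coeff_inv_mem_regularFunctions
        (φ ∘L (ContinuousLinearMap.mul ℂ (V →L[ℂ] V)) (b i)),
      fun i => coeff_inv_mem_regularFunctions (co i), fun x y => ?_⟩
    beta_reduce
    conv_lhs => rw [mul_inv_rev, Units.val_mul, ← hb ((y⁻¹ : (V →L[ℂ] V)ˣ) : V →L[ℂ] V)]
    simp [Finset.sum_mul, mul_comm]
  · exact ⟨Unit, inferInstance, fun _ _ => c, fun _ _ => 1, fun _ => const_mem_regularFunctions c,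
      fun _ => const_mem_regularFunctions 1, fun x y => by simp⟩
  · rintro f g ⟨ι, _, F, c, hF, hc, h⟩ ⟨ι', _, F', c', hF', hc', h'⟩
    refine ⟨ι ⊕ ι', inferInstance, Sum.elim F F', Sum.elim c c', ?_, ?_, fun x y => ?_⟩
    · rintro (i | i)
      exacts [hF i, hF' i]
    · rintro (i | i)
      exacts [hc i, hc' i]
    · simp [h, h']
  · rintro f g ⟨ι, _, F, c, hF, hc, h⟩ ⟨ι', _, F', c', hF', hc', h'⟩
    refine ⟨ι × ι', inferInstance, fun i => F i.1 * F' i.2, fun i => c i.1 * c' i.2,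
      fun i => (regularFunctions V).mul_mem (hF _) (hF' _),
      fun i => (regularFunctions V).mul_mem (hc _) (hc' _), fun x y => ?_⟩
    simp only [Pi.mul_apply, h, h', Finset.sum_mul_sum, Fintype.sum_prod_type]
    exact Finset.sum_congr rfl fun i _ => Finset.sum_congr rfl fun j _ => by ring

/-- The Zariski closure of a linear group in `GL(V)`. -/
def zariskiClosure (G : Subgroup (V →L[ℂ] V)ˣ) : Subgroup (V →L[ℂ] V)ˣ where
  carrier := {g | ∀ f ∈ regularFunctions V, (∀ k ∈ G, f k = 0) → f g = 0}
  one_mem' := fun f _ h => h 1 G.one_mem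
  mul_mem' {a b} ha hb := fun f hf h => by
    have h1 : ∀ k ∈ G, f (k * b) = 0 := fun k hk =>
      hb _ (left_translate_mem_regularFunctions k hf) fun l hl => h _ (G.mul_mem hk hl)
    exact ha _ (right_translate_mem_regularFunctions b hf) h1
  inv_mem' {a} ha := fun f hf h =>
    ha _ (comp_inv_mem_regularFunctions hf) fun k hk => h _ (G.inv_mem hk)

theorem le_zariskiClosure (G : Subgroup (V →L[ℂ] V)ˣ) : G ≤ zariskiClosure G :=
  fun k hk _ _ h => h k hk

end Regular

/-! ### Exponential polynomials -/

section ExpPoly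

/-- The finite sums `z ↦ ∑ c e^{μ z}` with complex coefficients and real frequencies `μ`. -/
def expPolynomials : Submodule ℂ (ℂ → ℂ) :=
  Submodule.span ℂ (range fun (μ : ℝ) (z : ℂ) => Complex.exp (μ * z))

theorem exp_mem_expPolynomials (μ : ℝ) : (fun z : ℂ => Complex.exp (μ * z)) ∈ expPolynomials :=
  Submodule.subset_span ⟨μ, rfl⟩

theorem const_mem_expPolynomials (c : ℂ) : (fun _ : ℂ => c) ∈ expPolynomials := by
  have h := expPolynomials.smul_mem c (exp_mem_expPolynomials 0)
  convert h using 1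
  ext z
  simp

theorem mul_mem_expPolynomials {f g : ℂ → ℂ} (hf : f ∈ expPolynomials) (hg : g ∈ expPolynomials) :
    f * g ∈ expPolynomials := by
  refine Submodule.span_induction (p := fun f _ => f * g ∈ expPolynomials) ?_ ?_ ?_ ?_ hf
  · rintro _ ⟨μ, rfl⟩
    refine Submodule.span_induction (p := fun g _ => (fun z : ℂ => Complex.exp (μ * z)) * g
      ∈ expPolynomials) ?_ ?_ ?_ ?_ hg
    · rintro _ ⟨ν, rfl⟩
      convert exp_mem_expPolynomials (μ + ν) using 1
      ext z
      simp [← Complex.exp_add, add_mul]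
    · rw [mul_zero]; exact expPolynomials.zero_mem
    · intro x y _ _ hx hy
      rw [mul_add]; exact expPolynomials.add_mem hx hy
    · intro c x _ hx
      rw [mul_smul_comm]; exact expPolynomials.smul_mem c hx
  · rw [zero_mul]; exact expPolynomials.zero_mem
  · intro x y _ _ hx hy
    rw [add_mul]; exact expPolynomials.add_mem hx hy
  · intro c x _ hx
    rw [smul_mul_assoc]; exact expPolynomials.smul_mem c hx

/-- An exponential polynomial that vanishes on a submonoid of `ℂ` on which the real frequencies are
distinguished vanishes identically: distinct characters of a monoid are linearly independent. -/
theorem expPolynomials_eq_zero {M : Type*} [AddMonoid M] (τ : M →+ ℂ)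
    (hτ : ∀ μ ν : ℝ, (∀ m, Complex.exp (μ * τ m) = Complex.exp (ν * τ m)) → μ = ν) {f : ℂ → ℂ}
    (hf : f ∈ expPolynomials) (h0 : ∀ m, f (τ m) = 0) : f = 0 := by
  obtain ⟨c, rfl⟩ := (Finsupp.mem_span_range_iff_exists_finsupp).1 hf
  let ch : ℝ → (Multiplicative M →* ℂ) := fun μ =>
    { toFun := fun m => Complex.exp (μ * τ m.toAdd)
      map_one' := by simp
      map_mul' := fun a b => by simp [mul_add, Complex.exp_add] }
  have hinj : Injective ch := fun μ ν h =>
    hτ μ ν fun m => DFunLike.congr_fun h (Multiplicative.ofAdd m)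
  have hli := (linearIndependent_monoidHom (Multiplicative M) ℂ).comp ch hinj
  have hc : c = 0 := by
    refine linearIndependent_iff.1 hli c ?_
    ext m
    have := h0 m.toAdd
    rw [Finsupp.linearCombination_apply]
    simpa [Finsupp.sum, Finset.sum_apply, ch] using this
  simp [hc]

variable {V : Type*} [NormedAddCommGroup V] [InnerProductSpace ℂ V] [FiniteDimensional ℂ V]
  [CompleteSpace V]

theorem exp_smul_apply_eigenvector {χ : V →L[ℂ] V} {v : V} {μ : ℂ} (h : χ v = μ • v) (z : ℂ) :
    NormedSpace.exp (z • χ) v = Complex.exp (z * μ) • v := by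
  have h1 := (ContinuousLinearMap.apply ℂ V v).hasSum
    (NormedSpace.exp_series_hasSum_exp' (𝕂 := ℂ) (z • χ))
  have h2 := (NormedSpace.exp_series_hasSum_exp' (𝕂 := ℂ) (z * μ)).smul_const v
  have hp : ∀ n : ℕ, ((z • χ) ^ n) v = (z * μ) ^ n • v := fun n => by
    induction n with
    | zero => simp
    | succ n ih =>
      rw [pow_succ', mul_apply_eq_comp, ih, map_smul, smul_apply, h, smul_smul, smul_smul,
        pow_succ]
      ring_nf
  rw [← Complex.exp_eq_exp_ℂ] at h2
  refine h1.unique ?_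
  convert h2 using 2 with n
  simp [hp, smul_smul]

/-- The matrix entries of `e^{zχ}`, in an eigenbasis of `χ`, are exponentials with the eigenvalues
as frequencies. -/
theorem coeff_exp_mem_expPolynomials {χ : V →L[ℂ] V} (hχ : IsSelfAdjoint χ)
    (φ : (V →L[ℂ] V) →L[ℂ] ℂ) :
    (fun z : ℂ => φ (NormedSpace.exp (z • χ))) ∈ expPolynomials := by
  have hsym : (χ : V →ₗ[ℂ] V).IsSymmetric := hχ.isSymmetric
  let b := hsym.eigenvectorBasis rfl
  let μ := hsym.eigenvalues rfl
  have hb : ∀ j, χ (b j) = (μ j : ℂ) • b j := fun j => hsym.apply_eigenvectorBasis rfl j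
  have hexp : ∀ z : ℂ, NormedSpace.exp (z • χ)
      = ∑ j, Complex.exp (μ j * z) • (innerSL ℂ (b j)).smulRight (b j) := fun z => by
    ext v
    conv_lhs => rw [← b.sum_repr' v]
    simp only [map_sum, map_smul, exp_smul_apply_eigenvector (hb _)]
    rw [sum_apply]
    refine Finset.sum_congr rfl fun j _ => ?_
    simp [smul_smul, mul_comm]
  have : (fun z : ℂ => φ (NormedSpace.exp (z • χ)))
      = ∑ j, φ ((innerSL ℂ (b j)).smulRight (b j)) • fun z : ℂ => Complex.exp (μ j * z) := by
    ext z
    simp [hexp, mul_comm]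
  rw [this]
  exact expPolynomials.sum_mem fun j _ => expPolynomials.smul_mem _ (exp_mem_expPolynomials _)

theorem regularFunctions_exp_mem_expPolynomials {χ : V →L[ℂ] V} (hχ : IsSelfAdjoint χ)
    {f : (V →L[ℂ] V)ˣ → ℂ} (hf : f ∈ regularFunctions V) :
    (fun z : ℂ => f (expGL (z • χ))) ∈ expPolynomials := by
  refine regularFunctions_induction (p := fun f => (fun z : ℂ => f (expGL (z • χ)))
    ∈ expPolynomials) (fun φ => coeff_exp_mem_expPolynomials hχ φ) (fun φ => ?_)
    const_mem_expPolynomials (fun f g => expPolynomials.add_mem)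
    (fun f g => mul_mem_expPolynomials) hf
  have := coeff_exp_mem_expPolynomials hχ.neg φ
  simpa [expGL_inv_coe] using this

end ExpPoly

/-! ### The polar decomposition of the complexified group -/

section Cartan

variable {V : Type*} [NormedAddCommGroup V] [InnerProductSpace ℂ V] [FiniteDimensional ℂ V]
  [CompleteSpace V] {G : Subgroup (V →L[ℂ] V)ˣ}

/-- By Stone–Weierstrass, some regular function is close to `0` on `G` and close to `1` on the
coset `k G`. -/
theorem exists_regularFunction_near_indicator (hG : IsCompactConnectedUnitary G)
    {k : (V →L[ℂ] V)ˣ} (hk : star (k : V →L[ℂ] V) * k = 1) (hkG : k ∉ G) :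
    ∃ f ∈ regularFunctions V, ∃ d < (1 / 2 : ℝ), (∀ h ∈ G, ‖f h‖ ≤ d) ∧
      ∀ h ∈ G, ‖f (k * h) - 1‖ ≤ d := by
  let G' : Set (V →L[ℂ] V)ˣ := (fun h => k * h) '' G
  have hG' : IsCompact G' := hG.compact.image (continuous_const.mul continuous_id)
  let K : Set (V →L[ℂ] V)ˣ := G ∪ G'
  have hK : IsCompact K := hG.compact.union hG'
  have _ : CompactSpace K := isCompact_iff_compactSpace.1 hK
  have hKu : ∀ x ∈ K, star (x : V →L[ℂ] V) = ((x⁻¹ : (V →L[ℂ] V)ˣ) : V →L[ℂ] V) := by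
    rintro x (hx | ⟨h, hh, rfl⟩)
    · exact star_eq_inv_of_mem hG hx
    · refine (Units.inv_eq_of_mul_eq_one_left ?_).symm
      rw [Units.val_mul, star_mul, mul_assoc, ← mul_assoc (star (k : V →L[ℂ] V)), hk, one_mul,
        star_mul_self_of_mem hG hh]
  have hdisj : ∀ x ∈ G, x ∉ G' := by
    rintro x hx ⟨h, hh, rfl⟩
    exact hkG ((G.mul_mem_cancel_right hh).1 hx)
  let A : StarSubalgebra ℂ C(K, ℂ) :=
    { carrier := {F | ∃ f ∈ regularFunctions V, ∀ x : K, F x = f x}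
      mul_mem' := by
        rintro _ _ ⟨f, hf, h1⟩ ⟨g, hg, h2⟩
        exact ⟨_, (regularFunctions V).mul_mem hf hg, fun x => by simp [h1, h2]⟩
      add_mem' := by
        rintro _ _ ⟨f, hf, h1⟩ ⟨g, hg, h2⟩
        exact ⟨_, (regularFunctions V).add_mem hf hg, fun x => by simp [h1, h2]⟩
      algebraMap_mem' := fun c => ⟨_, const_mem_regularFunctions c, fun x => rfl⟩
      star_mem' := by
        rintro _ ⟨f, hf, h1⟩
        obtain ⟨f', hf', h2⟩ := exists_conj_mem_regularFunctions hf
        exact ⟨f', hf', fun x => by rw [h2 x (hKu x x.2)]; simp [h1]⟩ }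
  have hsep : A.SeparatesPoints := by
    intro x y hxy
    have hne : ((x : (V →L[ℂ] V)ˣ) : V →L[ℂ] V) ≠ ((y : (V →L[ℂ] V)ˣ) : V →L[ℂ] V) :=
      fun h => hxy (Subtype.ext (Units.ext h))
    obtain ⟨φ, hφ⟩ := SeparatingDual.exists_separating_of_ne (R := ℂ) hne
    exact ⟨_, ⟨⟨fun x : K => φ ((x : (V →L[ℂ] V)ˣ) : V →L[ℂ] V),
      φ.continuous.comp (Units.continuous_val.comp continuous_subtype_val)⟩,
      ⟨_, coeff_mem_regularFunctions φ, fun x => rfl⟩, rfl⟩, hφ⟩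
  have htop := ContinuousMap.starSubalgebra_topologicalClosure_eq_top_of_separatesPoints A hsep
  obtain ⟨F0, h0, h1, -⟩ := exists_continuous_zero_one_of_isClosed
    (s := {x : K | (x : (V →L[ℂ] V)ˣ) ∈ G}) (t := {x : K | (x : (V →L[ℂ] V)ˣ) ∈ G'})
    (hG.compact.isClosed.preimage continuous_subtype_val)
    (hG'.isClosed.preimage continuous_subtype_val)
    (Set.disjoint_left.2 fun x hx hx' => hdisj x hx hx')
  let F1 : C(K, ℂ) := ⟨fun x => (F0 x : ℂ), Complex.continuous_ofReal.comp F0.continuous⟩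
  have hF1 : F1 ∈ closure (A : Set C(K, ℂ)) := by
    have : F1 ∈ A.topologicalClosure := by rw [htop]; trivial
    exact this
  obtain ⟨F, ⟨f, hf, hFf⟩, hd⟩ := Metric.mem_closure_iff.1 hF1 (1 / 2) (by norm_num)
  rw [dist_comm, dist_eq_norm] at hd
  refine ⟨f, hf, _, hd, fun h hh => ?_, fun h hh => ?_⟩
  · have e := (F - F1).norm_coe_le_norm ⟨h, Or.inl hh⟩
    have e0 : F0 ⟨h, Or.inl hh⟩ = 0 := h0 (x := ⟨h, Or.inl hh⟩) hh
    simpa [hFf, F1, e0] using e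
  · have hm : k * h ∈ G' := ⟨h, hh, rfl⟩
    have e := (F - F1).norm_coe_le_norm ⟨k * h, Or.inr hm⟩
    have e0 : F0 ⟨k * h, Or.inr hm⟩ = 1 := h1 (x := ⟨k * h, Or.inr hm⟩) hm
    simpa [hFf, F1, e0] using e

/-- A compact group of unitary operators is the set of unitary points of its Zariski closure: the
average over `G` of a regular function which separates `G` from `k G` is a regular function that is
constant on `G` and takes a different value at `k`. -/
theorem mem_of_mem_zariskiClosure (hG : IsCompactConnectedUnitary G)
    {k : (V →L[ℂ] V)ˣ} (hk : star (k : V →L[ℂ] V) * k = 1) (hkZ : k ∈ zariskiClosure G) :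
    k ∈ G := by
  by_contra hkG
  obtain ⟨f, hf, d, hd, h1, h2⟩ := exists_regularFunction_near_indicator hG hk hkG
  obtain ⟨ι, _, F, c, hF, hc, hfc⟩ := exists_regularFunctions_mul hf
  have _ : CompactSpace G := isCompact_iff_compactSpace.1 hG.compact
  let _ : MeasurableSpace G := borel G
  have _ : BorelSpace G := ⟨rfl⟩
  let m : MeasureTheory.Measure G := MeasureTheory.Measure.haar
  have hint : ∀ p : (V →L[ℂ] V)ˣ → ℂ, Continuous p →
      MeasureTheory.Integrable (fun h : G => p h) m := fun p hp =>
    (hp.comp continuous_subtype_val).integrable_of_hasCompactSupport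
      (HasCompactSupport.of_compactSpace _)
  -- The average `J` of `f` over right translations by `G`.
  let J : (V →L[ℂ] V)ˣ → ℂ := fun x => ∫ h : G, f (x * h) ∂m
  have hJ : J ∈ regularFunctions V := by
    have : J = ∑ i, (∫ h : G, c i h ∂m) • F i := by
      ext x
      simp only [J, hfc]
      rw [MeasureTheory.integral_finsetSum _ fun i _ =>
        (hint _ (continuous_of_mem_regularFunctions (hc i))).const_mul _]
      simp [MeasureTheory.integral_const_mul, mul_comm]
    rw [this]
    exact (regularFunctions V).sum_mem fun i _ => (regularFunctions V).smul_mem (hF i) _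
  have hJG : ∀ h ∈ G, J h = J 1 := fun h hh => by
    have := MeasureTheory.integral_mul_left_eq_self (μ := m) (fun x : G => f x) ⟨h, hh⟩
    simpa [J] using this
  have hJk : J k - J 1 = 0 :=
    hkZ _ ((regularFunctions V).sub_mem hJ (const_mem_regularFunctions (J 1)))
      fun h hh => by simp [hJG h hh]
  have hpos : 0 < m.real univ := by
    rw [MeasureTheory.measureReal_def]
    exact ENNReal.toReal_pos (MeasureTheory.Measure.measure_univ_ne_zero.2
      (NeZero.ne m)) (MeasureTheory.measure_ne_top _ _)
  have hfcont := continuous_of_mem_regularFunctions hf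
  have e1 : ‖J 1‖ ≤ d * m.real univ := by
    refine MeasureTheory.norm_integral_le_of_norm_le_const
      (Filter.Eventually.of_forall fun h => ?_)
    simpa using h1 h h.2
  have e2 : ‖J k - m.real univ‖ ≤ d * m.real univ := by
    have : J k - m.real univ = ∫ h : G, (f (k * h) - 1) ∂m := by
      rw [MeasureTheory.integral_sub (hint (fun x => f (k * x))
        (hfcont.comp (continuous_const.mul continuous_id))) (MeasureTheory.integrable_const _)]
      simp [J]
    rw [this]
    exact MeasureTheory.norm_integral_le_of_norm_le_const
      (Filter.Eventually.of_forall fun h => h2 h h.2)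
  have e3 : ‖(m.real univ : ℂ)‖ = m.real univ := by simp
  have e4 : ‖(m.real univ : ℂ)‖ ≤ ‖J k‖ + ‖J k - m.real univ‖ := by
    have := norm_sub_le (J k) (J k - m.real univ)
    simpa using this
  rw [sub_eq_zero.1 hJk] at e4 e2
  rw [e3] at e4
  nlinarith

theorem smul_I_mem_lieAlg_isSelfAdjoint (hG : IsCompactConnectedUnitary G) {ξ : V →L[ℂ] V}
    (hξ : ξ ∈ lieAlg G) : IsSelfAdjoint (Complex.I • ξ) := by
  rw [IsSelfAdjoint, star_smul, star_eq_neg_of_mem_lieAlg hG hξ]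
  simp

/-- A regular function which vanishes on `G` is, along `z ↦ e^{izξ}` with `ξ ∈ 𝔤`, an exponential
polynomial which vanishes on the imaginary axis. -/
theorem complexification_le_zariskiClosure (hG : IsCompactConnectedUnitary G) :
    complexification G ≤ zariskiClosure G := by
  refine (Subgroup.closure_le _).2 ?_
  rintro g (hg | ⟨ξ, hξ, rfl⟩)
  · exact le_zariskiClosure G hg
  intro f hf h
  have hχ := smul_I_mem_lieAlg_isSelfAdjoint hG hξ
  let τ : ℝ →+ ℂ :=
    { toFun := fun t => -(t * Complex.I)
      map_zero' := by simp
      map_add' := fun a b => by push_cast; ring }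
  have h0 := expPolynomials_eq_zero τ ?_ (regularFunctions_exp_mem_expPolynomials hχ hf) ?_
  · have := congrFun h0 1
    simpa using this
  · intro μ ν hμν
    by_contra hne
    have hne' : (μ - ν : ℂ) ≠ 0 := by exact_mod_cast sub_ne_zero.2 hne
    have h1 := hμν (Real.pi / (μ - ν))
    have h2 : Complex.exp (-((μ - ν : ℂ) * ((Real.pi / (μ - ν) : ℝ) * Complex.I))) = 1 := by
      have e : -((μ - ν : ℂ) * ((Real.pi / (μ - ν) : ℝ) * Complex.I))
        = μ * τ (Real.pi / (μ - ν)) - ν * τ (Real.pi / (μ - ν)) := by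
        simp only [τ, AddMonoidHom.coe_mk, ZeroHom.coe_mk]; ring
      rw [e, Complex.exp_sub, h1, div_self (Complex.exp_ne_zero _)]
    have h3 : -((μ - ν : ℂ) * ((Real.pi / (μ - ν) : ℝ) * Complex.I)) = -(Real.pi * Complex.I) := by
      push_cast
      field_simp
    rw [h3, Complex.exp_neg, Complex.exp_pi_mul_I] at h2
    norm_num at h2
  · intro t
    have : (τ t) • (Complex.I • ξ) = t • ξ := by
      simp only [τ, AddMonoidHom.coe_mk, ZeroHom.coe_mk, smul_smul]
      rw [neg_mul, mul_assoc, Complex.I_mul_I]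
      simp
    rw [this]
    exact h _ (hξ t)

theorem star_mem_complexification (hG : IsCompactConnectedUnitary G) {g : (V →L[ℂ] V)ˣ}
    (hg : g ∈ complexification G) : star g ∈ complexification G := by
  refine Subgroup.closure_induction (p := fun g _ => star g ∈ complexification G) ?_ ?_ ?_ ?_ hg
  · rintro g (hg | ⟨ξ, hξ, rfl⟩)
    · have : star g = g⁻¹ := Units.ext (star_eq_inv_of_mem hG hg)
      rw [this]
      exact Subgroup.subset_closure (Or.inl (G.inv_mem hg))
    · have : star (expGL (Complex.I • ξ)) = expGL (Complex.I • ξ) :=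
        Units.ext (smul_I_mem_lieAlg_isSelfAdjoint hG hξ).exp.star_eq
      rw [this]
      exact Subgroup.subset_closure (Or.inr ⟨ξ, hξ, rfl⟩)
  · rw [star_one]; exact (complexification G).one_mem
  · intro x y _ _ hx hy
    rw [star_mul]
    exact (complexification G).mul_mem hy hx
  · intro x _ hx
    rw [star_inv]
    exact (complexification G).inv_mem hx

theorem le_complexification : G ≤ complexification G :=
  fun _ hk => Subgroup.subset_closure (Or.inl hk)

theorem expGL_mem_complexification {χ : V →L[ℂ] V} (hχ : (-Complex.I) • χ ∈ lieAlg G) :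
    expGL χ ∈ complexification G := by
  refine Subgroup.subset_closure (Or.inr ⟨_, hχ, ?_⟩)
  rw [smul_smul]
  simp

/-- The self-adjoint logarithm `½ log (g* g)` of the positive part of `g`. -/
def polarLog (g : V →L[ℂ] V) : V →L[ℂ] V := (1 / 2 : ℝ) • CFC.log (star g * g)

theorem polarLog_isSelfAdjoint (g : V →L[ℂ] V) : IsSelfAdjoint (polarLog g) :=
  (IsSelfAdjoint.all (1 / 2 : ℝ)).smul IsSelfAdjoint.log

theorem exp_two_smul_polarLog (g : (V →L[ℂ] V)ˣ) :
    NormedSpace.exp ((2 : ℝ) • polarLog (g : V →L[ℂ] V)) = star (g : V →L[ℂ] V) * g := by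
  rw [polarLog, smul_smul]
  norm_num
  exact CFC.exp_log _ (IsUnit.isStrictlyPositive (star g * g).isUnit (star_mul_self_nonneg _))

theorem eq_polarLog {g χ : V →L[ℂ] V} (hχ : IsSelfAdjoint χ)
    (h : NormedSpace.exp ((2 : ℝ) • χ) = star g * g) : polarLog g = χ := by
  rw [polarLog, ← h, CFC.log_exp _ ((IsSelfAdjoint.all (2 : ℝ)).smul hχ), smul_smul]
  norm_num

/-- Polar decomposition, infinitesimal part: the positive part of `g ∈ G_ℂ` lies in
`exp (i 𝔤)`. -/
theorem polarLog_mem (hG : IsCompactConnectedUnitary G) {g : (V →L[ℂ] V)ˣ}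
    (hg : g ∈ complexification G) : (-Complex.I) • polarLog (g : V →L[ℂ] V) ∈ lieAlg G := by
  set χ := polarLog (g : V →L[ℂ] V) with hχdef
  have hχ : IsSelfAdjoint χ := polarLog_isSelfAdjoint _
  have hp : expGL ((2 : ℝ) • χ) = star g * g := Units.ext (exp_two_smul_polarLog g)
  have hpZ : star g * g ∈ zariskiClosure G := complexification_le_zariskiClosure hG
    ((complexification G).mul_mem (star_mem_complexification hG hg) hg)
  intro t
  refine mem_of_mem_zariskiClosure hG (star_mul_self_exp_of_skew ?_) fun f hf h => ?_
  · simp [star_smul, hχ.star_eq]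
  -- The powers of `g* g = e^{2χ}` belong to the Zariski closure, hence so does every `e^{zχ}`.
  let τ : ℕ →+ ℂ :=
    { toFun := fun n => 2 * n
      map_zero' := by simp
      map_add' := fun a b => by push_cast; ring }
  have h0 := expPolynomials_eq_zero τ ?_ (regularFunctions_exp_mem_expPolynomials hχ hf) ?_
  · have := congrFun h0 (-(t * Complex.I))
    have e : t • (-Complex.I) • χ = (-(t * Complex.I) : ℂ) • χ := by
      rw [← Complex.coe_smul, smul_smul, mul_neg]
    rw [e]
    exact this
  · intro μ ν hμν
    have h1 := hμν 1
    simp only [τ, AddMonoidHom.coe_mk, ZeroHom.coe_mk, Nat.cast_one, mul_one] at h1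
    have h2 : Real.exp (μ * 2) = Real.exp (ν * 2) := by exact_mod_cast h1
    have := Real.exp_injective h2
    linarith
  · intro n
    have e : expGL (τ n • χ) = (star g * g) ^ n := by
      rw [← hp]
      refine Units.ext ?_
      let _ : NormedAlgebra ℚ (V →L[ℂ] V) := NormedAlgebra.restrictScalars ℚ ℂ _
      rw [Units.val_pow_eq_pow_val, expGL_coe, expGL_coe, ← NormedSpace.exp_nsmul,
        ← Nat.cast_smul_eq_nsmul ℂ, ← Complex.coe_smul, smul_smul, mul_comm]
      simp [τ]
    rw [e]
    exact (zariskiClosure G).pow_mem hpZ n f hf h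

/-- Polar decomposition, compact part: `g e^{-χ} ∈ G` for `g ∈ G_ℂ` and `χ = ½ log (g* g)`. -/
theorem mul_expGL_neg_polarLog_mem (hG : IsCompactConnectedUnitary G) {g : (V →L[ℂ] V)ˣ}
    (hg : g ∈ complexification G) : g * expGL (-polarLog (g : V →L[ℂ] V)) ∈ G := by
  set χ := polarLog (g : V →L[ℂ] V) with hχdef
  have hχ : IsSelfAdjoint χ := polarLog_isSelfAdjoint _
  have hmem := polarLog_mem hG hg
  have hneg : (-Complex.I) • (-χ) ∈ lieAlg G := by
    rw [smul_neg]
    exact (lieSubmodule hG).neg_mem hmem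
  refine mem_of_mem_zariskiClosure hG ?_ (complexification_le_zariskiClosure hG
    ((complexification G).mul_mem hg (expGL_mem_complexification hneg)))
  have h2 : star (g : V →L[ℂ] V) * g = NormedSpace.exp χ * NormedSpace.exp χ := by
    rw [← exp_two_smul_polarLog g, two_smul, exp_add_of_comm (Commute.refl _)]
  rw [Units.val_mul, star_mul, expGL_coe, NormedSpace.star_exp, star_neg, hχ.star_eq, mul_assoc,
    ← mul_assoc (star (g : V →L[ℂ] V)), h2, mul_assoc, exp_mul_exp_neg, mul_one, exp_neg_mul_exp]

theorem polarLog_conj (hG : IsCompactConnectedUnitary G) {t : (V →L[ℂ] V)ˣ} (ht : t ∈ G)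
    (g : (V →L[ℂ] V)ˣ) :
    polarLog ((t * g * t⁻¹ : (V →L[ℂ] V)ˣ) : V →L[ℂ] V)
      = (t : V →L[ℂ] V) * polarLog (g : V →L[ℂ] V) * ((t⁻¹ : (V →L[ℂ] V)ˣ) : V →L[ℂ] V) := by
  have h1 := star_eq_inv_of_mem hG ht
  have h2 := star_eq_inv_of_mem hG (G.inv_mem ht)
  rw [inv_inv] at h2
  refine eq_polarLog ?_ ?_
  · rw [IsSelfAdjoint, star_mul, star_mul, h1, h2, (polarLog_isSelfAdjoint _).star_eq, mul_assoc]
  · rw [← smul_mul_assoc, ← mul_smul_comm, ← expGL_coe, expGL_conj, Units.val_mul, Units.val_mul,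
      expGL_coe, exp_two_smul_polarLog, Units.val_mul, Units.val_mul, star_mul, star_mul, h2, h1]
    simp only [mul_assoc, Units.inv_mul_cancel_left]

end Cartan

/-! ### The complexified Lie algebra and the complexified invariant form -/

section ComplexForm

variable {V : Type*} [NormedAddCommGroup V] [InnerProductSpace ℂ V] [FiniteDimensional ℂ V]
  [CompleteSpace V] {G : Subgroup (V →L[ℂ] V)ˣ}

/-- The component `r` in the decomposition `η = r + i m` of an operator into skew-adjoint
operators. -/
def skewRe : (V →L[ℂ] V) →ₗ[ℝ] (V →L[ℂ] V) where
  toFun η := (1 / 2 : ℂ) • (η - star η)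
  map_add' a b := by rw [star_add]; module
  map_smul' r a := by
    rw [star_smul, star_trivial, RingHom.id_apply, ← smul_sub, smul_comm]

/-- The component `m` in the decomposition `η = r + i m` of an operator into skew-adjoint
operators. -/
def skewIm : (V →L[ℂ] V) →ₗ[ℝ] (V →L[ℂ] V) where
  toFun η := (-(Complex.I / 2)) • (η + star η)
  map_add' a b := by rw [star_add]; module
  map_smul' r a := by
    rw [star_smul, star_trivial, RingHom.id_apply, ← smul_add, smul_comm]

theorem skewRe_apply (η : V →L[ℂ] V) : skewRe η = (1 / 2 : ℂ) • (η - star η) := rfl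

theorem skewIm_apply (η : V →L[ℂ] V) : skewIm η = (-(Complex.I / 2)) • (η + star η) := rfl

theorem skewRe_add_I_smul_skewIm (η : V →L[ℂ] V) : skewRe η + Complex.I • skewIm η = η := by
  rw [skewRe_apply, skewIm_apply, smul_smul]
  have : Complex.I * -(Complex.I / 2) = 1 / 2 := by
    rw [mul_neg, mul_div_assoc', Complex.I_mul_I]; ring
  rw [this]
  module

theorem skewRe_I_smul (η : V →L[ℂ] V) : skewRe (Complex.I • η) = -skewIm η := by
  rw [skewRe_apply, skewIm_apply, star_smul, Complex.star_def, Complex.conj_I]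
  module

theorem skewIm_I_smul (η : V →L[ℂ] V) : skewIm (Complex.I • η) = skewRe η := by
  rw [skewRe_apply, skewIm_apply, star_smul, Complex.star_def, Complex.conj_I]
  have : Complex.I * Complex.I = -1 := Complex.I_mul_I
  rw [neg_smul Complex.I, ← sub_eq_add_neg, ← smul_sub, smul_smul]
  congr 1
  linear_combination (-1 / 2 : ℂ) * this

theorem complex_smul_eq (c : ℂ) (η : V →L[ℂ] V) :
    c • η = c.re • η + c.im • (Complex.I • η) := by
  conv_lhs => rw [← Complex.re_add_im c]
  rw [add_smul, mul_smul, Complex.coe_smul, Complex.coe_smul]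

theorem skewRe_smul (c : ℂ) (η : V →L[ℂ] V) :
    skewRe (c • η) = c.re • skewRe η - c.im • skewIm η := by
  rw [complex_smul_eq, map_add, map_smul, map_smul, skewRe_I_smul, smul_neg, sub_eq_add_neg]

theorem skewIm_smul (c : ℂ) (η : V →L[ℂ] V) :
    skewIm (c • η) = c.re • skewIm η + c.im • skewRe η := by
  rw [complex_smul_eq, map_add, map_smul, map_smul, skewIm_I_smul]

theorem skewRe_neg_star (η : V →L[ℂ] V) : skewRe (-star η) = skewRe η := by
  rw [skewRe_apply, skewRe_apply, star_neg, star_star]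
  congr 1
  abel

theorem skewIm_neg_star (η : V →L[ℂ] V) : skewIm (-star η) = -skewIm η := by
  rw [skewIm_apply, skewIm_apply, star_neg, star_star, ← smul_neg]
  congr 1
  abel

theorem skewRe_of_skew {ξ : V →L[ℂ] V} (h : star ξ = -ξ) : skewRe ξ = ξ := by
  rw [skewRe_apply, h]
  module

theorem skewIm_of_skew {ξ : V →L[ℂ] V} (h : star ξ = -ξ) : skewIm ξ = 0 := by
  rw [skewIm_apply, h]
  module

/-- The complexification `𝔤 ⊕ i 𝔤` of the Lie algebra. -/
def complexLie (hG : IsCompactConnectedUnitary G) : Submodule ℂ (V →L[ℂ] V) where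
  carrier := {η | skewRe η ∈ lieSubmodule hG ∧ skewIm η ∈ lieSubmodule hG}
  add_mem' {a b} ha hb := by
    refine ⟨?_, ?_⟩
    · rw [map_add]; exact add_mem ha.1 hb.1
    · rw [map_add]; exact add_mem ha.2 hb.2
  zero_mem' := by
    refine ⟨?_, ?_⟩ <;> rw [map_zero] <;> exact zero_mem _
  smul_mem' c a ha := by
    refine ⟨?_, ?_⟩
    · rw [skewRe_smul]
      exact sub_mem (Submodule.smul_mem _ _ ha.1) (Submodule.smul_mem _ _ ha.2)
    · rw [skewIm_smul]
      exact add_mem (Submodule.smul_mem _ _ ha.2) (Submodule.smul_mem _ _ ha.1)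

theorem mem_complexLie_of_mem (hG : IsCompactConnectedUnitary G) {ξ : V →L[ℂ] V}
    (hξ : ξ ∈ lieAlg G) : ξ ∈ complexLie hG := by
  have h := star_eq_neg_of_mem_lieAlg hG hξ
  refine ⟨?_, ?_⟩
  · rw [skewRe_of_skew h]; exact hξ
  · rw [skewIm_of_skew h]; exact zero_mem _

theorem isClosed_complexLie (hG : IsCompactConnectedUnitary G) :
    IsClosed (complexLie hG : Set (V →L[ℂ] V)) := Submodule.closed_of_finiteDimensional _

theorem neg_star_mem_complexLie (hG : IsCompactConnectedUnitary G) {η : V →L[ℂ] V}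
    (h : η ∈ complexLie hG) : -star η ∈ complexLie hG := by
  refine ⟨?_, ?_⟩
  · rw [skewRe_neg_star]; exact h.1
  · rw [skewIm_neg_star]; exact neg_mem h.2

theorem complexLie_induction (hG : IsCompactConnectedUnitary G) {p : (V →L[ℂ] V) → Prop}
    (mem : ∀ ξ ∈ lieAlg G, p ξ) (add : ∀ a b, p a → p b → p (a + b))
    (smul : ∀ a, p a → p (Complex.I • a)) {η : V →L[ℂ] V} (h : η ∈ complexLie hG) : p η := by
  rw [← skewRe_add_I_smul_skewIm η]
  exact add _ _ (mem _ h.1) (smul _ (mem _ h.2))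

theorem bracket_mem_complexLie (hG : IsCompactConnectedUnitary G) {a b : V →L[ℂ] V}
    (ha : a ∈ complexLie hG) (hb : b ∈ complexLie hG) : a * b - b * a ∈ complexLie hG := by
  refine complexLie_induction hG (p := fun a => a * b - b * a ∈ complexLie hG) (fun ξ hξ => ?_)
    (fun x y hx hy => ?_) (fun x hx => ?_) ha
  · refine complexLie_induction hG (p := fun b => ξ * b - b * ξ ∈ complexLie hG) (fun η hη => ?_)
      (fun x y hx hy => ?_) (fun x hx => ?_) hb
    · exact mem_complexLie_of_mem hG (bracket_mem_lieAlg hG hξ hη)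
    · convert add_mem hx hy using 1; noncomm_ring
    · convert (complexLie hG).smul_mem Complex.I hx using 1
      rw [mul_smul_comm, smul_mul_assoc, smul_sub]
  · convert add_mem hx hy using 1; noncomm_ring
  · convert (complexLie hG).smul_mem Complex.I hx using 1
    rw [mul_smul_comm, smul_mul_assoc, smul_sub]

theorem exp_conj_mem_complexLie (hG : IsCompactConnectedUnitary G) {a η : V →L[ℂ] V}
    (ha : a ∈ complexLie hG) (hη : η ∈ complexLie hG) :
    NormedSpace.exp a * η * NormedSpace.exp (-a) ∈ complexLie hG :=
  exp_conj_mem (isClosed_complexLie hG) (fun _ hw => bracket_mem_complexLie hG ha hw) hη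

namespace InvariantInnerProduct

/-- The complex bilinear extension of the invariant inner product. -/
def complexForm (B : InvariantInnerProduct G) :
    (V →L[ℂ] V) →ₗ[ℂ] (V →L[ℂ] V) →ₗ[ℂ] ℂ :=
  LinearMap.mk₂ ℂ (fun η ζ =>
    ((B.form (skewRe η) (skewRe ζ) - B.form (skewIm η) (skewIm ζ) : ℝ) : ℂ)
      + Complex.I * ((B.form (skewRe η) (skewIm ζ) + B.form (skewIm η) (skewRe ζ) : ℝ) : ℂ))
    (fun a b c => by
      simp only [map_add, LinearMap.add_apply]; push_cast; ring)
    (fun r a b => by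
      simp only [skewRe_smul, skewIm_smul, map_add, map_sub, map_smul, LinearMap.add_apply,
        LinearMap.sub_apply, LinearMap.smul_apply, smul_eq_mul]
      conv_rhs => rw [← Complex.re_add_im r]
      push_cast
      linear_combination ((r.im : ℂ) * ((B.form (skewRe a) (skewIm b) : ℝ)
        + (B.form (skewIm a) (skewRe b) : ℝ))) * (-Complex.I_mul_I))
    (fun a b c => by
      simp only [map_add, LinearMap.add_apply]; push_cast; ring)
    (fun r a b => by
      simp only [skewRe_smul, skewIm_smul, map_add, map_sub, map_smul, LinearMap.add_apply,
        LinearMap.sub_apply, LinearMap.smul_apply, smul_eq_mul]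
      conv_rhs => rw [← Complex.re_add_im r]
      push_cast
      linear_combination ((r.im : ℂ) * ((B.form (skewRe a) (skewIm b) : ℝ)
        + (B.form (skewIm a) (skewRe b) : ℝ))) * (-Complex.I_mul_I))

/-- The square `B_ℂ(η, -η*)` of the Hermitian norm on the complexified Lie algebra. -/
def normSq (B : InvariantInnerProduct G) (η : V →L[ℂ] V) : ℝ :=
  B.form (skewRe η) (skewRe η) + B.form (skewIm η) (skewIm η)

variable (B : InvariantInnerProduct G)

theorem complexForm_apply (η ζ : V →L[ℂ] V) : B.complexForm η ζ =
    ((B.form (skewRe η) (skewRe ζ) - B.form (skewIm η) (skewIm ζ) : ℝ) : ℂ)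
      + Complex.I * ((B.form (skewRe η) (skewIm ζ) + B.form (skewIm η) (skewRe ζ) : ℝ) : ℂ) := rfl

theorem complexForm_of_mem (hG : IsCompactConnectedUnitary G) {ξ η : V →L[ℂ] V}
    (hξ : ξ ∈ lieAlg G) (hη : η ∈ lieAlg G) : B.complexForm ξ η = B.form ξ η := by
  have h1 := star_eq_neg_of_mem_lieAlg hG hξ
  have h2 := star_eq_neg_of_mem_lieAlg hG hη
  rw [complexForm_apply, skewRe_of_skew h1, skewRe_of_skew h2, skewIm_of_skew h1,
    skewIm_of_skew h2]
  simp

/-- The complexified form as a continuous real bilinear map. -/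
def complexFormL : (V →L[ℂ] V) →L[ℝ] (V →L[ℂ] V) →L[ℝ] ℂ :=
  (LinearMap.mk₂ ℝ (fun η ζ => B.complexForm η ζ) (fun a b c => by simp)
    (fun r a b => by simp) (fun a b c => by simp) (fun r a b => by simp)).toContinuousBilinearMap

theorem complexFormL_apply (η ζ : V →L[ℂ] V) : B.complexFormL η ζ = B.complexForm η ζ := rfl

theorem hasDerivAt_complexForm {f g : ℝ → V →L[ℂ] V} {f' g' : V →L[ℂ] V} {t : ℝ}
    (hf : HasDerivAt f f' t) (hg : HasDerivAt g g' t) :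
    HasDerivAt (fun s => B.complexForm (f s) (g s))
      (B.complexForm f' (g t) + B.complexForm (f t) g') t := by
  have h := (B.complexFormL.hasFDerivAt.comp_hasDerivAt t hf).clm_apply hg
  exact h

theorem normSq_nonneg (hG : IsCompactConnectedUnitary G) {η : V →L[ℂ] V}
    (h : η ∈ complexLie hG) : 0 ≤ B.normSq η := by
  have key : ∀ ξ ∈ lieAlg G, 0 ≤ B.form ξ ξ := fun ξ hξ => by
    rcases eq_or_ne ξ 0 with rfl | h0
    · simp
    · exact (B.pos ξ hξ h0).le
  exact add_nonneg (key _ h.1) (key _ h.2)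

theorem eq_zero_of_normSq_eq_zero (hG : IsCompactConnectedUnitary G) {η : V →L[ℂ] V}
    (h : η ∈ complexLie hG) (h0 : B.normSq η = 0) : η = 0 := by
  have key : ∀ ξ ∈ lieAlg G, 0 ≤ B.form ξ ξ := fun ξ hξ => by
    rcases eq_or_ne ξ 0 with rfl | h0
    · simp
    · exact (B.pos ξ hξ h0).le
  have h1 := key _ h.1
  have h2 := key _ h.2
  unfold normSq at h0
  have h3 : skewRe η = 0 := by
    by_contra hne
    have := B.pos _ h.1 hne
    linarith
  have h4 : skewIm η = 0 := by
    by_contra hne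
    have := B.pos _ h.2 hne
    linarith
  rw [← skewRe_add_I_smul_skewIm η, h3, h4, smul_zero, add_zero]

theorem complexForm_neg_star (hG : IsCompactConnectedUnitary G) {η : V →L[ℂ] V}
    (h : η ∈ complexLie hG) : B.complexForm η (-star η) = B.normSq η := by
  rw [complexForm_apply, skewRe_neg_star, skewIm_neg_star, map_neg, map_neg,
    B.symm _ h.1 _ h.2, normSq]
  simp

/-- Infinitesimal invariance, from the invariance under the one-parameter group of `a`. -/
theorem form_bracket (hG : IsCompactConnectedUnitary G) {a η ζ : V →L[ℂ] V}
    (ha : a ∈ lieAlg G) (hη : η ∈ lieAlg G) (hζ : ζ ∈ lieAlg G) :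
    B.complexForm (a * η - η * a) ζ + B.complexForm η (a * ζ - ζ * a) = 0 := by
  have h1 := hasDerivAt_exp_conj a η 0
  have h2 := hasDerivAt_exp_conj a ζ 0
  have h3 := B.hasDerivAt_complexForm h1 h2
  simp only [zero_smul, neg_zero, NormedSpace.exp_zero, one_mul, mul_one] at h3
  refine h3.unique ?_
  have h4 : (fun s : ℝ => B.complexForm
      (NormedSpace.exp (s • a) * η * NormedSpace.exp (-(s • a)))
      (NormedSpace.exp (s • a) * ζ * NormedSpace.exp (-(s • a))))
      = fun _ => B.complexForm η ζ := by
    ext s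
    have e := B.complexForm_of_mem hG (conj_mem_lieAlg (k := expGL (s • a)) (ha s) hη)
      (conj_mem_lieAlg (k := expGL (s • a)) (ha s) hζ)
    rw [B.invariant _ (ha s) _ hη _ hζ, ← B.complexForm_of_mem hG hη hζ] at e
    exact e
  rw [h4]
  exact hasDerivAt_const _ _

theorem complexForm_bracket (hG : IsCompactConnectedUnitary G) {a η ζ : V →L[ℂ] V}
    (ha : a ∈ complexLie hG) (hη : η ∈ complexLie hG) (hζ : ζ ∈ complexLie hG) :
    B.complexForm (a * η - η * a) ζ + B.complexForm η (a * ζ - ζ * a) = 0 := by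
  refine complexLie_induction hG (p := fun a => B.complexForm (a * η - η * a) ζ
    + B.complexForm η (a * ζ - ζ * a) = 0) (fun a ha => ?_) (fun x y hx hy => ?_)
    (fun x hx => ?_) ha
  · refine complexLie_induction hG (p := fun η => B.complexForm (a * η - η * a) ζ
      + B.complexForm η (a * ζ - ζ * a) = 0) (fun η hη => ?_) (fun x y hx hy => ?_)
      (fun x hx => ?_) hη
    · refine complexLie_induction hG (p := fun ζ => B.complexForm (a * η - η * a) ζ
        + B.complexForm η (a * ζ - ζ * a) = 0) (fun ζ hζ => ?_) (fun x y hx hy => ?_)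
        (fun x hx => ?_) hζ
      · exact B.form_bracket hG ha hη hζ
      · simp only [mul_add, add_mul, map_add, map_sub] at *
        linear_combination hx + hy
      · simp only [mul_smul_comm, smul_mul_assoc, map_smul, map_sub, smul_eq_mul] at *
        linear_combination Complex.I * hx
    · simp only [mul_add, add_mul, map_add, map_sub, LinearMap.add_apply,
        LinearMap.sub_apply] at *
      linear_combination hx + hy
    · simp only [mul_smul_comm, smul_mul_assoc, map_smul, map_sub, smul_eq_mul,
        LinearMap.smul_apply, LinearMap.sub_apply] at *
      linear_combination Complex.I * hx
  · simp only [mul_add, add_mul, map_add, map_sub, LinearMap.add_apply,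
      LinearMap.sub_apply] at *
    linear_combination hx + hy
  · simp only [mul_smul_comm, smul_mul_assoc, map_smul, map_sub, smul_eq_mul,
      LinearMap.smul_apply, LinearMap.sub_apply] at *
    linear_combination Complex.I * hx

/-- The complexified form is invariant under the adjoint action of `e^a`, `a ∈ 𝔤 ⊕ i 𝔤`. -/
theorem complexForm_exp_conj (hG : IsCompactConnectedUnitary G) {a η ζ : V →L[ℂ] V}
    (ha : a ∈ complexLie hG) (hη : η ∈ complexLie hG) (hζ : ζ ∈ complexLie hG) :
    B.complexForm (NormedSpace.exp a * η * NormedSpace.exp (-a))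
      (NormedSpace.exp a * ζ * NormedSpace.exp (-a)) = B.complexForm η ζ := by
  have h : ∀ s : ℝ, HasDerivAt (fun s : ℝ => B.complexForm
      (NormedSpace.exp (s • a) * η * NormedSpace.exp (-(s • a)))
      (NormedSpace.exp (s • a) * ζ * NormedSpace.exp (-(s • a)))) 0 s := fun s => by
    have hs : s • a ∈ complexLie hG := by
      rw [← Complex.coe_smul]; exact (complexLie hG).smul_mem _ ha
    refine (B.hasDerivAt_complexForm (hasDerivAt_exp_conj a η s)
      (hasDerivAt_exp_conj a ζ s)).congr_deriv ?_
    exact B.complexForm_bracket hG ha (exp_conj_mem_complexLie hG hs hη)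
      (exp_conj_mem_complexLie hG hs hζ)
  have := is_const_of_deriv_eq_zero (fun s => (h s).differentiableAt) (fun s => (h s).deriv) 1 0
  simpa using this

end InvariantInnerProduct

end ComplexForm

/-! ### The logarithmic derivative of the positive part of a complex gauge transformation -/

section LogDeriv

variable {V : Type*} [NormedAddCommGroup V] [InnerProductSpace ℂ V] [FiniteDimensional ℂ V]
  [CompleteSpace V] {G : Subgroup (V →L[ℂ] V)ˣ}

/-- The covariant logarithmic derivative `h⁻¹ (∂h + β h) - β` of `h = e^a`, where `da = ∂a` and `β`
is the connection form in the direction of differentiation. -/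
def covLogDeriv (a da β : V →L[ℂ] V) : V →L[ℂ] V :=
  NormedSpace.exp (-a) * fderiv ℂ (NormedSpace.exp : (V →L[ℂ] V) → (V →L[ℂ] V)) a da
    + (NormedSpace.exp (-a) * β * NormedSpace.exp a - β)

theorem hasDerivAt_covLogDeriv (a da β : V →L[ℂ] V) (s : ℝ) :
    HasDerivAt (fun s : ℝ => covLogDeriv (s • a) (s • da) β)
      (NormedSpace.exp (-(s • a)) * (da + (β * a - a * β)) * NormedSpace.exp (s • a)) s :=
  hasDerivAt_logDeriv_exp a da β s

theorem covLogDeriv_zero (β : V →L[ℂ] V) : covLogDeriv 0 0 β = 0 := by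
  simp [covLogDeriv]

/-- If `a` is covariantly constant, so is `e^a`. -/
theorem covLogDeriv_eq_zero {a da β : V →L[ℂ] V} (h : da + (β * a - a * β) = 0) :
    covLogDeriv a da β = 0 := by
  have h1 : ∀ s : ℝ, HasDerivAt (fun s : ℝ => covLogDeriv (s • a) (s • da) β) 0 s := fun s => by
    refine (hasDerivAt_covLogDeriv a da β s).congr_deriv ?_
    rw [h, mul_zero, zero_mul]
  have := is_const_of_deriv_eq_zero (fun s => (h1 s).differentiableAt) (fun s => (h1 s).deriv) 1 0
  simpa [covLogDeriv_zero] using this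

variable (hG : IsCompactConnectedUnitary G) (B : InvariantInnerProduct G)
  {χ dχ β : V →L[ℂ] V}

theorem mem_complexLie_of_I_smul {χ : V →L[ℂ] V} (h : (-Complex.I) • χ ∈ lieAlg G) :
    χ ∈ complexLie hG := by
  have h1 := (complexLie hG).smul_mem Complex.I (mem_complexLie_of_mem hG h)
  rw [smul_smul] at h1
  simpa using h1

theorem real_smul_mem_complexLie {η : V →L[ℂ] V} (h : η ∈ complexLie hG) (s : ℝ) :
    s • η ∈ complexLie hG := by
  rw [← Complex.coe_smul]; exact (complexLie hG).smul_mem _ h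

theorem exp_neg_conj_mem_complexLie {a η : V →L[ℂ] V}
    (ha : a ∈ complexLie hG) (hη : η ∈ complexLie hG) :
    NormedSpace.exp (-a) * η * NormedSpace.exp a ∈ complexLie hG := by
  have := exp_conj_mem_complexLie hG (neg_mem ha) hη
  rwa [neg_neg] at this

theorem covLogDeriv_mem_complexLie (hχ : χ ∈ complexLie hG)
    (hθ : dχ + (β * χ - χ * β) ∈ complexLie hG) : covLogDeriv χ dχ β ∈ complexLie hG := by
  have h := mem_of_hasDerivAt_mem ((complexLie hG).restrictScalars ℝ)
    (fun s => hasDerivAt_covLogDeriv χ dχ β s)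
    (fun s => exp_neg_conj_mem_complexLie hG (real_smul_mem_complexLie hG hχ s) hθ)
    (by rw [zero_smul, zero_smul, covLogDeriv_zero]; exact zero_mem _) 1
  simpa using h

theorem exp_conj_eq_of_commute {a ξ : V →L[ℂ] V} (h : Commute a ξ) :
    NormedSpace.exp a * ξ * NormedSpace.exp (-a) = ξ := by
  have h1 : Commute (NormedSpace.exp a) ξ := h.exp_left
  rw [h1.eq, mul_assoc, exp_mul_exp_neg, mul_one]

/-- Pairing the logarithmic derivative of `h = e^χ` with an element of the Lie algebra that commutes
with `χ`. -/
theorem complexForm_covLogDeriv_of_commute {ξ : V →L[ℂ] V} (hχ : χ ∈ complexLie hG)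
    (hθ : dχ + (β * χ - χ * β) ∈ complexLie hG) (hξ : ξ ∈ complexLie hG) (hc : Commute χ ξ) :
    B.complexForm (covLogDeriv χ dχ β) ξ = B.complexForm (dχ + (β * χ - χ * β)) ξ := by
  set θ := dχ + (β * χ - χ * β) with hθdef
  have h : ∀ s : ℝ, HasDerivAt (fun s : ℝ => B.complexForm (covLogDeriv (s • χ) (s • dχ) β) ξ
      - (s : ℂ) * B.complexForm θ ξ) 0 s := fun s => by
    have h1 := B.hasDerivAt_complexForm (hasDerivAt_covLogDeriv χ dχ β s) (hasDerivAt_const s ξ)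
    have h2 : HasDerivAt (fun s : ℝ => (s : ℂ) * B.complexForm θ ξ) (B.complexForm θ ξ) s := by
      simpa using (Complex.ofRealCLM.hasDerivAt (x := s)).mul_const (B.complexForm θ ξ)
    refine (h1.sub h2).congr_deriv ?_
    have h3 := B.complexForm_exp_conj hG (neg_mem (real_smul_mem_complexLie hG hχ s)) hθ hξ
    rw [exp_conj_eq_of_commute ((hc.smul_left s).neg_left), neg_neg] at h3
    rw [map_zero, add_zero, ← hθdef, h3, sub_self]
  have := is_const_of_deriv_eq_zero (fun s => (h s).differentiableAt) (fun s => (h s).deriv) 1 0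
  simp only [one_smul, zero_smul, covLogDeriv_zero, Complex.ofReal_one, Complex.ofReal_zero,
    map_zero, LinearMap.zero_apply] at this
  linear_combination this

/-- Pairing the logarithmic derivative of `h = e^{2χ}` with `-θ*`, where `2 θ` is the covariant
derivative of `2 χ`: up to a factor `2` the result is a square, by the mean value theorem. -/
theorem exists_re_complexForm_covLogDeriv (hsa : IsSelfAdjoint χ) (hχ : χ ∈ complexLie hG)
    (hθ : dχ + (β * χ - χ * β) ∈ complexLie hG) :
    ∃ s : ℝ, (B.complexForm (covLogDeriv ((2 : ℝ) • χ) ((2 : ℝ) • dχ) β)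
        (-star (dχ + (β * χ - χ * β)))).re
      = 2 * B.normSq (NormedSpace.exp (-(s • χ)) * (dχ + (β * χ - χ * β))
        * NormedSpace.exp (s • χ)) := by
  set θ := dχ + (β * χ - χ * β) with hθdef
  have h : ∀ s : ℝ, HasDerivAt (fun s : ℝ => (B.complexForm
      (covLogDeriv (s • ((2 : ℝ) • χ)) (s • ((2 : ℝ) • dχ)) β) (-star θ)).re)
      (2 * B.normSq (NormedSpace.exp (-(s • χ)) * θ * NormedSpace.exp (s • χ))) s := fun s => by
    have h1 := B.hasDerivAt_complexForm
      (hasDerivAt_covLogDeriv ((2 : ℝ) • χ) ((2 : ℝ) • dχ) β s) (hasDerivAt_const s (-star θ))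
    have h2 := Complex.reCLM.hasFDerivAt.comp_hasDerivAt s h1
    refine h2.congr_deriv ?_
    have hsχ := real_smul_mem_complexLie hG hχ s
    have e1 : (2 : ℝ) • dχ + (β * (2 : ℝ) • χ - (2 : ℝ) • χ * β) = (2 : ℝ) • θ := by
      rw [hθdef, mul_smul_comm, smul_mul_assoc, ← smul_sub, ← smul_add]
    have e2 : s • ((2 : ℝ) • χ) = s • χ + s • χ := by rw [smul_comm, two_smul]
    have e3 : NormedSpace.exp (s • ((2 : ℝ) • χ)) = NormedSpace.exp (s • χ)
        * NormedSpace.exp (s • χ) := by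
      rw [e2, exp_add_of_comm (Commute.refl _)]
    have e4 : NormedSpace.exp (-(s • ((2 : ℝ) • χ))) = NormedSpace.exp (-(s • χ))
        * NormedSpace.exp (-(s • χ)) := by
      rw [e2, neg_add, exp_add_of_comm (Commute.refl _)]
    -- Half of the conjugation is moved to the second argument.
    have hmid : NormedSpace.exp (-(s • χ)) * θ * NormedSpace.exp (s • χ) ∈ complexLie hG :=
      exp_neg_conj_mem_complexLie hG hsχ hθ
    have h3 := B.complexForm_exp_conj hG (neg_mem hsχ) hmid (neg_star_mem_complexLie hG hmid)
    rw [B.complexForm_neg_star hG hmid, neg_neg] at h3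
    have e5 : NormedSpace.exp (-(s • χ)) * -star (NormedSpace.exp (-(s • χ)) * θ
        * NormedSpace.exp (s • χ)) * NormedSpace.exp (s • χ) = -star θ := by
      have hs1 : star (NormedSpace.exp (s • χ)) = NormedSpace.exp (s • χ) := by
        rw [NormedSpace.star_exp, star_smul, hsa.star_eq, star_trivial]
      have hs2 : star (NormedSpace.exp (-(s • χ))) = NormedSpace.exp (-(s • χ)) := by
        rw [NormedSpace.star_exp, star_neg, star_smul, hsa.star_eq, star_trivial]
      rw [star_mul, star_mul, hs1, hs2, mul_neg, neg_mul, ← mul_assoc, exp_neg_mul_exp, one_mul,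
        mul_assoc, exp_neg_mul_exp, mul_one]
    rw [e5] at h3
    rw [e1, e3, e4, map_zero, add_zero]
    have e6 : NormedSpace.exp (-(s • χ)) * NormedSpace.exp (-(s • χ)) * (2 : ℝ) • θ
        * (NormedSpace.exp (s • χ) * NormedSpace.exp (s • χ))
        = (2 : ℝ) • (NormedSpace.exp (-(s • χ)) * (NormedSpace.exp (-(s • χ)) * θ
          * NormedSpace.exp (s • χ)) * NormedSpace.exp (s • χ)) := by
      rw [mul_smul_comm, smul_mul_assoc]
      simp only [mul_assoc]
    rw [e6, ← Complex.coe_smul, map_smul, LinearMap.smul_apply, h3]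
    simp
  obtain ⟨s, -, hs⟩ := exists_hasDerivAt_eq_slope _ _ (zero_lt_one (α := ℝ))
    (fun s _ => (h s).continuousAt.continuousWithinAt) (fun s _ => h s)
  refine ⟨s, ?_⟩
  rw [hs]
  simp [covLogDeriv_zero]

end LogDeriv

/-! ### Complex gauge transformations at a point -/

section GaugeAlgebra

variable {V : Type*} [NormedAddCommGroup V] [InnerProductSpace ℂ V] [FiniteDimensional ℂ V]
  [CompleteSpace V]

/-- If the `(0,1)`-parts of two unitary connections are related by a complex gauge transformation
`g`, with derivatives `p`, `q` in the two coordinate directions, then `g` transforms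
`(ax + σ, ay + i σ)` into the second connection, where `σ = h⁻¹ ∂_A h` and `h = g* g`. -/
theorem gauge_real_of_gauge01 {ax ay bx b_y p q σ g gi : V →L[ℂ] V}
    (hgi : g * gi = 1) (hig : gi * g = 1)
    (hax : star ax = -ax) (hay : star ay = -ay) (hbx : star bx = -bx) (hby : star b_y = -b_y)
    (h01 : (1 / 2 : ℂ) • (bx + Complex.I • b_y) = g * ((1 / 2 : ℂ) • (ax + Complex.I • ay)) * gi
      - (1 / 2 : ℂ) • (p + Complex.I • q) * gi)
    (hσ : star g * g * (σ + (1 / 2 : ℂ) • (ax - Complex.I • ay))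
      = (1 / 2 : ℂ) • ((star p * g + star g * p) - Complex.I • (star q * g + star g * q))
        + (1 / 2 : ℂ) • (ax - Complex.I • ay) * (star g * g)) :
    bx = g * (ax + σ) * gi - p * gi ∧
      b_y = g * (ay + Complex.I • σ) * gi - q * gi := by
  have hs1 : star gi * star g = 1 := by rw [← star_mul, hgi, star_one]
  have hs2 : star g * star gi = 1 := by rw [← star_mul, hig, star_one]
  set α := (1 / 2 : ℂ) • (ax + Complex.I • ay) with hα
  set β := (1 / 2 : ℂ) • (ax - Complex.I • ay) with hβ
  have hαs : star α = -β := by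
    rw [hα, hβ, star_smul, star_add, star_smul, hax, hay, Complex.star_def,
      Complex.conj_I]
    simp only [map_div₀, map_one, map_ofNat]
    module
  -- The `(1,0)`-part of the second connection
  have hb10 : (1 / 2 : ℂ) • (bx - Complex.I • b_y) = star gi * β * star g
      + star gi * ((1 / 2 : ℂ) • (star p - Complex.I • star q)) := by
    have h1 : (1 / 2 : ℂ) • (bx - Complex.I • b_y)
        = -star ((1 / 2 : ℂ) • (bx + Complex.I • b_y)) := by
      rw [star_smul, star_add, star_smul, hbx, hby, Complex.star_def,
        Complex.conj_I]
      simp only [map_div₀, map_one, map_ofNat]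
      module
    rw [h1, h01, star_sub, star_mul, star_mul, star_mul, hαs, star_smul, star_add, star_smul,
      Complex.star_def, Complex.conj_I]
    simp only [map_div₀, map_one, map_ofNat]
    have : (1 / 2 : ℂ) • (star p + -Complex.I • star q)
        = (1 / 2 : ℂ) • (star p - Complex.I • star q) := by module
    rw [this]
    noncomm_ring
  have hb10' : (1 / 2 : ℂ) • (bx - Complex.I • b_y)
      = g * (σ + β) * gi - (1 / 2 : ℂ) • (p - Complex.I • q) * gi := by
    have h2 : g * (σ + β) = star gi * (star g * g * (σ + β)) := by
      rw [← mul_assoc, ← mul_assoc, hs1, one_mul]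
    rw [hb10, h2, hσ]
    have h3 : (1 / 2 : ℂ) • (star p * g + star g * p - Complex.I • (star q * g + star g * q))
        = ((1 / 2 : ℂ) • (star p - Complex.I • star q)) * g
          + star g * ((1 / 2 : ℂ) • (p - Complex.I • q)) := by
      simp only [smul_mul_assoc, mul_smul_comm, sub_mul, mul_sub]
      module
    rw [h3]
    set P := (1 / 2 : ℂ) • (star p - Complex.I • star q)
    set Q := (1 / 2 : ℂ) • (p - Complex.I • q)
    have h4 : star gi * (P * g + star g * Q + β * (star g * g)) * gi
        = star gi * P * (g * gi) + (star gi * star g) * Q * gi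
          + star gi * β * star g * (g * gi) := by noncomm_ring
    rw [h4, hgi, hs1]
    noncomm_ring
  have hx : bx = (1 / 2 : ℂ) • (bx + Complex.I • b_y) + (1 / 2 : ℂ) • (bx - Complex.I • b_y) := by
    module
  have hI : Complex.I * Complex.I = -1 := Complex.I_mul_I
  have hy : b_y = (-Complex.I) • ((1 / 2 : ℂ) • (bx + Complex.I • b_y)
      - (1 / 2 : ℂ) • (bx - Complex.I • b_y)) := by
    have : (1 / 2 : ℂ) • (bx + Complex.I • b_y) - (1 / 2 : ℂ) • (bx - Complex.I • b_y)
      = Complex.I • b_y := by module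
    rw [this, smul_smul]
    simp
  refine ⟨?_, ?_⟩
  · rw [hx, h01, hb10']
    have e1 : ax = α + β := by rw [hα, hβ]; module
    have e2 : p = (1 / 2 : ℂ) • (p + Complex.I • q) + (1 / 2 : ℂ) • (p - Complex.I • q) := by module
    conv_rhs => rw [e1, e2]
    noncomm_ring
  · rw [hy, h01, hb10']
    have e1 : ay = (-Complex.I) • (α - β) := by
      have : α - β = Complex.I • ay := by rw [hα, hβ]; module
      rw [this, smul_smul]; simp
    have e2 : q = (-Complex.I) • ((1 / 2 : ℂ) • (p + Complex.I • q)
        - (1 / 2 : ℂ) • (p - Complex.I • q)) := by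
      have : (1 / 2 : ℂ) • (p + Complex.I • q) - (1 / 2 : ℂ) • (p - Complex.I • q)
        = Complex.I • q := by module
      rw [this, smul_smul]
      simp
    have e3 : ay + Complex.I • σ = (-Complex.I) • (α - β - σ) := by
      rw [e1]; module
    rw [e3]
    conv_rhs => rw [e2]
    simp only [mul_smul_comm, smul_mul_assoc]
    rw [← smul_sub]
    congr 1
    simp only [mul_add, add_mul, mul_sub, sub_mul, smul_mul_assoc]
    abel

end GaugeAlgebra

/-! ### Curvature and complex gauge transformations in a coordinate disc -/

section LocalCurvature

variable {V : Type*} [NormedAddCommGroup V] [InnerProductSpace ℂ V] [FiniteDimensional ℂ V]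
  [CompleteSpace V]

theorem hasFDerivAt_units_inv {g : ℂ → (V →L[ℂ] V)ˣ} {z : ℂ} {g' : ℂ →L[ℝ] (V →L[ℂ] V)}
    (h : HasFDerivAt (fun z => (g z : V →L[ℂ] V)) g' z) :
    HasFDerivAt (fun z => (((g z)⁻¹ : (V →L[ℂ] V)ˣ) : V →L[ℂ] V))
      ((-ContinuousLinearMap.mulLeftRight ℝ (V →L[ℂ] V) ((g z)⁻¹ : (V →L[ℂ] V)ˣ)
        ((g z)⁻¹ : (V →L[ℂ] V)ˣ)) ∘L g') z := by
  have h1 := (hasFDerivAt_ringInverse (𝕜 := ℝ) (g z)).comp z h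
  simpa [Function.comp_def] using h1

/-- The curvature `∂₁ a₂ - ∂₂ a₁ + [a₁, a₂]` of the connection with components `a₁`, `a₂`. -/
def planeCurvature (ax ay : ℂ → V →L[ℂ] V) (z : ℂ) : V →L[ℂ] V :=
  fderiv ℝ ay z 1 - fderiv ℝ ax z Complex.I + (ax z * ay z - ay z * ax z)

/-- Gauge covariance of the curvature, for gauge transformations with values in `GL(V)`. -/
theorem planeCurvature_gauge {Bx By bx b_y : ℂ → V →L[ℂ] V} {g : ℂ → (V →L[ℂ] V)ˣ} {z₀ : ℂ}
    (hg : ContDiffAt ℝ 2 (fun z => (g z : V →L[ℂ] V)) z₀)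
    (hBx : DifferentiableAt ℝ Bx z₀) (hBy : DifferentiableAt ℝ By z₀)
    (hx : ∀ᶠ z in 𝓝 z₀, bx z = (g z : V →L[ℂ] V) * Bx z * ((g z)⁻¹ : (V →L[ℂ] V)ˣ)
      - fderiv ℝ (fun z => (g z : V →L[ℂ] V)) z 1 * ((g z)⁻¹ : (V →L[ℂ] V)ˣ))
    (hy : ∀ᶠ z in 𝓝 z₀, b_y z = (g z : V →L[ℂ] V) * By z * ((g z)⁻¹ : (V →L[ℂ] V)ˣ)
      - fderiv ℝ (fun z => (g z : V →L[ℂ] V)) z Complex.I * ((g z)⁻¹ : (V →L[ℂ] V)ˣ)) :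
    planeCurvature bx b_y z₀
      = (g z₀ : V →L[ℂ] V) * planeCurvature Bx By z₀ * ((g z₀)⁻¹ : (V →L[ℂ] V)ˣ) := by
  have hgd : HasFDerivAt (fun z => (g z : V →L[ℂ] V)) _ z₀ :=
    (hg.differentiableAt two_ne_zero).hasFDerivAt
  have hinv := hasFDerivAt_units_inv hgd
  have hD : DifferentiableAt ℝ (fderiv ℝ (fun z => (g z : V →L[ℂ] V))) z₀ :=
    (hg.fderiv_right (m := 1) (by norm_num)).differentiableAt one_ne_zero
  have hsym : fderiv ℝ (fderiv ℝ (fun z => (g z : V →L[ℂ] V))) z₀ 1 Complex.I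
      = fderiv ℝ (fderiv ℝ (fun z => (g z : V →L[ℂ] V))) z₀ Complex.I 1 :=
    (hg.isSymmSndFDerivAt (by simp)) 1 Complex.I
  have hp : ∀ v : ℂ, HasFDerivAt (fun z => fderiv ℝ (fun z => (g z : V →L[ℂ] V)) z v)
      ((fderiv ℝ (fderiv ℝ (fun z => (g z : V →L[ℂ] V))) z₀).flip v) z₀ := fun v => by
    have := hD.hasFDerivAt.clm_apply (hasFDerivAt_const v z₀)
    simpa using this
  have key : ∀ (B b : ℂ → V →L[ℂ] V) (v w : ℂ), DifferentiableAt ℝ B z₀ →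
      (∀ᶠ z in 𝓝 z₀, b z = (g z : V →L[ℂ] V) * B z * ((g z)⁻¹ : (V →L[ℂ] V)ˣ)
        - fderiv ℝ (fun z => (g z : V →L[ℂ] V)) z v * ((g z)⁻¹ : (V →L[ℂ] V)ˣ)) →
      fderiv ℝ b z₀ w = fderiv ℝ (fun z => (g z : V →L[ℂ] V)) z₀ w * B z₀
          * ((g z₀)⁻¹ : (V →L[ℂ] V)ˣ)
        + (g z₀ : V →L[ℂ] V) * fderiv ℝ B z₀ w * ((g z₀)⁻¹ : (V →L[ℂ] V)ˣ)
        - (g z₀ : V →L[ℂ] V) * B z₀ * ((g z₀)⁻¹ : (V →L[ℂ] V)ˣ)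
          * fderiv ℝ (fun z => (g z : V →L[ℂ] V)) z₀ w * ((g z₀)⁻¹ : (V →L[ℂ] V)ˣ)
        - fderiv ℝ (fderiv ℝ (fun z => (g z : V →L[ℂ] V))) z₀ w v * ((g z₀)⁻¹ : (V →L[ℂ] V)ˣ)
        + fderiv ℝ (fun z => (g z : V →L[ℂ] V)) z₀ v * ((g z₀)⁻¹ : (V →L[ℂ] V)ˣ)
          * fderiv ℝ (fun z => (g z : V →L[ℂ] V)) z₀ w * ((g z₀)⁻¹ : (V →L[ℂ] V)ˣ) := by
    intro B b v w hB hb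
    have h1 := ((hgd.mul' hB.hasFDerivAt).mul' hinv).sub ((hp v).mul' hinv)
    have h2 : b =ᶠ[𝓝 z₀] _ := hb
    rw [(h1.congr_of_eventuallyEq h2).fderiv]
    simp only [sub_apply, add_apply,
      smul_apply, ContinuousLinearMap.coe_comp, comp_apply,
      neg_apply, ContinuousLinearMap.mulLeftRight_apply,
      ContinuousLinearMap.flip_apply, smul_eq_mul, MulOpposite.smul_eq_mul_unop,
      MulOpposite.unop_op, Pi.mul_apply]
    noncomm_ring
  unfold planeCurvature
  rw [key By b_y Complex.I 1 hBy hy, key Bx bx 1 Complex.I hBx hx, hsym, hx.self_of_nhds,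
    hy.self_of_nhds]
  set a := (g z₀ : V →L[ℂ] V)
  set c := (((g z₀)⁻¹ : (V →L[ℂ] V)ˣ) : V →L[ℂ] V)
  have hca : ∀ T, c * (a * T) = T := fun T => by simp [a, c]
  simp only [mul_sub, sub_mul, mul_add, add_mul, mul_assoc, hca]
  abel

end LocalCurvature

/-! ### The Laplacian of the squared length of the polar part -/

section LocalIdentity

variable {V : Type*} [NormedAddCommGroup V] [InnerProductSpace ℂ V] [FiniteDimensional ℂ V]
  [CompleteSpace V] {G : Subgroup (V →L[ℂ] V)ˣ}

/-- The Laplacian of a function on the plane. -/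
def planeLaplacian (f : ℂ → ℝ) (z : ℂ) : ℝ :=
  fderiv ℝ (fun w => fderiv ℝ f w 1) z 1 + fderiv ℝ (fun w => fderiv ℝ f w Complex.I) z Complex.I

/-- `∂f/∂z` for a function with values in `End(V)`. -/
def dz (f : ℂ → V →L[ℂ] V) (z : ℂ) : V →L[ℂ] V :=
  (1 / 2 : ℂ) • (fderiv ℝ f z 1 - Complex.I • fderiv ℝ f z Complex.I)

/-- Locally on `GL(V)`, the self-adjoint logarithm of the positive part extends to a smooth function
on an open set of `End(V)`. -/
theorem exists_contDiffAt_polarLog (g : (V →L[ℂ] V)ˣ) :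
    ∃ l : (V →L[ℂ] V) → (V →L[ℂ] V), ContDiffAt ℝ ∞ l (g : V →L[ℂ] V) ∧
      ∀ᶠ b in 𝓝 (g : V →L[ℂ] V), ∀ c : (V →L[ℂ] V)ˣ, (c : V →L[ℂ] V) = b →
        polarLog (c : V →L[ℂ] V) = l b := by
  have hsa : ∀ c : V →L[ℂ] V, IsSelfAdjoint ((2 : ℝ) • polarLog c) := fun c =>
    (IsSelfAdjoint.all (2 : ℝ)).smul (polarLog_isSelfAdjoint c)
  obtain ⟨l, hl, hl'⟩ := exists_contDiffAt_log (hsa (g : V →L[ℂ] V))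
  have hs : ContDiff ℝ ∞ (fun b : V →L[ℂ] V => star b * b) :=
    ((starL' ℝ : (V →L[ℂ] V) ≃L[ℝ] (V →L[ℂ] V)).contDiff).mul contDiff_id
  rw [exp_two_smul_polarLog] at hl hl'
  refine ⟨fun b => (1 / 2 : ℝ) • l (star b * b), (ContDiffAt.comp (g := l)
    (f := fun b : V →L[ℂ] V => star b * b) (g : V →L[ℂ] V) hl hs.contDiffAt).const_smul _, ?_⟩
  filter_upwards [hs.continuous.continuousAt.eventually hl'] with b hb c hc
  rw [← hc] at hb ⊢
  rw [hb _ (hsa c) (exp_two_smul_polarLog c), smul_smul]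
  norm_num

theorem contDiffAt_polarLog_comp {g : ℂ → (V →L[ℂ] V)ˣ} {z : ℂ}
    (hg : ContDiffAt ℝ ∞ (fun z => (g z : V →L[ℂ] V)) z) :
    ContDiffAt ℝ ∞ (fun z => polarLog (g z : V →L[ℂ] V)) z := by
  obtain ⟨l, hl, hl'⟩ := exists_contDiffAt_polarLog (g z)
  refine (ContDiffAt.comp (g := l) z hl hg).congr_of_eventuallyEq ?_
  filter_upwards [hg.continuousAt.eventually hl'] with w hw
  exact hw _ rfl

theorem hasFDerivAt_exp_comp {a : ℂ → V →L[ℂ] V} {z : ℂ} (ha : DifferentiableAt ℝ a z) :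
    HasFDerivAt (fun w => NormedSpace.exp (a w))
      ((fderiv ℂ (NormedSpace.exp : (V →L[ℂ] V) → (V →L[ℂ] V)) (a z)).restrictScalars ℝ ∘L
        fderiv ℝ a z) z :=
  ((hasFDerivAt_exp_fderiv (a z)).restrictScalars ℝ).comp z ha.hasFDerivAt

theorem differentiableAt_covLogDeriv {a da β : ℂ → V →L[ℂ] V} {z : ℂ}
    (ha : DifferentiableAt ℝ a z) (hda : DifferentiableAt ℝ da z) (hβ : DifferentiableAt ℝ β z) :
    DifferentiableAt ℝ (fun w => covLogDeriv (a w) (da w) (β w)) z := by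
  have h1 : DifferentiableAt ℝ (fun w => NormedSpace.exp (a w)) z :=
    (hasFDerivAt_exp_comp ha).differentiableAt
  have h2 : DifferentiableAt ℝ (fun w => NormedSpace.exp (-a w)) z :=
    (hasFDerivAt_exp_comp ha.neg).differentiableAt
  have h3 : DifferentiableAt ℝ (fun w =>
      (fderiv ℂ (NormedSpace.exp : (V →L[ℂ] V) → (V →L[ℂ] V)) (a w)).restrictScalars ℝ) z := by
    have e : DifferentiableAt ℝ (fderiv ℂ (NormedSpace.exp : (V →L[ℂ] V) → (V →L[ℂ] V))) (a z) :=
      (differentiable_fderiv_exp (a z)).restrictScalars ℝ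
    exact ((ContinuousLinearMap.restrictScalarsL ℂ (V →L[ℂ] V) (V →L[ℂ] V) ℝ ℝ).differentiableAt).comp
      z (e.comp z ha)
  exact (h2.mul (h3.clm_apply hda)).add (((h2.mul hβ).mul h1).sub hβ)

/-- The derivative of a function with values in `End(V)` takes the values of the function in a
closed subspace to the same subspace. -/
theorem fderiv_mem_of_eventually_mem {W : Submodule ℝ (V →L[ℂ] V)} {c : ℂ → V →L[ℂ] V} {z : ℂ}
    (h : DifferentiableAt ℝ c z) (hc : ∀ᶠ y in 𝓝 z, c y ∈ W) (v : ℂ) : fderiv ℝ c z v ∈ W :=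
  hasFDerivAt_mem_of_eventually_mem (Submodule.closed_of_finiteDimensional _) h.hasFDerivAt hc v

variable (B : InvariantInnerProduct G)

theorem differentiableAt_dz {f : ℂ → V →L[ℂ] V} {z : ℂ} (hf : ContDiffAt ℝ 2 f z) :
    DifferentiableAt ℝ (dz f) z := by
  have hD : DifferentiableAt ℝ (fderiv ℝ f) z :=
    (hf.fderiv_right (m := 1) (by norm_num)).differentiableAt one_ne_zero
  have h1 := hD.clm_apply (differentiableAt_const (1 : ℂ))
  have h2 := hD.clm_apply (differentiableAt_const Complex.I)
  exact (h1.sub (h2.const_smul Complex.I)).const_smul (1 / 2 : ℂ)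

/-- The product rule for the complexified form. -/
theorem fderiv_complexForm {f g : ℂ → V →L[ℂ] V} {z : ℂ} (hf : DifferentiableAt ℝ f z)
    (hg : DifferentiableAt ℝ g z) (v : ℂ) :
    fderiv ℝ (fun w => B.complexForm (f w) (g w)) z v
      = B.complexForm (fderiv ℝ f z v) (g z) + B.complexForm (f z) (fderiv ℝ g z v) := by
  have h1 : HasFDerivAt (fun w => B.complexFormL (f w)) (B.complexFormL ∘L fderiv ℝ f z) z :=
    B.complexFormL.hasFDerivAt.comp z hf.hasFDerivAt
  have h2 := h1.clm_apply hg.hasFDerivAt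
  have h3 : fderiv ℝ (fun w => B.complexFormL (f w) (g w)) z v = _ :=
    congrArg (fun T : ℂ →L[ℝ] ℂ => T v) h2.fderiv
  simp only [InvariantInnerProduct.complexFormL_apply] at h3
  rw [h3]
  simp only [add_apply, ContinuousLinearMap.coe_comp, comp_apply,
    ContinuousLinearMap.flip_apply, InvariantInnerProduct.complexFormL_apply]
  ring

theorem fderiv_form_self (hG : IsCompactConnectedUnitary G) {ξ : ℂ → V →L[ℂ] V} {z : ℂ}
    (h : DifferentiableAt ℝ ξ z) (hξ : ∀ᶠ w in 𝓝 z, ξ w ∈ lieAlg G) (v : ℂ) :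
    ((fderiv ℝ (fun w => B.form (ξ w) (ξ w)) z v : ℝ) : ℂ)
      = 2 * B.complexForm (fderiv ℝ ξ z v) (ξ z) := by
  have hmem : fderiv ℝ ξ z v ∈ lieAlg G :=
    fderiv_mem_of_eventually_mem (W := lieSubmodule hG) h hξ v
  have hz := hξ.self_of_nhds
  let L := LinearMap.toContinuousBilinearMap B.form
  have h1 : HasFDerivAt (fun w => L (ξ w)) (L ∘L fderiv ℝ ξ z) z :=
    L.hasFDerivAt.comp z h.hasFDerivAt
  have h2 := h1.clm_apply h.hasFDerivAt
  have h3 : fderiv ℝ (fun w => L (ξ w) (ξ w)) z v = _ :=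
    congrArg (fun T : ℂ →L[ℝ] ℝ => T v) h2.fderiv
  simp only [add_apply, ContinuousLinearMap.coe_comp, comp_apply,
    ContinuousLinearMap.flip_apply, LinearMap.toContinuousBilinearMap_apply, L] at h3
  rw [h3, B.complexForm_of_mem hG hmem hz, B.symm _ hz _ hmem]
  push_cast
  ring

end LocalIdentity

section LocalIdentity

variable {V : Type*} [NormedAddCommGroup V] [InnerProductSpace ℂ V] [FiniteDimensional ℂ V]
  [CompleteSpace V] {G : Subgroup (V →L[ℂ] V)ˣ}

theorem two_le_infty : (2 : ℕ∞ω) ≤ ∞ := ENat.LEInfty.out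

/-- The `∂/∂z`-component of the covariant derivative of `χ`; `ax`, `ay` are the components of the
connection form. -/
def covDz (ax ay χ : ℂ → V →L[ℂ] V) (z : ℂ) : V →L[ℂ] V :=
  dz χ z + ((1 / 2 : ℂ) • (ax z - Complex.I • ay z) * χ z
    - χ z * (1 / 2 : ℂ) • (ax z - Complex.I • ay z))

/-- The `(1,0)`-form `h⁻¹ ∂_A h` of the positive part `h = e^{2χ}` of a complex gauge
transformation, in a coordinate. -/
def gaugeSigma (ax ay χ : ℂ → V →L[ℂ] V) (z : ℂ) : V →L[ℂ] V :=
  covLogDeriv ((2 : ℝ) • χ z) ((2 : ℝ) • dz χ z) ((1 / 2 : ℂ) • (ax z - Complex.I • ay z))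

theorem dz_star_mul_self {g : ℂ → V →L[ℂ] V} {z : ℂ} (hg : DifferentiableAt ℝ g z) :
    dz (fun w => star (g w) * g w) z = (1 / 2 : ℂ) • ((star (fderiv ℝ g z 1) * g z
      + star (g z) * fderiv ℝ g z 1) - Complex.I • (star (fderiv ℝ g z Complex.I) * g z
      + star (g z) * fderiv ℝ g z Complex.I)) := by
  have h1 : HasFDerivAt (fun w => star (g w)) _ z :=
    ((starL' ℝ : (V →L[ℂ] V) ≃L[ℝ] (V →L[ℂ] V)).hasFDerivAt).comp z hg.hasFDerivAt
  have h2 := h1.mul' hg.hasFDerivAt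
  have h3 : ∀ v, fderiv ℝ (fun w => star (g w) * g w) z v = star (fderiv ℝ g z v) * g z
      + star (g z) * fderiv ℝ g z v := fun v => by
    have := congrArg (fun T : ℂ →L[ℝ] (V →L[ℂ] V) => T v) h2.fderiv
    refine this.trans ?_
    simp [add_comm]
  rw [dz, h3, h3]

theorem dz_exp {a : ℂ → V →L[ℂ] V} {z : ℂ} (ha : DifferentiableAt ℝ a z) :
    dz (fun w => NormedSpace.exp (a w)) z
      = fderiv ℂ (NormedSpace.exp : (V →L[ℂ] V) → (V →L[ℂ] V)) (a z) (dz a z) := by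
  have h := hasFDerivAt_exp_comp ha
  rw [dz, h.fderiv, dz, map_smul, map_sub, map_smul]
  rfl

theorem dz_const_smul {a : ℂ → V →L[ℂ] V} {z : ℂ} (ha : DifferentiableAt ℝ a z) (r : ℝ) :
    dz (fun w => r • a w) z = r • dz a z := by
  rw [dz, fderiv_fun_const_smul ha, dz]
  simp only [smul_apply]
  rw [smul_comm r (1 / 2 : ℂ), smul_sub r, smul_comm r Complex.I]

/-- The defining relation `h (σ + β) = ∂_z h + β h` of `σ = h⁻¹ ∂_A h`. -/
theorem star_mul_self_mul_gaugeSigma {ax ay : ℂ → V →L[ℂ] V} {g : ℂ → (V →L[ℂ] V)ˣ} {z : ℂ}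
    (hg : ContDiffAt ℝ ∞ (fun z => (g z : V →L[ℂ] V)) z) :
    star (g z : V →L[ℂ] V) * (g z : V →L[ℂ] V)
      * (gaugeSigma ax ay (fun w => polarLog (g w : V →L[ℂ] V)) z
          + (1 / 2 : ℂ) • (ax z - Complex.I • ay z))
      = dz (fun w => star (g w : V →L[ℂ] V) * (g w : V →L[ℂ] V)) z
        + (1 / 2 : ℂ) • (ax z - Complex.I • ay z)
          * (star (g z : V →L[ℂ] V) * (g z : V →L[ℂ] V)) := by
  have hχ : DifferentiableAt ℝ (fun w => polarLog (g w : V →L[ℂ] V)) z :=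
    (contDiffAt_polarLog_comp hg).differentiableAt (by simp)
  have e1 : (fun w => star (g w : V →L[ℂ] V) * (g w : V →L[ℂ] V))
      = fun w => NormedSpace.exp ((2 : ℝ) • polarLog (g w : V →L[ℂ] V)) :=
    funext fun w => (exp_two_smul_polarLog (g w)).symm
  rw [e1, dz_exp (a := fun w => (2 : ℝ) • polarLog (g w : V →L[ℂ] V)) (hχ.const_smul (2 : ℝ)),
    dz_const_smul hχ, ← exp_two_smul_polarLog, gaugeSigma,
    covLogDeriv]
  set a := (2 : ℝ) • polarLog (g z : V →L[ℂ] V)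
  have h := exp_mul_exp_neg a
  simp only [mul_add, mul_sub, ← mul_assoc, h, one_mul]
  abel

variable (B : InvariantInnerProduct G)

set_option maxHeartbeats 1000000 in
/-- The Bochner-type identity: if a complex gauge transformation `g = k e^χ` relates two unitary
connections in a coordinate disc, whose curvatures are `-lam • φ` and `-lam • φ'`, then a quarter of
the Laplacian of the squared length of `ξ = -i χ` is the sum of the curvature term and of the squared
norm of the covariant derivative of `ξ`, conjugated by some `e^{sχ}`. -/
theorem planeLaplacian_normSq_polarLog (hG : IsCompactConnectedUnitary G)
    {ax ay bx b_y : ℂ → V →L[ℂ] V} {g : ℂ → (V →L[ℂ] V)ˣ} {z₀ : ℂ} {lam : ℝ} {φ φ' : V →L[ℂ] V}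
    (hgs : ∀ᶠ z in 𝓝 z₀, ContDiffAt ℝ ∞ (fun z => (g z : V →L[ℂ] V)) z)
    (hgc : ∀ᶠ z in 𝓝 z₀, g z ∈ complexification G)
    (hax : ∀ᶠ z in 𝓝 z₀, ax z ∈ lieAlg G) (hay : ∀ᶠ z in 𝓝 z₀, ay z ∈ lieAlg G)
    (hbx : ∀ᶠ z in 𝓝 z₀, bx z ∈ lieAlg G) (hby : ∀ᶠ z in 𝓝 z₀, b_y z ∈ lieAlg G)
    (dax : DifferentiableAt ℝ ax z₀) (day : DifferentiableAt ℝ ay z₀)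
    (h01 : ∀ᶠ z in 𝓝 z₀, (1 / 2 : ℂ) • (bx z + Complex.I • b_y z)
      = (g z : V →L[ℂ] V) * ((1 / 2 : ℂ) • (ax z + Complex.I • ay z)) * ((g z)⁻¹ : (V →L[ℂ] V)ˣ)
        - (1 / 2 : ℂ) • (fderiv ℝ (fun z => (g z : V →L[ℂ] V)) z 1
          + Complex.I • fderiv ℝ (fun z => (g z : V →L[ℂ] V)) z Complex.I)
          * ((g z)⁻¹ : (V →L[ℂ] V)ˣ))
    (hF : planeCurvature ax ay z₀ = -(lam • φ)) (hF' : planeCurvature bx b_y z₀ = -(lam • φ')) :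
    covDz ax ay (fun z => polarLog (g z : V →L[ℂ] V)) z₀ ∈ complexLie hG ∧
    ∃ s : ℝ, planeLaplacian (fun z => B.form ((-Complex.I) • polarLog (g z : V →L[ℂ] V))
        ((-Complex.I) • polarLog (g z : V →L[ℂ] V))) z₀ / 4
      = lam / 2 * ((B.complexForm ((((g z₀)⁻¹ : (V →L[ℂ] V)ˣ) : V →L[ℂ] V) * φ' * (g z₀ : V →L[ℂ] V))
          ((-Complex.I) • polarLog (g z₀ : V →L[ℂ] V))).re
          - (B.complexForm φ ((-Complex.I) • polarLog (g z₀ : V →L[ℂ] V))).re)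
        + 2 * B.normSq (NormedSpace.exp (-(s • polarLog (g z₀ : V →L[ℂ] V)))
          * covDz ax ay (fun z => polarLog (g z : V →L[ℂ] V)) z₀
          * NormedSpace.exp (s • polarLog (g z₀ : V →L[ℂ] V))) := by
  set χ : ℂ → V →L[ℂ] V := fun z => polarLog (g z : V →L[ℂ] V) with hχdef
  set ξ : ℂ → V →L[ℂ] V := fun z => (-Complex.I) • χ z with hξdef
  set σ : ℂ → V →L[ℂ] V := gaugeSigma ax ay χ with hσdef
  set β : ℂ → V →L[ℂ] V := fun z => (1 / 2 : ℂ) • (ax z - Complex.I • ay z) with hβdef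
  have hg := hgs.self_of_nhds
  have hχs : ContDiffAt ℝ ∞ χ z₀ := contDiffAt_polarLog_comp hg
  have hξs : ContDiffAt ℝ ∞ ξ z₀ := hχs.const_smul (-Complex.I)
  have hχd : ∀ᶠ z in 𝓝 z₀, DifferentiableAt ℝ χ z :=
    ((hχs.of_le (m := 1) (by exact_mod_cast le_top)).eventually (by simp)).mono
      fun z h => h.differentiableAt one_ne_zero
  have hξd : ∀ᶠ z in 𝓝 z₀, DifferentiableAt ℝ ξ z :=
    hχd.mono fun z h => h.const_smul (-Complex.I)
  have hξm : ∀ᶠ z in 𝓝 z₀, ξ z ∈ lieAlg G := hgc.mono fun z h => polarLog_mem hG h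
  have hχm : ∀ᶠ z in 𝓝 z₀, χ z ∈ complexLie hG := hξm.mono fun z h => mem_complexLie_of_I_smul hG h
  have hβm : ∀ᶠ z in 𝓝 z₀, β z ∈ complexLie hG := by
    filter_upwards [hax, hay] with z h1 h2
    exact Submodule.smul_mem _ _ (sub_mem (mem_complexLie_of_mem hG h1)
      (Submodule.smul_mem _ _ (mem_complexLie_of_mem hG h2)))
  have hdχm : ∀ᶠ z in 𝓝 z₀, dz χ z ∈ complexLie hG := by
    filter_upwards [hχd, hχm.eventually_nhds] with z h1 h2
    have h3 : ∀ v, fderiv ℝ χ z v ∈ (complexLie hG).restrictScalars ℝ :=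
      fderiv_mem_of_eventually_mem h1 h2
    exact Submodule.smul_mem _ _ (sub_mem (h3 1) (Submodule.smul_mem _ _ (h3 Complex.I)))
  have hθm : ∀ᶠ z in 𝓝 z₀, covDz ax ay χ z ∈ complexLie hG := by
    filter_upwards [hdχm, hβm, hχm] with z h1 h2 h3
    exact add_mem h1 (bracket_mem_complexLie hG h2 h3)
  refine ⟨hθm.self_of_nhds, ?_⟩
  have hcomm : ∀ z, Commute (χ z) (ξ z) := fun z => (Commute.refl _).smul_right _
  have e2 : ∀ z, (2 : ℝ) • dz χ z + (β z * (2 : ℝ) • χ z - (2 : ℝ) • χ z * β z)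
      = (2 : ℝ) • covDz ax ay χ z := fun z => by
    have k1 : β z * (2 : ℝ) • χ z = (2 : ℝ) • (β z * χ z) := mul_smul_comm _ _ _
    have k2 : (2 : ℝ) • χ z * β z = (2 : ℝ) • (χ z * β z) := smul_mul_assoc _ _ _
    rw [k1, k2, ← smul_sub, ← smul_add]
    rfl
  have hσm : ∀ᶠ z in 𝓝 z₀, σ z ∈ complexLie hG := by
    filter_upwards [hθm, hχm] with z h1 h2
    exact covLogDeriv_mem_complexLie hG (real_smul_mem_complexLie hG h2 2)
      (by rw [e2]; exact real_smul_mem_complexLie hG h1 2)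
  -- The pairing of `σ` with `ξ` is `i ∂_z f`.
  have hpair : ∀ᶠ z in 𝓝 z₀, B.complexForm (σ z) (ξ z)
      = (Complex.I / 2) * ((fderiv ℝ (fun w => B.form (ξ w) (ξ w)) z 1 : ℝ)
        - Complex.I * (fderiv ℝ (fun w => B.form (ξ w) (ξ w)) z Complex.I : ℝ)) := by
    filter_upwards [hθm, hχm, hβm, hχd, hξd, hξm.eventually_nhds] with z h1 h2 h3 h4 h5 h6
    have h7 := h6.self_of_nhds
    have hξz := mem_complexLie_of_mem hG h7
    have k1 := complexForm_covLogDeriv_of_commute hG B (χ := (2 : ℝ) • χ z)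
      (dχ := (2 : ℝ) • dz χ z) (β := β z) (ξ := ξ z) (real_smul_mem_complexLie hG h2 2)
      (by rw [e2]; exact real_smul_mem_complexLie hG h1 2) hξz ((hcomm z).smul_left _)
    have k2 := B.complexForm_bracket hG h2 h3 hξz
    rw [(hcomm z).eq, sub_self, map_zero, add_zero] at k2
    have k3 : χ z * β z - β z * χ z = -(β z * χ z - χ z * β z) := by abel
    rw [k3, map_neg, LinearMap.neg_apply, neg_eq_zero] at k2
    have k4 : ∀ v, fderiv ℝ χ z v = Complex.I • fderiv ℝ ξ z v := fun v => by
      rw [hξdef, fderiv_fun_const_smul h4, smul_apply, smul_smul]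
      simp
    change B.complexForm (covLogDeriv ((2 : ℝ) • χ z) ((2 : ℝ) • dz χ z) (β z)) (ξ z) = _
    have k5 : covDz ax ay χ z = (1 / 2 : ℂ) • (Complex.I • fderiv ℝ ξ z 1
        - Complex.I • Complex.I • fderiv ℝ ξ z Complex.I) + (β z * χ z - χ z * β z) := by
      rw [← k4, ← k4]; rfl
    rw [k1, e2, fderiv_form_self B hG h5 h6, fderiv_form_self B hG h5 h6, k5, ← Complex.coe_smul]
    generalize ξ z = ζ at k2 ⊢
    simp only [map_smul, map_sub, map_add, LinearMap.smul_apply, LinearMap.sub_apply,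
      LinearMap.add_apply, smul_eq_mul] at k2 ⊢
    push_cast
    linear_combination 2 * k2
  have hσd : DifferentiableAt ℝ σ z₀ :=
    differentiableAt_covLogDeriv (hχd.self_of_nhds.const_smul (2 : ℝ))
      ((differentiableAt_dz (hχs.of_le two_le_infty)).const_smul (2 : ℝ))
      ((dax.sub (day.const_smul Complex.I)).const_smul (1 / 2 : ℂ))
  -- The transformed connection has components `ax + σ`, `ay + i σ`.
  have hgauge : ∀ᶠ z in 𝓝 z₀,
      bx z = (g z : V →L[ℂ] V) * (ax z + σ z) * ((g z)⁻¹ : (V →L[ℂ] V)ˣ)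
        - fderiv ℝ (fun z => (g z : V →L[ℂ] V)) z 1 * ((g z)⁻¹ : (V →L[ℂ] V)ˣ) ∧
      b_y z = (g z : V →L[ℂ] V) * (ay z + Complex.I • σ z) * ((g z)⁻¹ : (V →L[ℂ] V)ˣ)
        - fderiv ℝ (fun z => (g z : V →L[ℂ] V)) z Complex.I * ((g z)⁻¹ : (V →L[ℂ] V)ˣ) := by
    filter_upwards [hax, hay, hbx, hby, h01, hgs] with z h1 h2 h3 h4 h5 h6
    refine gauge_real_of_gauge01 (Units.mul_inv _) (Units.inv_mul _)
      (star_eq_neg_of_mem_lieAlg hG h1) (star_eq_neg_of_mem_lieAlg hG h2)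
      (star_eq_neg_of_mem_lieAlg hG h3) (star_eq_neg_of_mem_lieAlg hG h4) h5 ?_
    have h7 := star_mul_self_mul_gaugeSigma (ax := ax) (ay := ay) h6
    rw [dz_star_mul_self (h6.differentiableAt (by simp))] at h7
    exact h7
  have hcurv := planeCurvature_gauge (hg.of_le two_le_infty) (dax.add hσd)
    (day.add (hσd.const_smul Complex.I)) (hgauge.mono fun z h => h.1)
    (hgauge.mono fun z h => h.2)
  -- The change of the curvature is `2 i (∂̄σ + [α, σ])`.
  set α : V →L[ℂ] V := (1 / 2 : ℂ) • (ax z₀ + Complex.I • ay z₀) with hαdef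
  set dσ : V →L[ℂ] V := (1 / 2 : ℂ) • (fderiv ℝ σ z₀ 1 + Complex.I • fderiv ℝ σ z₀ Complex.I)
    with hdσdef
  have hI : Complex.I * Complex.I = -1 := Complex.I_mul_I
  have hcurv2 : planeCurvature (ax + σ) (ay + Complex.I • σ) z₀ = planeCurvature ax ay z₀
      + (2 * Complex.I) • (dσ + (α * σ z₀ - σ z₀ * α)) := by
    have k1 : fderiv ℝ (ay + Complex.I • σ) z₀ 1
        = fderiv ℝ ay z₀ 1 + Complex.I • fderiv ℝ σ z₀ 1 := by
      rw [fderiv_add day (hσd.const_smul _), fderiv_const_smul hσd]; rfl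
    have k2 : fderiv ℝ (ax + σ) z₀ Complex.I
        = fderiv ℝ ax z₀ Complex.I + fderiv ℝ σ z₀ Complex.I := by
      rw [fderiv_add dax hσd]; rfl
    have k3 : (2 * Complex.I) • dσ = Complex.I • fderiv ℝ σ z₀ 1 - fderiv ℝ σ z₀ Complex.I := by
      rw [hdσdef, smul_smul, smul_add, smul_smul,
        show 2 * Complex.I * (1 / 2) * Complex.I = -1 by linear_combination hI,
        show 2 * Complex.I * (1 / 2 : ℂ) = Complex.I by ring]
      module
    have k4 : (2 * Complex.I) • α = Complex.I • ax z₀ - ay z₀ := by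
      rw [hαdef, smul_smul, smul_add, smul_smul,
        show 2 * Complex.I * (1 / 2) * Complex.I = -1 by linear_combination hI,
        show 2 * Complex.I * (1 / 2 : ℂ) = Complex.I by ring]
      module
    rw [smul_add, smul_sub, ← smul_mul_assoc, ← mul_smul_comm, k3, k4, planeCurvature,
      planeCurvature, k1, k2]
    simp only [Pi.add_apply, Pi.smul_apply, add_mul, mul_add, sub_mul, mul_sub, smul_mul_assoc,
      mul_smul_comm, smul_add]
    abel
  have hdiff : dσ + (α * σ z₀ - σ z₀ * α) = (Complex.I / 2 * lam) •
      ((((g z₀)⁻¹ : (V →L[ℂ] V)ˣ) : V →L[ℂ] V) * φ' * (g z₀ : V →L[ℂ] V) - φ) := by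
    have k1 : planeCurvature (ax + σ) (ay + Complex.I • σ) z₀
        = (((g z₀)⁻¹ : (V →L[ℂ] V)ˣ) : V →L[ℂ] V) * planeCurvature bx b_y z₀
          * (g z₀ : V →L[ℂ] V) := by
      rw [hcurv]
      simp only [mul_assoc, Units.inv_mul, mul_one, Units.inv_mul_cancel_left]
    rw [hcurv2, hF, hF'] at k1
    have k2 : (2 * Complex.I) • (dσ + (α * σ z₀ - σ z₀ * α)) = (-(lam : ℂ)) •
        ((((g z₀)⁻¹ : (V →L[ℂ] V)ˣ) : V →L[ℂ] V) * φ' * (g z₀ : V →L[ℂ] V) - φ) := by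
      rw [eq_sub_of_add_eq' k1, neg_smul, Complex.coe_smul, mul_neg, neg_mul, mul_smul_comm,
        smul_mul_assoc, smul_sub]
      abel
    have k3 := congrArg (fun T => (-(Complex.I / 2)) • T) k2
    simp only [smul_smul] at k3
    rw [show -(Complex.I / 2) * (2 * Complex.I) = 1 by linear_combination -hI, one_smul,
      show -(Complex.I / 2) * -(lam : ℂ) = Complex.I / 2 * lam by ring] at k3
    exact k3
  set dξ : V →L[ℂ] V := (1 / 2 : ℂ) • (fderiv ℝ ξ z₀ 1 + Complex.I • fderiv ℝ ξ z₀ Complex.I)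
    with hdξdef
  have hstar : dξ + (α * ξ z₀ - ξ z₀ * α) = Complex.I • (-star (covDz ax ay χ z₀)) := by
    have k4 : ∀ v, fderiv ℝ ξ z₀ v = (-Complex.I) • fderiv ℝ χ z₀ v := fun v => by
      rw [hξdef, fderiv_fun_const_smul hχd.self_of_nhds, smul_apply]
    have k5 : ∀ v, star (fderiv ℝ χ z₀ v) = fderiv ℝ χ z₀ v := fun v =>
      fderiv_mem_of_eventually_mem (W := selfAdjoint.submodule ℝ (V →L[ℂ] V))
        hχd.self_of_nhds (.of_forall fun z => polarLog_isSelfAdjoint _) v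
    have k6 : star (χ z₀) = χ z₀ := polarLog_isSelfAdjoint _
    have k7 : star (ax z₀) = -ax z₀ := star_eq_neg_of_mem_lieAlg hG hax.self_of_nhds
    have k8 : star (ay z₀) = -ay z₀ := star_eq_neg_of_mem_lieAlg hG hay.self_of_nhds
    have k9 : star (covDz ax ay χ z₀) = (1 / 2 : ℂ) • (fderiv ℝ χ z₀ 1
        + Complex.I • fderiv ℝ χ z₀ Complex.I) + (α * χ z₀ - χ z₀ * α) := by
      rw [covDz, dz]
      simp only [star_add, star_sub, star_mul, star_smul, k5, k6, k7, k8, Complex.star_def,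
        Complex.conj_I, map_div₀, map_one, map_ofNat, hαdef, mul_smul_comm, smul_mul_assoc,
        mul_add, add_mul, mul_sub, sub_mul, neg_smul, mul_neg, neg_mul]
      module
    rw [k9, hdξdef, k4, k4, hξdef]
    simp only [mul_smul_comm, smul_mul_assoc]
    module
  obtain ⟨s, hs⟩ := exists_re_complexForm_covLogDeriv hG B (polarLog_isSelfAdjoint (g z₀ : V →L[ℂ] V))
    hχm.self_of_nhds hθm.self_of_nhds
  refine ⟨s, ?_⟩
  have hαm : α ∈ complexLie hG := Submodule.smul_mem _ _
    (add_mem (mem_complexLie_of_mem hG hax.self_of_nhds)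
      (Submodule.smul_mem _ _ (mem_complexLie_of_mem hG hay.self_of_nhds)))
  have hξz := mem_complexLie_of_mem hG hξm.self_of_nhds
  -- The two expressions for the derivative `∂/∂z̄` of the pairing of `σ` with `ξ`.
  have hbr := B.complexForm_bracket hG hαm hσm.self_of_nhds hξz
  have hprod := fderiv_complexForm B hσd (hξd.self_of_nhds)
  have hFs : ContDiffAt ℝ 2 (fun w => B.form (ξ w) (ξ w)) z₀ := by
    have h2 : ContDiffAt ℝ 2 ξ z₀ := hξs.of_le two_le_infty
    exact ((LinearMap.toContinuousBilinearMap B.form).contDiff.contDiffAt.comp z₀ h2).clm_apply h2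
  have hFd : DifferentiableAt ℝ (fderiv ℝ (fun w => B.form (ξ w) (ξ w))) z₀ :=
    (hFs.fderiv_right (m := 1) (by norm_num)).differentiableAt one_ne_zero
  have hF1 := fun v : ℂ => hFd.clm_apply (differentiableAt_const v)
  have hpd : ∀ v, fderiv ℝ (fun w => B.complexForm (σ w) (ξ w)) z₀ v = (Complex.I / 2) *
      ((fderiv ℝ (fun z => fderiv ℝ (fun w => B.form (ξ w) (ξ w)) z 1) z₀ v : ℝ)
        - Complex.I *
          (fderiv ℝ (fun z => fderiv ℝ (fun w => B.form (ξ w) (ξ w)) z Complex.I) z₀ v : ℝ)) := by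
    intro v
    have k1 := (Complex.ofRealCLM.hasFDerivAt.comp z₀ (hF1 1).hasFDerivAt)
    have k2 := (Complex.ofRealCLM.hasFDerivAt.comp z₀ (hF1 Complex.I).hasFDerivAt)
    have k3 := (k1.sub (k2.const_mul Complex.I)).const_mul (Complex.I / 2)
    have k4 : (fun w => B.complexForm (σ w) (ξ w)) =ᶠ[𝓝 z₀] _ := hpair
    refine (congrArg (fun T : ℂ →L[ℝ] ℂ => T v) (k3.congr_of_eventuallyEq k4).fderiv).trans ?_
    rfl
  have hbar : B.complexForm (dσ + (α * σ z₀ - σ z₀ * α)) (ξ z₀)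
      + B.complexForm (σ z₀) (dξ + (α * ξ z₀ - ξ z₀ * α))
      = (1 / 2 : ℂ) * (fderiv ℝ (fun w => B.complexForm (σ w) (ξ w)) z₀ 1
        + Complex.I * fderiv ℝ (fun w => B.complexForm (σ w) (ξ w)) z₀ Complex.I) := by
    rw [hprod, hprod, map_add, LinearMap.add_apply, map_add (B.complexForm (σ z₀)), hdσdef, hdξdef]
    generalize ξ z₀ = ζ at hbr ⊢
    simp only [map_smul, map_add, LinearMap.smul_apply, LinearMap.add_apply, smul_eq_mul]
    linear_combination hbr
  rw [hstar, hdiff, hpd, hpd] at hbar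
  change (B.complexForm (σ z₀) (-star (covDz ax ay χ z₀))).re
    = 2 * B.normSq (NormedSpace.exp (-(s • χ z₀)) * covDz ax ay χ z₀
      * NormedSpace.exp (s • χ z₀)) at hs
  change planeLaplacian (fun z => B.form (ξ z) (ξ z)) z₀ / 4 = lam / 2 *
    ((B.complexForm _ (ξ z₀)).re - (B.complexForm φ (ξ z₀)).re)
      + 2 * B.normSq (NormedSpace.exp (-(s • χ z₀)) * covDz ax ay χ z₀
      * NormedSpace.exp (s • χ z₀))
  rw [planeLaplacian, ← hs]
  generalize ξ z₀ = ζ at hbar ⊢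
  rw [map_smul, map_smul, LinearMap.smul_apply, map_sub, LinearMap.sub_apply] at hbar
  generalize B.complexForm (σ z₀) (-star (covDz ax ay χ z₀)) = m at hbar ⊢
  have him := congrArg Complex.im hbar
  simp [Complex.add_im, Complex.mul_im, Complex.mul_re] at him
  linarith

end LocalIdentity

/-! ### The strong maximum principle in the plane -/

section MaximumPrinciple

open Metric

theorem hasDerivAt_comp_line {F : ℂ → ℝ} {p v : ℂ} {t : ℝ}
    (hF : DifferentiableAt ℝ F (p + t • v)) :
    HasDerivAt (fun t : ℝ => F (p + t • v)) (fderiv ℝ F (p + t • v) v) t := by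
  have h1 : HasDerivAt (fun t : ℝ => p + t • v) v t := by
    simpa using ((hasDerivAt_id t).smul_const v).const_add p
  exact hF.hasFDerivAt.comp_hasDerivAt t h1

theorem fderiv_fderiv_nonpos_of_isLocalMax {F : ℂ → ℝ} {p : ℂ} (v : ℂ)
    (hF : ContDiffAt ℝ 2 F p) (h : IsLocalMax F p) :
    fderiv ℝ (fun w => fderiv ℝ F w v) p v ≤ 0 := by
  by_contra! hpos
  set f : ℝ → ℝ := fun t => F (p + t • v) with hf
  have hc : Continuous fun t : ℝ => p + t • v := by fun_prop
  have hc0 : p + (0 : ℝ) • v = p := by simp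
  have hct : Filter.Tendsto (fun t : ℝ => p + t • v) (𝓝 0) (𝓝 p) := by
    have := hc.tendsto 0
    rwa [hc0] at this
  have hd : ∀ᶠ w in 𝓝 p, DifferentiableAt ℝ F w :=
    (hF.eventually (by simp)).mono fun w hw => hw.differentiableAt two_ne_zero
  have hd1 : deriv f =ᶠ[𝓝 0] fun t => fderiv ℝ F (p + t • v) v :=
    (hct.eventually hd).mono fun t ht => (hasDerivAt_comp_line ht).deriv
  have hD : DifferentiableAt ℝ (fderiv ℝ F) p :=
    (hF.fderiv_right (m := 1) (by norm_num)).differentiableAt one_ne_zero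
  have hDv : DifferentiableAt ℝ (fun w => fderiv ℝ F w v) p :=
    hD.clm_apply (differentiableAt_const v)
  have hd2 : deriv (deriv f) 0 = fderiv ℝ (fun w => fderiv ℝ F w v) p v := by
    rw [hd1.deriv_eq]
    have := (hasDerivAt_comp_line (F := fun w => fderiv ℝ F w v) (p := p) (v := v) (t := 0)
      (by rwa [hc0])).deriv
    rw [hc0] at this
    exact this
  have hmax : IsLocalMax f 0 := by
    have := hct.eventually h
    simpa [IsLocalMax, IsMaxFilter, hf] using this
  have hmin : IsLocalMin f 0 := isLocalMin_of_deriv_deriv_pos (by rw [hd2]; exact hpos)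
    hmax.deriv_eq_zero (by
      refine ContinuousAt.comp (f := fun t : ℝ => p + t • v) (g := F) ?_ hc.continuousAt
      rw [hc0]; exact hF.continuousAt)
  have hconst : f =ᶠ[𝓝 0] fun _ => f 0 := by
    filter_upwards [hmax, hmin] with t h1 h2
    exact le_antisymm h1 h2
  have h3 : deriv (deriv f) 0 = 0 := by
    rw [hconst.deriv.deriv_eq]
    simp
  rw [hd2] at h3
  exact hpos.ne' h3

theorem planeLaplacian_nonpos_of_isLocalMax {F : ℂ → ℝ} {p : ℂ}
    (hF : ContDiffAt ℝ 2 F p) (h : IsLocalMax F p) : planeLaplacian F p ≤ 0 :=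
  add_nonpos (fderiv_fderiv_nonpos_of_isLocalMax 1 hF h)
    (fderiv_fderiv_nonpos_of_isLocalMax Complex.I hF h)

theorem planeLaplacian_add_const_mul {F v : ℂ → ℝ} {p : ℂ} (ε : ℝ) (hF : ContDiffAt ℝ 2 F p)
    (hv : ContDiffAt ℝ 2 v p) :
    planeLaplacian (fun z => F z + ε * v z) p = planeLaplacian F p + ε * planeLaplacian v p := by
  have key : ∀ w : ℂ, fderiv ℝ (fun z => fderiv ℝ (fun z => F z + ε * v z) z w) p w
      = fderiv ℝ (fun z => fderiv ℝ F z w) p w + ε * fderiv ℝ (fun z => fderiv ℝ v z w) p w := by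
    intro w
    have hd : ∀ {F : ℂ → ℝ}, ContDiffAt ℝ 2 F p → ∀ᶠ z in 𝓝 p, DifferentiableAt ℝ F z :=
      fun hF => (hF.eventually (by simp)).mono fun w hw => hw.differentiableAt two_ne_zero
    have hD : ∀ {F : ℂ → ℝ}, ContDiffAt ℝ 2 F p →
        DifferentiableAt ℝ (fun z => fderiv ℝ F z w) p := fun hF =>
      ((hF.fderiv_right (m := 1) (by norm_num)).differentiableAt one_ne_zero).clm_apply
        (differentiableAt_const w)
    have e : (fun z => fderiv ℝ (fun z => F z + ε * v z) z w)
        =ᶠ[𝓝 p] fun z => fderiv ℝ F z w + ε * fderiv ℝ v z w := by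
      filter_upwards [hd hF, hd hv] with z h1 h2
      rw [fderiv_fun_add h1 (h2.const_mul ε), fderiv_const_mul h2]
      rfl
    rw [e.fderiv_eq, fderiv_fun_add (hD hF) ((hD hv).const_mul ε), fderiv_const_mul (hD hv)]
    rfl
  rw [planeLaplacian, key, key, planeLaplacian, planeLaplacian]
  ring

/-- The comparison function `|z - y|⁻²` is strictly subharmonic. -/
theorem planeLaplacian_inv_normSq {y p : ℂ} (h : p ≠ y) :
    ContDiffAt ℝ 2 (fun z => (Complex.normSq (z - y))⁻¹) p ∧
      0 < planeLaplacian (fun z => (Complex.normSq (z - y))⁻¹) p := by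
  have hq : ∀ z, HasFDerivAt (fun z => Complex.normSq (z - y))
      ((2 * (z - y).re) • Complex.reCLM + (2 * (z - y).im) • Complex.imCLM) z := fun z => by
    have h1 : HasFDerivAt (fun z : ℂ => (z - y).re) Complex.reCLM z :=
      Complex.reCLM.hasFDerivAt.comp z ((hasFDerivAt_id z).sub_const y)
    have h2 : HasFDerivAt (fun z : ℂ => (z - y).im) Complex.imCLM z :=
      Complex.imCLM.hasFDerivAt.comp z ((hasFDerivAt_id z).sub_const y)
    refine ((h1.mul h1).add (h2.mul h2)).congr_fderiv ?_
    ext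
    simp; ring
  have hne : ∀ᶠ z in 𝓝 p, z - y ≠ 0 := by
    filter_upwards [isOpen_ne.mem_nhds h] with z hz
    exact sub_ne_zero.2 hz
  have hinv : ∀ z, z - y ≠ 0 → HasFDerivAt (fun z => (Complex.normSq (z - y))⁻¹)
      ((-(Complex.normSq (z - y) ^ 2)⁻¹) • ((2 * (z - y).re) • Complex.reCLM
        + (2 * (z - y).im) • Complex.imCLM)) z := fun z hz =>
    (hasDerivAt_inv (mt Complex.normSq_eq_zero.1 hz)).comp_hasFDerivAt z (hq z)
  have hp : p - y ≠ 0 := sub_ne_zero.2 h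
  have hqp : Complex.normSq (p - y) ≠ 0 := mt Complex.normSq_eq_zero.1 hp
  refine ⟨?_, ?_⟩
  · refine ContDiffAt.inv ?_ hqp
    have : (fun z => Complex.normSq (z - y))
        = fun z => Complex.reCLM (z - y) * Complex.reCLM (z - y)
          + Complex.imCLM (z - y) * Complex.imCLM (z - y) := rfl
    rw [this]
    fun_prop
  · have e : ∀ w : ℂ, (fun z => fderiv ℝ (fun z => (Complex.normSq (z - y))⁻¹) z w) =ᶠ[𝓝 p]
        fun z => (-(Complex.normSq (z - y) ^ 2)⁻¹) * (2 * ((z - y).re * w.re + (z - y).im * w.im)) :=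
      fun w => by
        filter_upwards [hne] with z hz
        rw [(hinv z hz).fderiv]
        simp
        ring
    have e2 : ∀ w : ℂ, fderiv ℝ (fun z => fderiv ℝ (fun z => (Complex.normSq (z - y))⁻¹) z w) p w
        = 8 * (Complex.normSq (p - y) ^ 3)⁻¹ * ((p - y).re * w.re + (p - y).im * w.im) ^ 2
          - 2 * (Complex.normSq (p - y) ^ 2)⁻¹ * (w.re * w.re + w.im * w.im) := by
      intro w
      rw [(e w).fderiv_eq]
      have h1 : HasFDerivAt (fun z : ℂ => (z - y).re) Complex.reCLM p :=
        Complex.reCLM.hasFDerivAt.comp p ((hasFDerivAt_id p).sub_const y)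
      have h2 : HasFDerivAt (fun z : ℂ => (z - y).im) Complex.imCLM p :=
        Complex.imCLM.hasFDerivAt.comp p ((hasFDerivAt_id p).sub_const y)
      have h3 := ((h1.mul_const w.re).add (h2.mul_const w.im)).const_mul 2
      have h4 := (((hasDerivAt_inv (pow_ne_zero 2 hqp)).comp_hasFDerivAt p ((hq p).pow 2)).neg).mul h3
      refine (congrArg (fun T : ℂ →L[ℝ] ℝ => T w) h4.fderiv).trans ?_
      simp
      field_simp
      ring
    rw [planeLaplacian, e2, e2]
    have hpos : 0 < Complex.normSq (p - y) := Complex.normSq_pos.2 hp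
    have : Complex.normSq (p - y) = (p - y).re * (p - y).re + (p - y).im * (p - y).im :=
      Complex.normSq_apply _
    have e3 : 8 * (Complex.normSq (p - y) ^ 3)⁻¹
          * ((p - y).re * (1 : ℂ).re + (p - y).im * (1 : ℂ).im) ^ 2
        - 2 * (Complex.normSq (p - y) ^ 2)⁻¹ * ((1 : ℂ).re * (1 : ℂ).re + (1 : ℂ).im * (1 : ℂ).im)
        + (8 * (Complex.normSq (p - y) ^ 3)⁻¹
          * ((p - y).re * Complex.I.re + (p - y).im * Complex.I.im) ^ 2
        - 2 * (Complex.normSq (p - y) ^ 2)⁻¹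
          * (Complex.I.re * Complex.I.re + Complex.I.im * Complex.I.im))
        = 4 * (Complex.normSq (p - y) ^ 2)⁻¹ := by
      simp only [Complex.one_re, Complex.one_im, Complex.I_re, Complex.I_im]
      field_simp
      rw [this]
      ring
    rw [e3]
    positivity

/-- The strong maximum principle: a subharmonic function with an interior maximum is locally
constant there. -/
theorem eqOn_of_planeLaplacian_nonneg {F : ℂ → ℝ} {z₀ : ℂ} {R : ℝ}
    (hF : ∀ z ∈ ball z₀ R, ContDiffAt ℝ 2 F z) (hΔ : ∀ z ∈ ball z₀ R, 0 ≤ planeLaplacian F z)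
    (hM : ∀ z ∈ ball z₀ R, F z ≤ F z₀) : ∀ y ∈ ball z₀ (R / 2), F y = F z₀ := by
  intro y hy
  by_contra hne
  rw [mem_ball] at hy
  have hsub : closedBall y (dist y z₀) ⊆ ball z₀ R := fun z hz => by
    rw [mem_closedBall] at hz
    rw [mem_ball]
    linarith [dist_triangle z y z₀]
  have hcont : ContinuousOn F (ball z₀ R) := fun z hz => (hF z hz).continuousAt.continuousWithinAt
  -- `w` is a point of the maximum set nearest to `y`.
  obtain ⟨w, ⟨hw1, hw2⟩, hw3⟩ : ∃ w ∈ closedBall y (dist y z₀) ∩ F ⁻¹' {F z₀},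
      IsMinOn (fun z => dist z y) (closedBall y (dist y z₀) ∩ F ⁻¹' {F z₀}) w := by
    have hz₀ : z₀ ∈ closedBall y (dist y z₀) ∩ F ⁻¹' {F z₀} :=
      ⟨by rw [mem_closedBall, dist_comm], rfl⟩
    refine IsCompact.exists_isMinOn ?_ ⟨z₀, hz₀⟩ (by fun_prop)
    exact (isCompact_closedBall y _).of_isClosed_subset
      ((hcont.mono hsub).preimage_isClosed_of_isClosed isClosed_closedBall isClosed_singleton)
      inter_subset_left
  have hw4 : F w = F z₀ := hw2
  have hwy : w ≠ y := fun h => hne (h ▸ hw4)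
  have hwR : w ∈ ball z₀ R := hsub hw1
  set ρ := dist w y with hρ
  have hρ0 : 0 < ρ := dist_pos.2 hwy
  have hlt : ∀ z ∈ ball y ρ, F z < F z₀ := fun z hz => by
    have hz1 : z ∈ closedBall y (dist y z₀) := by
      rw [mem_closedBall] at hw1 ⊢
      exact ((mem_ball.1 hz).le).trans hw1
    refine lt_of_le_of_ne (hM z (hsub hz1)) fun h => ?_
    exact absurd (hw3 ⟨hz1, h⟩) (not_le.2 (mem_ball.1 hz))
  -- A smaller disc which touches the maximum set in `w` only.
  set c : ℂ := w + (1 / 2 : ℝ) • (y - w) with hc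
  have hcw : c - w = (1 / 2 : ℝ) • (y - w) := by rw [hc]; ring
  have hcy : c - y = (1 / 2 : ℝ) • (w - y) := by rw [hc]; module
  have hdcw : dist w c = ρ / 2 := by
    rw [dist_comm, dist_eq_norm, hcw, norm_smul, ← dist_eq_norm, dist_comm y w, ← hρ]
    norm_num; ring
  have hdcy : dist c y = ρ / 2 := by
    rw [dist_eq_norm, hcy, norm_smul, ← dist_eq_norm, ← hρ]
    norm_num; ring
  have htouch : ∀ z ∈ closedBall c (ρ / 2), z ≠ w → F z < F z₀ := by
    intro z hz hzw
    refine hlt z ?_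
    rw [mem_closedBall] at hz
    rw [mem_ball]
    refine lt_of_le_of_ne (by linarith [dist_triangle z c y]) fun h => hzw ?_
    have h1 : dist z y = dist z c + dist c y := by linarith [dist_triangle z c y]
    have h2 : dist z c = ρ / 2 := by linarith
    -- equality in the triangle inequality
    have h3 : SameRay ℝ (z - c) (c - y) := by
      rw [sameRay_iff_norm_add, sub_add_sub_cancel, ← dist_eq_norm, ← dist_eq_norm,
        ← dist_eq_norm, h1]
    have h4 := h3.norm_smul_eq
    rw [← dist_eq_norm, ← dist_eq_norm, h2, hdcy] at h4
    have h5 : c - y = z - c := smul_right_injective ℂ (r := ρ / 2) (by positivity) h4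
    have h6 : c - y = w - c := by rw [hcy, ← neg_sub c w, hcw]; module
    have : z - c = w - c := h5.symm.trans h6
    exact sub_left_injective this
  obtain ⟨δ, hδ0, hδ1, hδ2⟩ : ∃ δ > 0, δ < ρ / 2 ∧ closedBall w δ ⊆ ball z₀ R := by
    obtain ⟨ε, hε, hε'⟩ := nhds_basis_closedBall.mem_iff.1 (isOpen_ball.mem_nhds hwR)
    exact ⟨min ε (ρ / 4), by positivity, (min_le_right _ _).trans_lt (by linarith),
      (closedBall_subset_closedBall (min_le_left _ _)).trans hε'⟩
  have hcδ : ∀ z ∈ closedBall w δ, z ≠ c := by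
    rintro z hz rfl
    rw [mem_closedBall, dist_comm, hdcw] at hz
    linarith
  set v : ℂ → ℝ := fun z => (Complex.normSq (z - c))⁻¹ with hv
  have hvd : ∀ z, v z = (dist z c ^ 2)⁻¹ := fun z => by
    rw [hv, dist_eq_norm, Complex.sq_norm]
  -- The perturbation `ε (v - v w)` with `ε` small does not reach the maximum on the circle.
  obtain ⟨ε, hε0, hε⟩ : ∃ ε > 0, ∀ z ∈ sphere w δ, F z + ε * v z < F z₀ + ε * v w := by
    have hK : IsCompact (sphere w δ ∩ closedBall c (ρ / 2)) :=
      (isCompact_sphere w δ).inter_right isClosed_closedBall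
    have hvc : ContinuousOn v (sphere w δ) := fun z hz =>
      (planeLaplacian_inv_normSq (hcδ z (sphere_subset_closedBall hz))).1.continuousAt.continuousWithinAt
    have hcont' : ContinuousOn F (sphere w δ) := hcont.mono (sphere_subset_closedBall.trans hδ2)
    have hout : ∀ ε > 0, ∀ z ∈ sphere w δ, z ∉ closedBall c (ρ / 2) →
        F z + ε * v z < F z₀ + ε * v w := fun ε hε z hz hz' => by
      have h1 := hM z (hδ2 (sphere_subset_closedBall hz))
      have h2 : v z < v w := by
        rw [hvd, hvd, hdcw]
        rw [mem_closedBall, not_le] at hz'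
        have : 0 < ρ / 2 := by positivity
        gcongr
      nlinarith
    rcases (sphere w δ ∩ closedBall c (ρ / 2)).eq_empty_or_nonempty with he | hne
    · exact ⟨1, one_pos, fun z hz => hout 1 one_pos z hz fun h =>
        (he ▸ ⟨hz, h⟩ : z ∈ (∅ : Set ℂ))⟩
    · obtain ⟨p, hp, hpmax⟩ := hK.exists_isMaxOn hne (hcont'.mono inter_subset_left)
      obtain ⟨q, hq, hqmax⟩ := hK.exists_isMaxOn hne (hvc.mono inter_subset_left)
      have hpw : p ≠ w := by
        rintro rfl
        have := hp.1
        rw [mem_sphere, dist_self] at this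
        linarith
      have hη : 0 < F z₀ - F p := sub_pos.2 (htouch p hp.2 hpw)
      have hvq : 0 < v q + 1 := by
        have : 0 ≤ v q := by rw [hvd]; positivity
        linarith
      have hvw : 0 ≤ v w := by rw [hvd]; positivity
      refine ⟨(F z₀ - F p) / (v q + 1), by positivity, fun z hz => ?_⟩
      by_cases hz' : z ∈ closedBall c (ρ / 2)
      · have h1 : F z ≤ F p := hpmax ⟨hz, hz'⟩
        have h2 : v z ≤ v q := hqmax ⟨hz, hz'⟩
        have hε0 : 0 < (F z₀ - F p) / (v q + 1) := by positivity
        have h3 : (F z₀ - F p) / (v q + 1) * (v q + 1) = F z₀ - F p := by field_simp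
        nlinarith
      · exact hout _ (by positivity) z hz hz'
  have hGs : ∀ z ∈ closedBall w δ, ContDiffAt ℝ 2 (fun z => F z + ε * v z) z := fun z hz =>
    (hF z (hδ2 hz)).add (contDiffAt_const.mul (planeLaplacian_inv_normSq (hcδ z hz)).1)
  obtain ⟨p, hp, hpmax⟩ := (isCompact_closedBall w δ).exists_isMaxOn ⟨w, mem_closedBall_self hδ0.le⟩
    (fun z hz => (hGs z hz).continuousAt.continuousWithinAt)
  have hpi : p ∈ ball w δ := by
    rw [mem_ball]
    refine lt_of_le_of_ne hp fun h => ?_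
    have h1 := hε p h
    have h2 : F w + ε * v w ≤ F p + ε * v p := hpmax (mem_closedBall_self hδ0.le)
    rw [hw4] at h2
    linarith
  have hloc : IsLocalMax (fun z => F z + ε * v z) p :=
    hpmax.isLocalMax (Filter.mem_of_superset (isOpen_ball.mem_nhds hpi) ball_subset_closedBall)
  have h1 := planeLaplacian_nonpos_of_isLocalMax (hGs p hp) hloc
  obtain ⟨h2, h3⟩ := planeLaplacian_inv_normSq (hcδ p hp)
  rw [planeLaplacian_add_const_mul ε (hF p (hδ2 hp)) h2] at h1
  have h4 := hΔ p (hδ2 hp)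
  have h5 := mul_pos hε0 h3
  linarith

/-- The Laplacian transforms under a holomorphic change of coordinates by a positive factor. -/
theorem planeLaplacian_comp {F : ℂ → ℝ} {ψ : ℂ → ℂ} {z : ℂ} (hF : ContDiffAt ℝ 2 F (ψ z))
    (hψ : AnalyticAt ℂ ψ z) :
    planeLaplacian (fun w => F (ψ w)) z = Complex.normSq (deriv ψ z) * planeLaplacian F (ψ z) := by
  have hd : ∀ᶠ w in 𝓝 z, DifferentiableAt ℝ F (ψ w) :=
    hψ.continuousAt.eventually ((hF.eventually (by simp)).mono
      fun w hw => hw.differentiableAt two_ne_zero)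
  have hψd : ∀ᶠ w in 𝓝 z, HasFDerivAt ψ
      ((ContinuousLinearMap.toSpanSingleton ℂ (deriv ψ w)).restrictScalars ℝ) w :=
    hψ.eventually_analyticAt.mono fun w hw =>
      (hw.differentiableAt.hasDerivAt.hasFDerivAt).restrictScalars ℝ
  have hψ' : HasFDerivAt (deriv ψ)
      ((ContinuousLinearMap.toSpanSingleton ℂ (deriv (deriv ψ) z)).restrictScalars ℝ) z :=
    (hψ.deriv.differentiableAt.hasDerivAt.hasFDerivAt).restrictScalars ℝ
  have hD : HasFDerivAt (fderiv ℝ F) (fderiv ℝ (fderiv ℝ F) (ψ z)) (ψ z) :=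
    ((hF.fderiv_right (m := 1) (by norm_num)).differentiableAt one_ne_zero).hasFDerivAt
  have hDψ := HasFDerivAt.comp z hD hψd.self_of_nhds
  have e : ∀ v : ℂ, fderiv ℝ (fun w => fderiv ℝ (fun w => F (ψ w)) w v) z v
      = fderiv ℝ (fderiv ℝ F) (ψ z) (v * deriv ψ z) (v * deriv ψ z)
        + fderiv ℝ F (ψ z) (v * (v * deriv (deriv ψ) z)) := by
    intro v
    have e1 : (fun w => fderiv ℝ (fun w => F (ψ w)) w v)
        =ᶠ[𝓝 z] fun w => fderiv ℝ F (ψ w) (v * deriv ψ w) := by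
      filter_upwards [hd, hψd] with w h1 h2
      have h3 : fderiv ℝ (fun w => F (ψ w)) w = _ := (h1.hasFDerivAt.comp w h2).fderiv
      rw [h3]
      simp
    rw [e1.fderiv_eq]
    have h4 := hDψ.clm_apply (hψ'.const_mul v)
    refine (congrArg (fun T : ℂ →L[ℝ] ℝ => T v) h4.fderiv).trans ?_
    simp [add_comm]
  have e3 : ∀ v : ℂ, fderiv ℝ (fun w => fderiv ℝ F w v) (ψ z) v
      = fderiv ℝ (fderiv ℝ F) (ψ z) v v := fun v => by
    have h4 := hD.clm_apply (hasFDerivAt_const v (ψ z))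
    refine (congrArg (fun T : ℂ →L[ℝ] ℝ => T v) h4.fderiv).trans ?_
    simp
  have hsym : fderiv ℝ (fderiv ℝ F) (ψ z) Complex.I 1 = fderiv ℝ (fderiv ℝ F) (ψ z) 1 Complex.I :=
    (hF.isSymmSndFDerivAt (by simp)) Complex.I 1
  rw [planeLaplacian, planeLaplacian, e, e, e3, e3]
  set a := deriv ψ z
  set D := fderiv ℝ (fderiv ℝ F) (ψ z)
  have ha : a = a.re • (1 : ℂ) + a.im • Complex.I := by
    simp
  have hIa : Complex.I * a = (-a.im) • (1 : ℂ) + a.re • Complex.I := by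
    apply Complex.ext <;> simp
  have e4 : fderiv ℝ F (ψ z) (Complex.I * (Complex.I * deriv (deriv ψ) z))
      = -fderiv ℝ F (ψ z) (1 * (1 * deriv (deriv ψ) z)) := by
    rw [← mul_assoc, Complex.I_mul_I, ← map_neg]
    simp
  rw [e4, one_mul a, hIa]
  conv_lhs => rw [ha]
  simp only [map_add, map_smul, add_apply, smul_apply, smul_eq_mul, hsym, Complex.normSq_apply]
  simp
  ring

end MaximumPrinciple

/-! ### The moment map along the orbits of `exp (i 𝔤)` -/

section Manifolds

variable {E : Type*} [NormedAddCommGroup E] [NormedSpace ℂ E]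
  {X : Type*} [TopologicalSpace X] [ChartedSpace E X]

/-- The derivative of a map of complex manifolds, as a derivative of the underlying map of real
manifolds. -/
theorem hasMFDerivAt_restrictScalars {W : Type*} [NormedAddCommGroup W] [NormedSpace ℂ W]
    {f : W → X} {z : W} {f' : W →L[ℂ] E} (h : HasMFDerivAt 𝓘(ℂ, W) 𝓘(ℂ, E) f z f') :
    HasMFDerivAt 𝓘(ℝ, W) 𝓘(ℝ, E) f z (f'.restrictScalars ℝ : W →L[ℝ] E) := by
  refine ⟨h.1, ?_⟩
  have h2 : HasFDerivWithinAt (writtenInExtChartAt 𝓘(ℂ, W) 𝓘(ℂ, E) z f) f' (range 𝓘(ℂ, W))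
      (extChartAt 𝓘(ℂ, W) z z) := h.2
  have h3 := h2.restrictScalars ℝ
  exact h3

/-- A curve with vanishing velocity is constant. -/
theorem eq_of_hasMFDerivAt_zero [T2Space X] [IsManifold 𝓘(ℝ, E) 1 X] {γ : ℝ → X}
    (hγ : Continuous γ) (h : ∀ s ∈ Ioo (0 : ℝ) 1,
      HasMFDerivAt 𝓘(ℝ, ℝ) 𝓘(ℝ, E) γ s (0 : ℝ →L[ℝ] E)) : γ 0 = γ 1 := by
  have hloc : ∀ s ∈ Ioo (0 : ℝ) 1, ∀ᶠ t in 𝓝 s, γ t = γ s := by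
    intro s hs
    have hsrc : ∀ᶠ t in 𝓝 s, t ∈ Ioo (0 : ℝ) 1 ∧ γ t ∈ (chartAt E (γ s)).source :=
      Filter.Eventually.and (isOpen_Ioo.mem_nhds hs) (hγ.continuousAt.eventually
        ((chartAt E (γ s)).open_source.mem_nhds (mem_chart_source E (γ s))))
    obtain ⟨ε, hε, hball⟩ := Metric.eventually_nhds_iff_ball.1 hsrc
    have hd : ∀ t ∈ Metric.ball s ε,
        HasFDerivAt (fun t => extChartAt 𝓘(ℝ, E) (γ s) (γ t)) (0 : ℝ →L[ℝ] E) t := fun t ht => by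
      have h1 : MDifferentiableAt 𝓘(ℝ, E) 𝓘(ℝ, E) (extChartAt 𝓘(ℝ, E) (γ s)) (γ t) :=
        mdifferentiableAt_extChartAt (hball t ht).2
      have h2 := h1.hasMFDerivAt.comp t (h t (hball t ht).1)
      rw [hasMFDerivAt_iff_hasFDerivAt] at h2
      refine h2.congr_fderiv ?_
      exact ContinuousLinearMap.comp_zero _
    filter_upwards [Metric.ball_mem_nhds s hε] with t ht
    have h3 := (convex_ball s ε).is_const_of_fderivWithin_eq_zero (𝕜 := ℝ)
      (f := fun t => extChartAt 𝓘(ℝ, E) (γ s) (γ t))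
      (fun t ht => (hd t ht).differentiableAt.differentiableWithinAt)
      (fun t ht => ((hd t ht).hasFDerivWithinAt).fderivWithin
        (Metric.isOpen_ball.uniqueDiffWithinAt ht)) ht (Metric.mem_ball_self hε)
    refine (extChartAt 𝓘(ℝ, E) (γ s)).injOn ?_ ?_ h3
    · rw [extChartAt_source]; exact (hball t ht).2
    · exact mem_extChartAt_source _
  have hc : IsLocallyConstant fun s : Ioo (0 : ℝ) 1 => γ s := by
    rw [IsLocallyConstant.iff_eventually_eq]
    intro s
    exact continuous_subtype_val.continuousAt.eventually (hloc s s.2)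
  have : PreconnectedSpace (Ioo (0 : ℝ) 1) :=
    isPreconnected_iff_preconnectedSpace.1 isPreconnected_Ioo
  have hhalf : (1 / 2 : ℝ) ∈ Ioo (0 : ℝ) 1 := by norm_num
  have heq : EqOn γ (fun _ => γ (1 / 2)) (Ioo (0 : ℝ) 1) := fun s hs =>
    hc.apply_eq_of_preconnectedSpace ⟨s, hs⟩ ⟨1 / 2, hhalf⟩
  have h2 := heq.closure hγ continuous_const
  rw [closure_Ioo zero_ne_one] at h2
  exact (h2 (left_mem_Icc.2 zero_le_one)).trans (h2 (right_mem_Icc.2 zero_le_one)).symm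

end Manifolds

section Moment

variable {V : Type*} [NormedAddCommGroup V] [InnerProductSpace ℂ V] [FiniteDimensional ℂ V]
  [CompleteSpace V] {G : Subgroup (V →L[ℂ] V)ˣ}
  {E : Type*} [NormedAddCommGroup E] [NormedSpace ℂ E]
  {X : Type*} [TopologicalSpace X] [ChartedSpace E X]

theorem expGL_complex_smul_mem {ξ : V →L[ℂ] V} (hξ : ξ ∈ lieAlg G) (z : ℂ) :
    expGL (z • ξ) ∈ complexification G := by
  have h : z • ξ = z.re • ξ + (z.im * Complex.I : ℂ) • ξ := by
    conv_lhs => rw [← Complex.re_add_im z]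
    rw [add_smul, Complex.coe_smul]
  have hc : Commute (z.re • ξ) ((z.im * Complex.I : ℂ) • ξ) :=
    ((Commute.refl ξ).smul_left _).smul_right _
  rw [h, expGL_add_of_comm hc]
  refine mul_mem (le_complexification (hξ _)) (expGL_mem_complexification ?_)
  rw [smul_smul, show -Complex.I * (z.im * Complex.I) = z.im by
    linear_combination (-z.im : ℂ) * Complex.I_mul_I, Complex.coe_smul]
  intro t
  rw [smul_smul]
  exact hξ _

variable (ρ : HolomorphicAction E X (complexification G))

/-- The orbit map `z ↦ exp (z ξ) x` is holomorphic. -/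
theorem contMDiff_orbit {ξ : V →L[ℂ] V} (hξ : ξ ∈ lieAlg G) (x : X) :
    ContMDiff 𝓘(ℂ, ℂ) 𝓘(ℂ, E) ∞ fun z : ℂ => ρ.act (expGL (z • ξ)) x := by
  have h1 : ContMDiff 𝓘(ℂ, ℂ) 𝓘(ℂ, V →L[ℂ] V) ∞ fun z : ℂ => expGL (z • ξ) := by
    refine ContMDiff.of_comp_isOpenEmbedding Units.isOpenEmbedding_val ?_
    rw [contMDiff_iff_contDiff]
    have : ContDiff ℂ ∞ (NormedSpace.exp : (V →L[ℂ] V) → (V →L[ℂ] V)) := contDiff_exp_complex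
    exact this.comp (contDiff_id.smul contDiff_const)
  exact ρ.holomorphic.comp_contMDiff (h1.prodMk contMDiff_const)
    fun z => ⟨expGL_complex_smul_mem hξ z, mem_univ _⟩

/-- The velocity of the orbit map at `z` is the infinitesimal action at `exp (z ξ) x`. -/
theorem hasMFDerivAt_orbit {ξ : V →L[ℂ] V} (hξ : ξ ∈ lieAlg G) (x : X) (z : ℂ) :
    ∃ T : ℂ →L[ℂ] E, T 1 = infinitesimalAction ρ ξ (ρ.act (expGL (z • ξ)) x) ∧
      HasMFDerivAt 𝓘(ℝ, ℂ) 𝓘(ℝ, E) (fun z : ℂ => ρ.act (expGL (z • ξ)) x) z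
        (T.restrictScalars ℝ : ℂ →L[ℝ] E) := by
  have h0 := ((contMDiff_orbit ρ hξ x).mdifferentiable (by simp) z).hasMFDerivAt
  set T : ℂ →L[ℂ] E := mfderiv 𝓘(ℂ, ℂ) 𝓘(ℂ, E) (fun z : ℂ => ρ.act (expGL (z • ξ)) x) z with hT
  have h1 : HasMFDerivAt 𝓘(ℝ, ℂ) 𝓘(ℝ, E) (fun z : ℂ => ρ.act (expGL (z • ξ)) x) z
      (T.restrictScalars ℝ : ℂ →L[ℝ] E) := hasMFDerivAt_restrictScalars h0
  have h2 : HasMFDerivAt 𝓘(ℝ, ℝ) 𝓘(ℝ, ℂ) (fun t : ℝ => (t : ℂ) + z) 0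
      (Complex.ofRealCLM : ℝ →L[ℝ] ℂ) :=
    hasMFDerivAt_iff_hasFDerivAt.2 (Complex.ofRealCLM.hasFDerivAt.add_const z)
  have hz : ((0 : ℝ) : ℂ) + z = z := by simp
  have h3 := HasMFDerivAt.comp (g := fun z : ℂ => ρ.act (expGL (z • ξ)) x) (0 : ℝ)
    (by rw [hz]; exact h1) h2
  have h4 : ((fun z : ℂ => ρ.act (expGL (z • ξ)) x) ∘ fun t : ℝ => (t : ℂ) + z)
      = fun t : ℝ => ρ.act (expGL (t • ξ)) (ρ.act (expGL (z • ξ)) x) := by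
    funext t
    have hc : Commute ((t : ℂ) • ξ) (z • ξ) := ((Commute.refl ξ).smul_left _).smul_right _
    rw [comp_apply, add_smul, expGL_add_of_comm hc, ρ.mul_act _ (expGL_complex_smul_mem hξ _) _
      (expGL_complex_smul_mem hξ _), Complex.coe_smul]
  rw [h4] at h3
  refine ⟨T, ?_, h1⟩
  have h5 : infinitesimalAction ρ ξ (ρ.act (expGL (z • ξ)) x) = T ((1 : ℝ) : ℂ) :=
    congrArg (fun L : ℝ →L[ℝ] E => L 1) h3.mfderiv
  rw [h5, Complex.ofReal_one]

variable {B : InvariantInnerProduct G} {Ω : KahlerForm E X} {ρ}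

/-- Along the orbit `s ↦ exp (i s ξ) x` the function `⟨Φ, ξ⟩` grows with speed
`ω(ξ_X, J ξ_X) = |ξ_X|²`. -/
theorem MomentMap.hasDerivAt_orbit (Φ : MomentMap B Ω ρ) {ξ : V →L[ℂ] V} (hξ : ξ ∈ lieAlg G)
    (x : X) (s : ℝ) :
    HasDerivAt (fun s : ℝ => B.form (Φ.map (ρ.act (expGL ((s * Complex.I : ℂ) • ξ)) x)) ξ)
      (Ω.form _ ![infinitesimalAction ρ ξ (ρ.act (expGL ((s * Complex.I : ℂ) • ξ)) x),
        tangentJ 𝓘(ℝ, E) _ (infinitesimalAction ρ ξ (ρ.act (expGL ((s * Complex.I : ℂ) • ξ)) x))])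
      s := by
  obtain ⟨T, hT1, hT⟩ := hasMFDerivAt_orbit ρ hξ x (s * Complex.I)
  have h1 : HasMFDerivAt 𝓘(ℝ, ℝ) 𝓘(ℝ, ℂ) (fun s : ℝ => (s * Complex.I : ℂ)) s
      (Complex.ofRealCLM.smulRight Complex.I : ℝ →L[ℝ] ℂ) :=
    hasMFDerivAt_iff_hasFDerivAt.2
      ((Complex.ofRealCLM.smulRight Complex.I : ℝ →L[ℝ] ℂ).hasFDerivAt)
  have h2 : MDifferentiableAt 𝓘(ℝ, E) 𝓘(ℝ, ℝ) (fun y => B.form (Φ.map y) ξ)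
      (ρ.act (expGL ((s * Complex.I : ℂ) • ξ)) x) := by
    have h3 : ContMDiff 𝓘(ℝ, V →L[ℂ] V) 𝓘(ℝ, ℝ) ∞ fun η : V →L[ℂ] V => B.form η ξ :=
      ((B.form.flip ξ).toContinuousLinearMap.contDiff).contMDiff
    exact (h3.comp Φ.smooth).mdifferentiable (by simp) _
  have h4 := (h2.hasMFDerivAt.comp (s * Complex.I) hT).comp s h1
  set D : E →L[ℝ] ℝ := mfderiv 𝓘(ℝ, E) 𝓘(ℝ, ℝ) (fun y => B.form (Φ.map y) ξ)
      (ρ.act (expGL ((s * Complex.I : ℂ) • ξ)) x) with hD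
  have h5 : HasFDerivAt
      (fun s : ℝ => B.form (Φ.map (ρ.act (expGL ((s * Complex.I : ℂ) • ξ)) x)) ξ)
      (D ∘L (T.restrictScalars ℝ) ∘L (Complex.ofRealCLM.smulRight Complex.I)) s :=
    hasMFDerivAt_iff_hasFDerivAt.1 h4
  have h6 := h5.hasDerivAt
  refine h6.congr_deriv ?_
  rw [← Φ.hamiltonian ξ hξ]
  have h7 : tangentJ 𝓘(ℝ, E) _ (infinitesimalAction ρ ξ (ρ.act (expGL ((s * Complex.I : ℂ) • ξ)) x))
      = T Complex.I := by
    have : T Complex.I = Complex.I • T 1 := by rw [← map_smul]; simp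
    rw [this, hT1]
    rfl
  rw [h7]
  change D (T (((1 : ℝ) : ℂ) • Complex.I)) = D (T Complex.I)
  rw [Complex.ofReal_one, one_smul]

theorem KahlerForm.form_self_nonneg (Ω : KahlerForm E X) (x : X) (v : TangentSpace 𝓘(ℝ, E) x) :
    0 ≤ Ω.form x ![v, tangentJ 𝓘(ℝ, E) x v] := by
  rcases eq_or_ne v 0 with rfl | h
  · exact ((Ω.form x).map_coord_zero (0 : Fin 2) rfl).ge
  · exact (Ω.pos x v h).le

/-- `⟨Φ, ξ⟩` does not decrease under `exp (i ξ)`, and it increases unless `exp (i ξ)` fixes the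
point. -/
theorem MomentMap.form_le_form_exp [T2Space X] [IsManifold 𝓘(ℝ, E) 1 X] (Φ : MomentMap B Ω ρ)
    {ξ : V →L[ℂ] V} (hξ : ξ ∈ lieAlg G) (x : X) :
    B.form (Φ.map x) ξ ≤ B.form (Φ.map (ρ.act (expGL (Complex.I • ξ)) x)) ξ ∧
      (B.form (Φ.map (ρ.act (expGL (Complex.I • ξ)) x)) ξ = B.form (Φ.map x) ξ →
        ρ.act (expGL (Complex.I • ξ)) x = x) := by
  set γ : ℝ → X := fun s => ρ.act (expGL ((s * Complex.I : ℂ) • ξ)) x with hγ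
  have h0 : γ 0 = x := by simp [hγ, expGL_zero, ρ.one_act]
  have h1 : γ 1 = ρ.act (expGL (Complex.I • ξ)) x := by simp [hγ]
  have hd : ∀ s, HasDerivAt (fun s => B.form (Φ.map (γ s)) ξ) _ s := Φ.hasDerivAt_orbit hξ x
  have hmono : Monotone fun s => B.form (Φ.map (γ s)) ξ :=
    monotone_of_deriv_nonneg (fun s => (hd s).differentiableAt) fun s => by
      rw [(hd s).deriv]; exact Ω.form_self_nonneg _ _
  rw [← h1, ← h0]
  refine ⟨hmono zero_le_one, fun he => (eq_of_hasMFDerivAt_zero (E := E) (γ := γ) ?_ fun s hs => ?_).symm⟩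
  · exact (contMDiff_orbit ρ hξ x).continuous.comp (by fun_prop)
  · have hc : (fun s => B.form (Φ.map (γ s)) ξ) =ᶠ[𝓝 s] fun _ => B.form (Φ.map (γ 0)) ξ := by
      filter_upwards [isOpen_Ioo.mem_nhds hs] with t ht
      exact le_antisymm ((hmono ht.2.le).trans he.le) (hmono ht.1.le)
    have hz : Ω.form (γ s) ![infinitesimalAction ρ ξ (γ s),
        tangentJ 𝓘(ℝ, E) _ (infinitesimalAction ρ ξ (γ s))] = 0 :=
      ((hd s).congr_of_eventuallyEq hc.symm).unique (hasDerivAt_const _ _)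
    have hv : infinitesimalAction ρ ξ (γ s) = 0 := by
      by_contra hne
      exact (Ω.pos _ _ hne).ne' hz
    obtain ⟨T, hT1, hT⟩ := hasMFDerivAt_orbit ρ hξ x (s * Complex.I)
    have h3 : HasMFDerivAt 𝓘(ℝ, ℝ) 𝓘(ℝ, ℂ) (fun s : ℝ => (s * Complex.I : ℂ)) s
        (Complex.ofRealCLM.smulRight Complex.I : ℝ →L[ℝ] ℂ) :=
      hasMFDerivAt_iff_hasFDerivAt.2
        ((Complex.ofRealCLM.smulRight Complex.I : ℝ →L[ℝ] ℂ).hasFDerivAt)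
    have hT0 : T = 0 := by
      ext
      exact hT1.trans hv
    rw [hT0] at hT
    exact hT.comp s h3

/-- The curvature term in the Bochner identity: it is nonnegative, and it vanishes only where the
positive part of `g` acts trivially. -/
theorem MomentMap.complexForm_le [T2Space X] [IsManifold 𝓘(ℝ, E) 1 X]
    (hG : IsCompactConnectedUnitary G) (Φ : MomentMap B Ω ρ) {g : (V →L[ℂ] V)ˣ}
    (hg : g ∈ complexification G) (x : X) :
    (B.complexForm (Φ.map x) ((-Complex.I) • polarLog (g : V →L[ℂ] V))).re
      ≤ (B.complexForm (((g⁻¹ : (V →L[ℂ] V)ˣ) : V →L[ℂ] V) * Φ.map (ρ.act g x) * (g : V →L[ℂ] V))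
          ((-Complex.I) • polarLog (g : V →L[ℂ] V))).re ∧
    ((B.complexForm (((g⁻¹ : (V →L[ℂ] V)ˣ) : V →L[ℂ] V) * Φ.map (ρ.act g x) * (g : V →L[ℂ] V))
          ((-Complex.I) • polarLog (g : V →L[ℂ] V))).re
        = (B.complexForm (Φ.map x) ((-Complex.I) • polarLog (g : V →L[ℂ] V))).re →
      ρ.act (expGL (polarLog (g : V →L[ℂ] V))) x = x) := by
  set χ := polarLog (g : V →L[ℂ] V) with hχ
  set ξ := (-Complex.I) • χ with hξ
  have hξm : ξ ∈ lieAlg G := polarLog_mem hG hg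
  have hIξ : Complex.I • ξ = χ := by rw [hξ, smul_smul]; simp
  have hχm : expGL χ ∈ complexification G := expGL_mem_complexification hξm
  obtain ⟨k, hk, hgk⟩ : ∃ k ∈ G, g = k * expGL χ := by
    refine ⟨_, mul_expGL_neg_polarLog_mem hG hg, ?_⟩
    rw [mul_assoc, ← expGL_add_of_comm (Commute.refl χ).neg_left, neg_add_cancel,
      expGL_zero, mul_one]
  set Φ' := Φ.map (ρ.act (expGL χ) x)
  have h1 : ((g⁻¹ : (V →L[ℂ] V)ˣ) : V →L[ℂ] V) * Φ.map (ρ.act g x) * (g : V →L[ℂ] V)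
      = NormedSpace.exp (-χ) * Φ' * NormedSpace.exp χ := by
    rw [hgk, ρ.mul_act _ (le_complexification hk) _ hχm, Φ.equivariant k hk, mul_inv_rev,
      Units.val_mul, Units.val_mul, expGL_inv_coe, expGL_coe]
    simp only [mul_assoc, Units.inv_mul_cancel_left]
    rfl
  have h2 : B.complexForm (NormedSpace.exp (-χ) * Φ' * NormedSpace.exp χ) ξ
      = B.complexForm Φ' ξ := by
    have h3 := B.complexForm_exp_conj hG (neg_mem (mem_complexLie_of_I_smul hG hξm))
      (mem_complexLie_of_mem hG (Φ.mem (ρ.act (expGL χ) x))) (mem_complexLie_of_mem hG hξm)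
    rw [exp_conj_eq_of_commute ((Commute.refl χ).smul_right _).neg_left, neg_neg] at h3
    exact h3
  rw [h1, h2, B.complexForm_of_mem hG (Φ.mem _) hξm, B.complexForm_of_mem hG (Φ.mem _) hξm,
    Complex.ofReal_re, Complex.ofReal_re]
  have h4 := Φ.form_le_form_exp hξm x
  rwa [hIξ] at h4

end Moment

/-! ### Holomorphic coordinates on the Riemann surface -/

section RestrictScalars

/-- A complex manifold (with boundary) is a real manifold. -/
theorem isManifold_restrictScalars {E H M : Type*} [NormedAddCommGroup E] [NormedSpace ℂ E]
    [TopologicalSpace H] [TopologicalSpace M] [ChartedSpace H M] (Iℂ : ModelWithCorners ℂ E H)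
    (Iℝ : ModelWithCorners ℝ E H) (h : ⇑Iℝ = ⇑Iℂ) (hs : ⇑Iℝ.symm = ⇑Iℂ.symm)
    [IsManifold Iℂ ∞ M] : IsManifold Iℝ ∞ M := by
  refine isManifold_of_contDiffOn _ _ _ fun e e' he he' => ?_
  have h1 := (mem_groupoid_of_pregroupoid.1
    ((contDiffGroupoid ∞ Iℂ).compatible he he')).1
  have h2 : ContDiffOn ℂ ∞ (Iℂ ∘ (e.symm.trans e') ∘ Iℂ.symm)
    (Iℂ.symm ⁻¹' (e.symm.trans e').source ∩ range Iℂ) := h1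
  rw [h, hs]
  exact h2.restrict_scalars ℝ

theorem isManifold_real_of_complex (E X : Type*) [NormedAddCommGroup E] [NormedSpace ℂ E]
    [TopologicalSpace X] [ChartedSpace E X] [IsManifold 𝓘(ℂ, E) ∞ X] :
    IsManifold 𝓘(ℝ, E) ∞ X :=
  isManifold_restrictScalars 𝓘(ℂ, E) 𝓘(ℝ, E) rfl rfl

theorem isManifold_halfPlane (S : Type*) [TopologicalSpace S] [ChartedSpace HalfPlane S]
    [IsManifold halfPlaneℂ ∞ S] : IsManifold halfPlaneℝ ∞ S :=
  isManifold_restrictScalars halfPlaneℂ halfPlaneℝ rfl rfl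

end RestrictScalars

section Coordinates

variable {S : Type*} [TopologicalSpace S] [ChartedSpace HalfPlane S]
  {F : Type*} [NormedAddCommGroup F] [NormedSpace ℝ F]

theorem range_halfPlane_mem_nhds {x₀ : S} {z : ℂ}
    (hz : (extChartAt halfPlaneℝ x₀).target ∈ 𝓝 z) : range halfPlaneℝ ∈ 𝓝 z :=
  Filter.mem_of_superset hz (extChartAt_target_subset_range x₀)

theorem contDiffAt_comp_extChartAt_symm [IsManifold halfPlaneℝ ∞ S] {f : S → F} {U : Set S}
    (hU : IsOpen U)
    (hf : ContMDiffOn halfPlaneℝ 𝓘(ℝ, F) ∞ f U) {x₀ : S} {z : ℂ}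
    (hz : (extChartAt halfPlaneℝ x₀).target ∈ 𝓝 z) (hzU : (extChartAt halfPlaneℝ x₀).symm z ∈ U) :
    ContDiffAt ℝ ∞ (fun w => f ((extChartAt halfPlaneℝ x₀).symm w)) z := by
  rw [← contMDiffAt_iff_contDiffAt]
  exact (hf.contMDiffAt (hU.mem_nhds hzU)).comp z
    ((contMDiffOn_extChartAt_symm (I := halfPlaneℝ) x₀).contMDiffAt hz)

/-- The derivative of the inverse of the chart at `x₀`, as a map from the plane to a tangent
space. -/
def chartFrame (x₀ : S) (z : ℂ) :
    ℂ →L[ℝ] TangentSpace halfPlaneℝ ((extChartAt halfPlaneℝ x₀).symm z) :=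
  mfderivWithin 𝓘(ℝ, ℂ) halfPlaneℝ (extChartAt halfPlaneℝ x₀).symm (range halfPlaneℝ) z

theorem chartForm_apply_one (η : ∀ x : S, TangentSpace halfPlaneℝ x [⋀^Fin 1]→L[ℝ] F) (x₀ : S)
    (z v : ℂ) : chartForm halfPlaneℝ η x₀ z ![v]
      = η ((extChartAt halfPlaneℝ x₀).symm z) ![chartFrame x₀ z v] := by
  refine congrArg (η ((extChartAt halfPlaneℝ x₀).symm z)) ?_
  ext i
  fin_cases i
  rfl

theorem hasMFDerivAt_chartFrame [IsManifold halfPlaneℝ ∞ S] {x₀ : S} {z : ℂ}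
    (hz : (extChartAt halfPlaneℝ x₀).target ∈ 𝓝 z) :
    HasMFDerivAt 𝓘(ℝ, ℂ) halfPlaneℝ (extChartAt halfPlaneℝ x₀).symm z (chartFrame x₀ z) := by
  have h1 : MDifferentiableAt 𝓘(ℝ, ℂ) halfPlaneℝ (extChartAt halfPlaneℝ x₀).symm z :=
    ((contMDiffOn_extChartAt_symm (I := halfPlaneℝ) (n := ∞) x₀).contMDiffAt hz).mdifferentiableAt
      (by simp)
  exact (h1.mdifferentiableWithinAt.hasMFDerivWithinAt).hasMFDerivAt (range_halfPlane_mem_nhds hz)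

/-- Charts are holomorphic. -/
theorem chartFrame_I_mul [IsManifold halfPlaneℝ ∞ S] [IsManifold halfPlaneℂ ∞ S] {x₀ : S} {z : ℂ}
    (hz : (extChartAt halfPlaneℝ x₀).target ∈ 𝓝 z) (v : ℂ) :
    chartFrame x₀ z (Complex.I * v) = tangentJ halfPlaneℝ _ (chartFrame x₀ z v) := by
  have h1 : MDifferentiableAt 𝓘(ℂ, ℂ) halfPlaneℂ (extChartAt halfPlaneℂ x₀).symm z :=
    ((contMDiffOn_extChartAt_symm (I := halfPlaneℂ) (n := ∞) x₀).contMDiffAt hz).mdifferentiableAt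
      (by simp)
  obtain ⟨T, hT⟩ : ∃ T : ℂ →L[ℂ] ℂ, HasMFDerivAt 𝓘(ℂ, ℂ) halfPlaneℂ
      (extChartAt halfPlaneℂ x₀).symm z T := ⟨_, h1.hasMFDerivAt⟩
  have h2 : HasFDerivWithinAt (writtenInExtChartAt 𝓘(ℂ, ℂ) halfPlaneℂ z
      (extChartAt halfPlaneℂ x₀).symm) T (range 𝓘(ℂ, ℂ)) (extChartAt 𝓘(ℂ, ℂ) z z) := hT.2
  have h3 : HasMFDerivAt 𝓘(ℝ, ℂ) halfPlaneℝ (extChartAt halfPlaneℝ x₀).symm z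
      (T.restrictScalars ℝ : ℂ →L[ℝ] ℂ) := ⟨hT.1, h2.restrictScalars ℝ⟩
  have h4 : chartFrame x₀ z = (T.restrictScalars ℝ : ℂ →L[ℝ] ℂ) :=
    hasMFDerivAt_unique (hasMFDerivAt_chartFrame hz) h3
  have h5 : ∀ v, chartFrame x₀ z v = T v := fun v =>
    congrArg (fun L : ℂ →L[ℝ] ℂ => L v) h4
  rw [h5, h5]
  change T (Complex.I • v) = Complex.I • T v
  rw [map_smul]

/-- At the centre of the chart the tangent space is the model space. -/
theorem chartFrame_self [IsManifold halfPlaneℝ ∞ S] {x₀ : S}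
    (hz : (extChartAt halfPlaneℝ x₀).target ∈ 𝓝 (extChartAt halfPlaneℝ x₀ x₀)) (v : ℂ) :
    chartFrame x₀ (extChartAt halfPlaneℝ x₀ x₀) v = v := by
  have h1 : HasMFDerivAt 𝓘(ℝ, ℂ) halfPlaneℝ (extChartAt halfPlaneℝ x₀).symm
      (extChartAt halfPlaneℝ x₀ x₀) (ContinuousLinearMap.id ℝ ℂ : ℂ →L[ℝ] ℂ) := by
    refine ⟨(hasMFDerivAt_chartFrame hz).1, ?_⟩
    have h2 : HasFDerivAt (fun w : ℂ => w) (ContinuousLinearMap.id ℝ ℂ)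
      (extChartAt halfPlaneℝ x₀ x₀) := hasFDerivAt_id _
    have h3 : writtenInExtChartAt 𝓘(ℝ, ℂ) halfPlaneℝ (extChartAt halfPlaneℝ x₀ x₀)
        (extChartAt halfPlaneℝ x₀).symm =ᶠ[𝓝 (extChartAt halfPlaneℝ x₀ x₀)] fun w : ℂ => w := by
      filter_upwards [hz] with w hw
      rw [writtenInExtChartAt, extChartAt_to_inv]
      exact (extChartAt halfPlaneℝ x₀).right_inv hw
    exact (h2.congr_of_eventuallyEq h3).hasFDerivWithinAt
  have h4 := hasMFDerivAt_unique (hasMFDerivAt_chartFrame hz) h1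
  exact congrArg (fun L : ℂ →L[ℝ] ℂ => L v) h4

/-- The chain rule for the derivative in a coordinate. -/
theorem fderiv_comp_extChartAt_symm [IsManifold halfPlaneℝ ∞ S] {f : S → F} {x₀ : S} {z : ℂ}
    (hz : (extChartAt halfPlaneℝ x₀).target ∈ 𝓝 z)
    (hf : MDifferentiableAt halfPlaneℝ 𝓘(ℝ, F) f ((extChartAt halfPlaneℝ x₀).symm z)) (v : ℂ) :
    fderiv ℝ (fun w => f ((extChartAt halfPlaneℝ x₀).symm w)) z v
      = mfderiv halfPlaneℝ 𝓘(ℝ, F) f ((extChartAt halfPlaneℝ x₀).symm z) (chartFrame x₀ z v) := by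
  have h := hf.hasMFDerivAt.comp z (hasMFDerivAt_chartFrame hz)
  let D : ℂ →L[ℝ] F := mfderiv halfPlaneℝ 𝓘(ℝ, F) f ((extChartAt halfPlaneℝ x₀).symm z)
  let T : ℂ →L[ℝ] ℂ := chartFrame x₀ z
  have h1 : HasFDerivAt (fun w => f ((extChartAt halfPlaneℝ x₀).symm w)) (D ∘L T) z :=
    hasMFDerivAt_iff_hasFDerivAt.1 h
  have h2 := h1.fderiv
  exact congrArg (fun L : ℂ →L[ℝ] F => L v) h2

/-- The exterior derivative of a `1`-form in a coordinate. -/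
theorem formDeriv_apply {η : ∀ x : S, TangentSpace halfPlaneℝ x [⋀^Fin 1]→L[ℝ] F} {x₀ : S}
    (hz : (extChartAt halfPlaneℝ x₀).target ∈ 𝓝 (extChartAt halfPlaneℝ x₀ x₀))
    (h : DifferentiableAt ℝ (chartForm halfPlaneℝ η x₀) (extChartAt halfPlaneℝ x₀ x₀)) (v w : ℂ) :
    formDeriv halfPlaneℝ η x₀ ![v, w]
      = fderiv ℝ (fun z => chartForm halfPlaneℝ η x₀ z ![w]) (extChartAt halfPlaneℝ x₀ x₀) v
        - fderiv ℝ (fun z => chartForm halfPlaneℝ η x₀ z ![v]) (extChartAt halfPlaneℝ x₀ x₀) w := by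
  have hr := range_halfPlane_mem_nhds hz
  have h1 : extDerivWithin (chartForm halfPlaneℝ η x₀) (range halfPlaneℝ)
      (extChartAt halfPlaneℝ x₀ x₀) = extDeriv (chartForm halfPlaneℝ η x₀)
      (extChartAt halfPlaneℝ x₀ x₀) := by
    rw [extDerivWithin, extDeriv, fderivWithin_of_mem_nhds hr]
  have h2 := extDeriv_apply h ![v, w]
  rw [← h1] at h2
  refine Eq.trans h2 ?_
  rw [Fin.sum_univ_two]
  have e0 : (0 : Fin 2).removeNth ![v, w] = ![w] := by
    ext i; fin_cases i; rfl
  have e1 : (1 : Fin 2).removeNth ![v, w] = ![v] := by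
    ext i; fin_cases i; rfl
  rw [e0, e1]
  simp [sub_eq_add_neg]

end Coordinates

/-! ### The Bochner inequality on the Riemann surface -/

section Bochner

variable {V : Type*} [NormedAddCommGroup V] [InnerProductSpace ℂ V] [FiniteDimensional ℂ V]
  [CompleteSpace V] {G : Subgroup (V →L[ℂ] V)ˣ}
  {S : Type*} [TopologicalSpace S] [ChartedSpace HalfPlane S] {ι : Type*}
  {P : PrincipalBundle G S ι}

/-- The squared length of `ξ`, where `g = k e^{iξ}` is the polar decomposition, in the local
trivialisation `α`. -/
def PrincipalBundle.ComplexGauge.polarSq (g : P.ComplexGauge) (B : InvariantInnerProduct G) (α : ι)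
    (x : S) : ℝ :=
  B.form ((-Complex.I) • polarLog (g.map α x : V →L[ℂ] V))
    ((-Complex.I) • polarLog (g.map α x : V →L[ℂ] V))

theorem PrincipalBundle.ComplexGauge.polarLog_compat (hG : IsCompactConnectedUnitary G)
    (g : P.ComplexGauge) {α β : ι} {x : S} (hx : x ∈ P.U α ∩ P.U β) :
    polarLog (g.map α x : V →L[ℂ] V) = (P.trans α β x : V →L[ℂ] V)
      * polarLog (g.map β x : V →L[ℂ] V) * ((P.trans α β x)⁻¹ : (V →L[ℂ] V)ˣ) := by
  rw [g.compat α β x hx]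
  exact polarLog_conj hG (P.mem α β x hx) (g.map β x)

theorem PrincipalBundle.ComplexGauge.polarSq_eq (hG : IsCompactConnectedUnitary G)
    (B : InvariantInnerProduct G) (g : P.ComplexGauge) {α β : ι} {x : S}
    (hx : x ∈ P.U α ∩ P.U β) : g.polarSq B α x = g.polarSq B β x := by
  have h := polarLog_mem hG (g.mem β x hx.2)
  rw [polarSq, g.polarLog_compat hG hx, ← smul_mul_assoc, ← mul_smul_comm]
  exact B.invariant _ (P.mem α β x hx) _ h _ h

theorem PrincipalBundle.ComplexGauge.polarSq_nonneg (hG : IsCompactConnectedUnitary G)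
    (B : InvariantInnerProduct G) (g : P.ComplexGauge) {α : ι} {x : S}
    (hx : x ∈ P.U α) : 0 ≤ g.polarSq B α x := by
  rcases eq_or_ne ((-Complex.I) • polarLog (g.map α x : V →L[ℂ] V)) 0 with h | h
  · rw [polarSq, h]; simp
  · exact (B.pos _ (polarLog_mem hG (g.mem α x hx)) h).le

theorem PrincipalBundle.ComplexGauge.polarLog_eq_zero_of_polarSq (hG : IsCompactConnectedUnitary G)
    (B : InvariantInnerProduct G) (g : P.ComplexGauge) {α : ι} {x : S}
    (hx : x ∈ P.U α) (h0 : g.polarSq B α x = 0) : polarLog (g.map α x : V →L[ℂ] V) = 0 := by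
  by_contra hne
  have h1 : (-Complex.I) • polarLog (g.map α x : V →L[ℂ] V) ≠ 0 :=
    smul_ne_zero (by simp) hne
  exact (B.pos _ (polarLog_mem hG (g.mem α x hx)) h1).ne' h0

variable {E : Type*} [NormedAddCommGroup E] [NormedSpace ℂ E]
  {X : Type*} [TopologicalSpace X] [ChartedSpace E X] [T2Space X] [IsManifold 𝓘(ℝ, E) 1 X]
  [IsManifold halfPlaneℂ ∞ S] [IsManifold halfPlaneℝ ∞ S]
  {B : InvariantInnerProduct G} {Ω : KahlerForm E X} {ρ : HolomorphicAction E X (complexification G)}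
  {Φ : MomentMap B Ω ρ} {dvol : AreaForm S} {A A' : P.Connection} {u u' : P.AssocSection ρ}
  {g : P.ComplexGauge}

theorem eventually_chart {x₀ : S} {U : Set S} (hU : IsOpen U) (hx : x₀ ∈ U)
    (hz : (extChartAt halfPlaneℝ x₀).target ∈ 𝓝 (extChartAt halfPlaneℝ x₀ x₀)) :
    ∀ᶠ z in 𝓝 (extChartAt halfPlaneℝ x₀ x₀), (extChartAt halfPlaneℝ x₀).target ∈ 𝓝 z ∧
      (extChartAt halfPlaneℝ x₀).symm z ∈ U := by
  refine (eventually_mem_nhds_iff.2 hz).and ?_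
  have hc := (hasMFDerivAt_chartFrame hz).continuousAt
  refine hc.eventually (hU.mem_nhds ?_)
  rwa [extChartAt_to_inv]

theorem differentiableAt_chartForm (A : P.Connection) {α : ι} {x₀ : S} (hx : x₀ ∈ P.U α)
    (hz : (extChartAt halfPlaneℝ x₀).target ∈ 𝓝 (extChartAt halfPlaneℝ x₀ x₀)) :
    DifferentiableAt ℝ (chartForm halfPlaneℝ (A.form α) x₀) (extChartAt halfPlaneℝ x₀ x₀) :=
  ((A.smooth α x₀ hx).contDiffAt (range_halfPlane_mem_nhds hz)).differentiableAt (by simp)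

theorem chartForm_self (A : P.Connection) {α : ι} {x₀ : S}
    (hz : (extChartAt halfPlaneℝ x₀).target ∈ 𝓝 (extChartAt halfPlaneℝ x₀ x₀)) (v : ℂ) :
    chartForm halfPlaneℝ (A.form α) x₀ (extChartAt halfPlaneℝ x₀ x₀) ![v]
      = A.form α x₀ ![v] := by
  rw [chartForm_apply_one, chartFrame_self hz, extChartAt_to_inv]

/-- The curvature of a connection in the chart, at the centre of the chart. -/
theorem planeCurvature_chartForm (A : P.Connection) {α : ι} {x₀ : S} (hx : x₀ ∈ P.U α)
    (hz : (extChartAt halfPlaneℝ x₀).target ∈ 𝓝 (extChartAt halfPlaneℝ x₀ x₀)) :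
    planeCurvature (fun z => chartForm halfPlaneℝ (A.form α) x₀ z ![(1 : ℂ)])
      (fun z => chartForm halfPlaneℝ (A.form α) x₀ z ![Complex.I]) (extChartAt halfPlaneℝ x₀ x₀)
      = A.curvature α x₀ (1 : ℂ) Complex.I := by
  rw [planeCurvature, chartForm_self A hz, chartForm_self A hz,
    ← formDeriv_apply hz (differentiableAt_chartForm A hx hz) 1 Complex.I]
  rfl

/-- At an interior point of the surface, `|ξ|²` has nonnegative Laplacian, and if the Laplacian
vanishes there, so does the `(1,0)`-part of the covariant derivative of `χ = iξ`, and `e^χ` fixes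
`u`. -/
theorem bochner_interior (hG : IsCompactConnectedUnitary G)
    (hAu : IsVortex Φ dvol A u) (hAu' : IsVortex Φ dvol A' u') (hg : g.Maps A u A' u')
    {α : ι} {x₀ : S} (hx : x₀ ∈ P.U α)
    (hz : (extChartAt halfPlaneℝ x₀).target ∈ 𝓝 (extChartAt halfPlaneℝ x₀ x₀)) :
    0 ≤ planeLaplacian (fun z => g.polarSq B α ((extChartAt halfPlaneℝ x₀).symm z))
        (extChartAt halfPlaneℝ x₀ x₀) ∧
    (planeLaplacian (fun z => g.polarSq B α ((extChartAt halfPlaneℝ x₀).symm z))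
        (extChartAt halfPlaneℝ x₀ x₀) = 0 →
      covDz (fun z => chartForm halfPlaneℝ (A.form α) x₀ z ![(1 : ℂ)])
        (fun z => chartForm halfPlaneℝ (A.form α) x₀ z ![Complex.I])
        (fun z => polarLog (g.map α ((extChartAt halfPlaneℝ x₀).symm z) : V →L[ℂ] V))
        (extChartAt halfPlaneℝ x₀ x₀) = 0 ∧
      ρ.act (expGL (polarLog (g.map α x₀ : V →L[ℂ] V))) (u.map α x₀) = u.map α x₀) := by
  set z₀ := extChartAt halfPlaneℝ x₀ x₀ with hz₀
  set ψ := (extChartAt halfPlaneℝ x₀).symm with hψ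
  have hψ0 : ψ z₀ = x₀ := extChartAt_to_inv x₀
  have hnear := eventually_chart (P.isOpen α) hx hz
  have hmem : ∀ (A : P.Connection) (v : ℂ), ∀ᶠ z in 𝓝 z₀,
      chartForm halfPlaneℝ (A.form α) x₀ z ![v] ∈ lieAlg G := fun A v => by
    filter_upwards [hnear] with z h
    rw [chartForm_apply_one]
    exact A.mem α _ h.2 _
  have hd : ∀ (A : P.Connection) (v : ℂ),
      DifferentiableAt ℝ (fun z => chartForm halfPlaneℝ (A.form α) x₀ z ![v]) z₀ := fun A v =>
    ((ContinuousAlternatingMap.apply ℝ ℂ (V →L[ℂ] V) ![v]).differentiableAt).comp z₀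
      (differentiableAt_chartForm A hx hz)
  set lam : ℝ := dvol.form x₀ ![(1 : ℂ), Complex.I] with hlam
  have hlam0 : 0 < lam := by
    have := dvol.pos x₀ (1 : ℂ) (one_ne_zero (α := ℂ))
    have e : tangentJ halfPlaneℝ x₀ (1 : ℂ) = Complex.I := mul_one Complex.I
    rwa [e] at this
  have hcurv : ∀ (A : P.Connection) (u : P.AssocSection ρ), IsVortex Φ dvol A u →
      planeCurvature (fun z => chartForm halfPlaneℝ (A.form α) x₀ z ![(1 : ℂ)])
        (fun z => chartForm halfPlaneℝ (A.form α) x₀ z ![Complex.I]) z₀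
        = -(lam • Φ.map (u.map α x₀)) := fun A u h => by
    rw [planeCurvature_chartForm A hx hz]
    exact eq_neg_of_add_eq_zero_left (h.curvature_eq α x₀ hx _ _)
  obtain ⟨h1, s, h2⟩ := planeLaplacian_normSq_polarLog B hG
    (ax := fun z => chartForm halfPlaneℝ (A.form α) x₀ z ![(1 : ℂ)])
    (ay := fun z => chartForm halfPlaneℝ (A.form α) x₀ z ![Complex.I])
    (bx := fun z => chartForm halfPlaneℝ (A'.form α) x₀ z ![(1 : ℂ)])
    (b_y := fun z => chartForm halfPlaneℝ (A'.form α) x₀ z ![Complex.I])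
    (g := fun z => g.map α (ψ z)) (z₀ := z₀) (lam := lam) (φ := Φ.map (u.map α x₀))
    (φ' := Φ.map (u'.map α x₀))
    (hnear.mono fun z h => contDiffAt_comp_extChartAt_symm (P.isOpen α) (g.smooth α) h.1 h.2)
    (hnear.mono fun z h => g.mem α _ h.2) (hmem A _) (hmem A _) (hmem A' _) (hmem A' _)
    (hd A _) (hd A _) (by
      filter_upwards [hnear] with z h
      have k1 := (hg α (ψ z) h.2).2 (chartFrame x₀ z 1)
      have k2 : ∀ v, fderiv ℝ (fun z => (g.map α (ψ z) : V →L[ℂ] V)) z v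
          = dEnd (g.map α) (ψ z) (chartFrame x₀ z v) := fun v =>
        fderiv_comp_extChartAt_symm (f := fun x => (g.map α x : V →L[ℂ] V)) h.1
          (((g.smooth α).contMDiffAt ((P.isOpen α).mem_nhds h.2)).mdifferentiableAt (by simp)) v
      have k3 := chartFrame_I_mul h.1 1
      rw [mul_one] at k3
      rw [k2, k2, chartForm_apply_one, chartForm_apply_one, chartForm_apply_one,
        chartForm_apply_one, k3]
      exact k1)
    (hcurv A u hAu) (hcurv A' u' hAu')
  have h3 : ρ.act (g.map α x₀) (u.map α x₀) = u'.map α x₀ := ((hg α x₀ hx).1).symm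
  obtain ⟨h4, h5⟩ := Φ.complexForm_le hG (g.mem α x₀ hx) (u.map α x₀)
  have hχm : ∀ s : ℝ, s • polarLog (g.map α x₀ : V →L[ℂ] V) ∈ complexLie hG := fun s =>
    real_smul_mem_complexLie hG (mem_complexLie_of_I_smul hG (polarLog_mem hG (g.mem α x₀ hx))) s
  have h6 := B.normSq_nonneg hG (exp_neg_conj_mem_complexLie hG (hχm s) h1)
  rw [h3] at h4 h5
  simp only [hψ0] at h2
  change planeLaplacian (fun z => g.polarSq B α (ψ z)) z₀ / 4 = _ at h2
  refine ⟨by nlinarith, fun h0 => ?_⟩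
  rw [h0] at h2
  have h7 := mul_nonneg hlam0.le (sub_nonneg.2 h4)
  refine ⟨?_, h5 ?_⟩
  · have h8 := B.eq_zero_of_normSq_eq_zero hG (exp_neg_conj_mem_complexLie hG (hχm s) h1)
      (by linarith)
    have h9 := congrArg (fun T => NormedSpace.exp (s • polarLog (g.map α x₀ : V →L[ℂ] V)) * T
      * NormedSpace.exp (-(s • polarLog (g.map α x₀ : V →L[ℂ] V)))) h8
    simp only [mul_zero, zero_mul, mul_assoc, exp_mul_exp_neg, mul_one] at h9
    rwa [← mul_assoc, exp_mul_exp_neg, one_mul] at h9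
  · have h8 : lam * _ = 0 := le_antisymm (by linarith) h7
    have h9 := (mul_eq_zero.1 h8).resolve_left hlam0.ne'
    linarith

end Bochner

/-! ### The unitary part of a complex gauge transformation -/

section UnitaryPart

variable {V : Type*} [NormedAddCommGroup V] [InnerProductSpace ℂ V] [FiniteDimensional ℂ V]
  [CompleteSpace V] {G : Subgroup (V →L[ℂ] V)ˣ}
  {S : Type*} [TopologicalSpace S] [ChartedSpace HalfPlane S] {ι : Type*}
  {P : PrincipalBundle G S ι}

theorem polarLog_eq_zero_of_mem (hG : IsCompactConnectedUnitary G) {g : (V →L[ℂ] V)ˣ}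
    (hg : g ∈ G) : polarLog (g : V →L[ℂ] V) = 0 := by
  refine eq_polarLog (IsSelfAdjoint.zero _) ?_
  rw [smul_zero, NormedSpace.exp_zero, star_mul_self_of_mem hG hg]

theorem mem_of_polarLog_eq_zero (hG : IsCompactConnectedUnitary G) {g : (V →L[ℂ] V)ˣ}
    (hg : g ∈ complexification G) (h : polarLog (g : V →L[ℂ] V) = 0) : g ∈ G := by
  have := mul_expGL_neg_polarLog_mem hG hg
  rwa [h, neg_zero, expGL_zero, mul_one] at this

theorem PrincipalBundle.ComplexGauge.contMDiffAt_polarLog (g : P.ComplexGauge) {α : ι} {x : S}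
    (hx : x ∈ P.U α) : ContMDiffAt halfPlaneℝ 𝓘(ℝ, V →L[ℂ] V) ∞
      (fun y => polarLog (g.map α y : V →L[ℂ] V)) x := by
  have hg := (g.smooth α).contMDiffAt ((P.isOpen α).mem_nhds hx)
  obtain ⟨l, hl, hl'⟩ := exists_contDiffAt_polarLog (g.map α x)
  refine (ContMDiffAt.comp (g := l) x hl.contMDiffAt hg).congr_of_eventuallyEq ?_
  filter_upwards [hg.continuousAt.eventually hl'] with y hy
  exact hy _ rfl

theorem PrincipalBundle.ComplexGauge.continuousAt_polarSq (g : P.ComplexGauge)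
    (B : InvariantInnerProduct G) {α : ι} {x : S} (hx : x ∈ P.U α) :
    ContinuousAt (g.polarSq B α) x := by
  have h1 : ContinuousAt (fun y => (-Complex.I) • polarLog (g.map α y : V →L[ℂ] V)) x :=
    (continuous_const_smul (-Complex.I)).continuousAt.comp (g.contMDiffAt_polarLog hx).continuousAt
  exact ((LinearMap.toContinuousBilinearMap B.form).continuous.continuousAt.comp h1).clm_apply h1

/-- The unitary part `k` of a complex gauge transformation `g = k e^χ`. -/
def PrincipalBundle.ComplexGauge.unitaryPart (hG : IsCompactConnectedUnitary G)
    (g : P.ComplexGauge) : P.ComplexGauge where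
  map α x := g.map α x * expGL (-polarLog (g.map α x : V →L[ℂ] V))
  mem α x hx := le_complexification (mul_expGL_neg_polarLog_mem hG (g.mem α x hx))
  smooth α x hx := by
    have hg := (g.smooth α).contMDiffAt ((P.isOpen α).mem_nhds hx)
    have hl := g.contMDiffAt_polarLog hx
    have hm : ContDiff ℝ ∞ fun p : (V →L[ℂ] V) × (V →L[ℂ] V) => p.1 * NormedSpace.exp (-p.2) :=
      contDiff_fst.mul (contDiff_exp_real.comp contDiff_snd.neg)
    exact ((hm.contMDiff.contMDiffAt).comp x (hg.prodMk_space hl)).contMDiffWithinAt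
  compat α β x hx := by
    rw [g.polarLog_compat hG hx, ← neg_mul, ← mul_neg, expGL_conj, g.compat α β x hx]
    simp only [mul_assoc, inv_mul_cancel_left]

theorem PrincipalBundle.ComplexGauge.unitaryPart_isUnitaryOn (hG : IsCompactConnectedUnitary G)
    (g : P.ComplexGauge) (s : Set S) : (g.unitaryPart hG).IsUnitaryOn s :=
  fun α x hx => mul_expGL_neg_polarLog_mem hG (g.mem α x hx.1)

theorem gaugeForm_half (f : S → (V →L[ℂ] V)ˣ) (x : S) (a b p q : V →L[ℂ] V) :
    gaugeForm f x ((1 / 2 : ℂ) • (a + Complex.I • b)) ((1 / 2 : ℂ) • (p + Complex.I • q))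
      = (1 / 2 : ℂ) • (gaugeForm f x a p + Complex.I • gaugeForm f x b q) := by
  simp only [gaugeForm, mul_smul_comm, smul_mul_assoc, mul_add, add_mul, smul_sub, smul_add]
  abel

/-- The form `(dk) k⁻¹` is skew-adjoint for a unitary gauge transformation `k`. -/
theorem star_dEnd_mul_inv (hG : IsCompactConnectedUnitary G) {k : P.ComplexGauge}
    (hk : k.IsUnitaryOn univ) {α : ι} {x : S} (hx : x ∈ P.U α) (v : TangentSpace halfPlaneℝ x) :
    star (dEnd (k.map α) x v * (((k.map α x)⁻¹ : (V →L[ℂ] V)ˣ) : V →L[ℂ] V))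
      = -(dEnd (k.map α) x v * (((k.map α x)⁻¹ : (V →L[ℂ] V)ˣ) : V →L[ℂ] V)) := by
  have h1 : MDifferentiableAt halfPlaneℝ 𝓘(ℝ, V →L[ℂ] V)
      (fun y => (k.map α y : V →L[ℂ] V)) x :=
    ((k.smooth α).contMDiffAt ((P.isOpen α).mem_nhds hx)).mdifferentiableAt (by simp)
  let D : ℂ →L[ℝ] (V →L[ℂ] V) :=
    mfderiv halfPlaneℝ 𝓘(ℝ, V →L[ℂ] V) (fun y => (k.map α y : V →L[ℂ] V)) x
  set ψ := (extChartAt halfPlaneℝ x).symm with hψ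
  set z₀ := extChartAt halfPlaneℝ x x with hz₀
  have hψ0 : ψ z₀ = x := extChartAt_to_inv x
  let c : ℂ → V →L[ℂ] V := fun z => (k.map α (ψ z) : V →L[ℂ] V)
  have h2 : HasFDerivWithinAt c D (range halfPlaneℝ) z₀ := h1.hasMFDerivAt.2
  have h3 : HasFDerivWithinAt (fun z => star (c z)) _ (range halfPlaneℝ) z₀ :=
    ((starL' ℝ : (V →L[ℂ] V) ≃L[ℝ] (V →L[ℂ] V)).hasFDerivAt).comp_hasFDerivWithinAt z₀ h2
  have h4 := h3.mul' h2
  have h5 : ∀ᶠ z in 𝓝 z₀, star (c z) * c z = 1 := by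
    have hc : ContinuousAt ψ z₀ := continuousAt_extChartAt_symm x
    have hU : P.U α ∈ 𝓝 (ψ z₀) := by rw [hψ0]; exact (P.isOpen α).mem_nhds hx
    filter_upwards [hc.eventually hU] with z hz
    exact star_mul_self_of_mem hG (hk α _ ⟨hz, mem_univ _⟩)
  have h6 : HasFDerivWithinAt (fun z => star (c z) * c z) (0 : ℂ →L[ℝ] (V →L[ℂ] V))
      (range halfPlaneℝ) z₀ :=
    ((hasFDerivAt_const (1 : V →L[ℂ] V) z₀).congr_of_eventuallyEq h5).hasFDerivWithinAt
  have hu : UniqueDiffWithinAt ℝ (range halfPlaneℝ) z₀ :=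
    halfPlaneℝ.uniqueDiffOn _ (extChartAt_target_subset_range x (mem_extChartAt_target x))
  have h7 : star (c z₀) * D v + star (D v) * c z₀ = 0 := by
    exact congrArg (fun L : ℂ →L[ℝ] (V →L[ℂ] V) => L v) (hu.eq h4 h6)
  have hcx : c z₀ = k.map α x := by simp only [c, hψ0]
  have hkG := hk α x ⟨hx, mem_univ x⟩
  rw [hcx, star_eq_inv_of_mem hG hkG] at h7
  have h8 := star_eq_inv_of_mem hG (G.inv_mem hkG)
  rw [inv_inv] at h8
  rw [star_mul, h8]
  change (k.map α x : V →L[ℂ] V) * star (D v) = -(D v * _)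
  have h9 := congrArg (fun T => (k.map α x : V →L[ℂ] V) * T
    * (((k.map α x)⁻¹ : (V →L[ℂ] V)ˣ) : V →L[ℂ] V)) h7
  simp only [mul_add, add_mul, mul_zero, zero_mul, mul_assoc, Units.mul_inv_cancel_left,
    Units.mul_inv, mul_one] at h9
  exact eq_neg_of_add_eq_zero_right h9

/-- A unitary gauge transformation relating the `(0,1)`-parts of two connections relates the
connections. -/
theorem eq_gaugeForm_of_form01 (hG : IsCompactConnectedUnitary G) {k : P.ComplexGauge}
    (hk : k.IsUnitaryOn univ) {A A' : P.Connection} {α : ι} {x : S} (hx : x ∈ P.U α)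
    (h : ∀ v : TangentSpace halfPlaneℝ x,
      A'.form01 α x v = gaugeForm (k.map α) x (A.form01 α x v) (dbarEnd (k.map α) x v))
    (v : TangentSpace halfPlaneℝ x) :
    A'.form α x ![v] = gaugeForm (k.map α) x (A.form α x ![v]) (dEnd (k.map α) x v) := by
  have hkG := hk α x ⟨hx, mem_univ x⟩
  have h1 := star_eq_inv_of_mem hG hkG
  have h2 := star_eq_inv_of_mem hG (G.inv_mem hkG)
  rw [inv_inv] at h2
  have hC : ∀ v : TangentSpace halfPlaneℝ x,
      star (gaugeForm (k.map α) x (A.form α x ![v]) (dEnd (k.map α) x v))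
        = -gaugeForm (k.map α) x (A.form α x ![v]) (dEnd (k.map α) x v) := fun v => by
    rw [gaugeForm, star_sub, star_dEnd_mul_inv hG hk hx, star_mul, star_mul, h1, h2,
      star_eq_neg_of_mem_lieAlg hG (A.mem α x hx v)]
    noncomm_ring
  have hA := star_eq_neg_of_mem_lieAlg hG (A'.mem α x hx v)
  have hA2 := star_eq_neg_of_mem_lieAlg hG (A'.mem α x hx (tangentJ halfPlaneℝ x v))
  have h3 := h v
  rw [PrincipalBundle.Connection.form01, PrincipalBundle.Connection.form01, dbarEnd,
    gaugeForm_half] at h3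
  have h4 := smul_right_injective (V →L[ℂ] V) (one_div_ne_zero (two_ne_zero (α := ℂ))) h3
  have h5 := congrArg star h4
  simp only [star_add, star_smul, hC, hA, hA2, Complex.star_def, Complex.conj_I, neg_smul,
    smul_neg, neg_neg] at h5
  have h6 : (2 : ℂ) • A'.form α x ![v]
      = (2 : ℂ) • gaugeForm (k.map α) x (A.form α x ![v]) (dEnd (k.map α) x v) := by
    have h7 := congrArg₂ (fun a b => a - b) h4 h5
    rw [two_smul, two_smul]
    convert h7 using 1 <;> abel
  exact smul_right_injective (V →L[ℂ] V) (two_ne_zero (α := ℂ)) h6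

variable [IsManifold halfPlaneℝ ∞ S]

/-- If the covariant derivative of `χ` vanishes, then `g = k e^χ` and its unitary part `k` act in
the same way on the connection. -/
theorem gaugeForm_unitaryPart (hG : IsCompactConnectedUnitary G) {g : P.ComplexGauge} {α : ι}
    {x₀ : S} (hx : x₀ ∈ P.U α)
    (hz : (extChartAt halfPlaneℝ x₀).target ∈ 𝓝 (extChartAt halfPlaneℝ x₀ x₀))
    {a : V →L[ℂ] V} {v : ℂ}
    (h : fderiv ℝ (fun z => polarLog (g.map α ((extChartAt halfPlaneℝ x₀).symm z) : V →L[ℂ] V))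
        (extChartAt halfPlaneℝ x₀ x₀) v
      + (a * polarLog (g.map α x₀ : V →L[ℂ] V) - polarLog (g.map α x₀ : V →L[ℂ] V) * a) = 0) :
    gaugeForm ((g.unitaryPart hG).map α) x₀ a (dEnd ((g.unitaryPart hG).map α) x₀ v)
      = gaugeForm (g.map α) x₀ a (dEnd (g.map α) x₀ v) := by
  set ψ := (extChartAt halfPlaneℝ x₀).symm with hψ
  set z₀ := extChartAt halfPlaneℝ x₀ x₀ with hz₀
  have hψ0 : ψ z₀ = x₀ := extChartAt_to_inv x₀
  have key : ∀ f : P.ComplexGauge, DifferentiableAt ℝ (fun z => (f.map α (ψ z) : V →L[ℂ] V)) z₀ ∧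
      fderiv ℝ (fun z => (f.map α (ψ z) : V →L[ℂ] V)) z₀ v = dEnd (f.map α) x₀ v := by
    intro f
    have h1 : MDifferentiableAt halfPlaneℝ 𝓘(ℝ, V →L[ℂ] V)
        (fun y => (f.map α y : V →L[ℂ] V)) x₀ :=
      ((f.smooth α).contMDiffAt ((P.isOpen α).mem_nhds hx)).mdifferentiableAt (by simp)
    refine ⟨(contDiffAt_comp_extChartAt_symm (P.isOpen α) (f.smooth α) hz
      (by rw [extChartAt_to_inv]; exact hx)).differentiableAt (by simp), ?_⟩
    have h2 := fderiv_comp_extChartAt_symm (f := fun y => (f.map α y : V →L[ℂ] V)) hz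
      (by rw [extChartAt_to_inv]; exact h1) v
    rw [chartFrame_self hz, extChartAt_to_inv] at h2
    exact h2
  set χ : ℂ → V →L[ℂ] V := fun z => polarLog (g.map α (ψ z) : V →L[ℂ] V) with hχ
  have hχ0 : χ z₀ = polarLog (g.map α x₀ : V →L[ℂ] V) := by simp only [hχ, hψ0]
  have hχd : DifferentiableAt ℝ χ z₀ :=
    (contDiffAt_polarLog_comp (contDiffAt_comp_extChartAt_symm (P.isOpen α) (g.smooth α) hz
      (by rw [extChartAt_to_inv]; exact hx))).differentiableAt (by simp)
  rw [← hχ0] at h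
  have h1 : covLogDeriv (-χ z₀) (-fderiv ℝ χ z₀ v) a = 0 := by
    refine covLogDeriv_eq_zero ?_
    rw [← neg_eq_zero, ← h]
    noncomm_ring
  have h2 : HasFDerivAt (fun z => NormedSpace.exp (-χ z)) _ z₀ := hasFDerivAt_exp_comp hχd.neg
  have h3 := (key g).1.hasFDerivAt.mul' h2
  have h4 : dEnd ((g.unitaryPart hG).map α) x₀ v = dEnd (g.map α) x₀ v * NormedSpace.exp (-χ z₀)
      + (g.map α x₀ : V →L[ℂ] V) * (fderiv ℂ (NormedSpace.exp : (V →L[ℂ] V) → (V →L[ℂ] V))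
        (-χ z₀) (-fderiv ℝ χ z₀ v)) := by
    have h5 : fderiv ℝ (fun w => -χ w) z₀ v = -fderiv ℝ χ z₀ v := by
      rw [fderiv_fun_neg]; rfl
    rw [← (key _).2, ← (key g).2, ← h5, add_comm]
    conv_rhs => rw [← hψ0]
    exact congrArg (fun L : ℂ →L[ℝ] (V →L[ℂ] V) => L v) h3.fderiv
  rw [covLogDeriv, neg_neg] at h1
  have h5 : fderiv ℂ (NormedSpace.exp : (V →L[ℂ] V) → (V →L[ℂ] V)) (-χ z₀) (-fderiv ℝ χ z₀ v)
      = NormedSpace.exp (-χ z₀) * a - a * NormedSpace.exp (-χ z₀) := by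
    have h6 := congrArg (fun T => NormedSpace.exp (-χ z₀) * T) h1
    simp only [mul_add, mul_sub, ← mul_assoc, exp_neg_mul_exp, one_mul, mul_zero] at h6
    rw [← sub_eq_zero, ← h6]
    abel
  have h6 : (((g.unitaryPart hG).map α x₀ : (V →L[ℂ] V)ˣ) : V →L[ℂ] V)
      = (g.map α x₀ : V →L[ℂ] V) * NormedSpace.exp (-χ z₀) := by
    rw [hχ0]; rfl
  have h7 : ((((g.unitaryPart hG).map α x₀)⁻¹ : (V →L[ℂ] V)ˣ) : V →L[ℂ] V)
      = NormedSpace.exp (χ z₀) * (((g.map α x₀)⁻¹ : (V →L[ℂ] V)ˣ) : V →L[ℂ] V) := by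
    have : ((g.unitaryPart hG).map α x₀)⁻¹ = (expGL (-χ z₀))⁻¹ * (g.map α x₀)⁻¹ := by
      rw [hχ0, ← mul_inv_rev]; rfl
    rw [this, Units.val_mul, expGL_inv_coe, neg_neg]
  rw [gaugeForm, gaugeForm, h4, h5, h6, h7]
  have h8 : ∀ T, NormedSpace.exp (-χ z₀) * (NormedSpace.exp (χ z₀) * T) = T := fun T => by
    rw [← mul_assoc, exp_neg_mul_exp, one_mul]
  simp only [mul_sub, sub_mul, add_mul, mul_assoc, h8]
  abel

/-- For a unitary connection, the covariant derivative of a self-adjoint section is self-adjoint, so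
it vanishes if its `∂/∂z`-part does. -/
theorem covariantDerivative_eq_zero_of_covDz {ax ay χ : ℂ → V →L[ℂ] V} {z : ℂ}
    (hχ : ∀ w, IsSelfAdjoint (χ w)) (hχd : DifferentiableAt ℝ χ z) (hx : star (ax z) = -ax z)
    (hy : star (ay z) = -ay z) (h : covDz ax ay χ z = 0) :
    fderiv ℝ χ z 1 + (ax z * χ z - χ z * ax z) = 0 ∧
      fderiv ℝ χ z Complex.I + (ay z * χ z - χ z * ay z) = 0 := by
  have h1 : ∀ v, star (fderiv ℝ χ z v) = fderiv ℝ χ z v := fun v =>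
    fderiv_mem_of_eventually_mem (W := selfAdjoint.submodule ℝ (V →L[ℂ] V)) hχd (.of_forall hχ) v
  have h2 : star (χ z) = χ z := hχ z
  set p := fderiv ℝ χ z 1 + (ax z * χ z - χ z * ax z) with hp
  set q := fderiv ℝ χ z Complex.I + (ay z * χ z - χ z * ay z) with hq
  have hps : star p = p := by
    rw [hp]; simp only [star_add, star_sub, star_mul, h1, h2, hx]; noncomm_ring
  have hqs : star q = q := by
    rw [hq]; simp only [star_add, star_sub, star_mul, h1, h2, hy]; noncomm_ring
  have h3 : p = Complex.I • q := by
    have : covDz ax ay χ z = (1 / 2 : ℂ) • (p - Complex.I • q) := by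
      rw [covDz, dz, hp, hq]
      simp only [mul_smul_comm, smul_mul_assoc, mul_sub, sub_mul, smul_add, smul_sub]
      abel
    rw [this] at h
    exact sub_eq_zero.1 ((smul_eq_zero.1 h).resolve_left (by norm_num))
  have h4 : p = -p := by
    conv_lhs => rw [← hps, h3, star_smul, hqs, Complex.star_def, Complex.conj_I, neg_smul, ← h3]
  have h5 : p = 0 := by
    have : (2 : ℂ) • p = 0 := by rw [two_smul]; nth_rewrite 1 [h4]; simp
    exact (smul_eq_zero.1 this).resolve_left two_ne_zero
  refine ⟨h5, ?_⟩
  rw [h5] at h3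
  exact (smul_eq_zero.1 h3.symm).resolve_left Complex.I_ne_zero

end UnitaryPart

/-! ### The global argument -/

section Global

variable {V : Type*} [NormedAddCommGroup V] [InnerProductSpace ℂ V] [FiniteDimensional ℂ V]
  [CompleteSpace V] {G : Subgroup (V →L[ℂ] V)ˣ}
  {S : Type*} [TopologicalSpace S] [ChartedSpace HalfPlane S] {ι : Type*}
  {P : PrincipalBundle G S ι}
  {E : Type*} [NormedAddCommGroup E] [NormedSpace ℂ E]
  {X : Type*} [TopologicalSpace X] [ChartedSpace E X] [T2Space X] [IsManifold 𝓘(ℝ, E) 1 X]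
  [IsManifold halfPlaneℂ ∞ S] [IsManifold halfPlaneℝ ∞ S]
  {B : InvariantInnerProduct G} {Ω : KahlerForm E X} {ρ : HolomorphicAction E X (complexification G)}
  {Φ : MomentMap B Ω ρ} {dvol : AreaForm S} {A A' : P.Connection} {u u' : P.AssocSection ρ}
  {g : P.ComplexGauge}

theorem planeLaplacian_congr {F₁ F₂ : ℂ → ℝ} {z : ℂ} (h : F₁ =ᶠ[𝓝 z] F₂) :
    planeLaplacian F₁ z = planeLaplacian F₂ z := by
  have key : ∀ v : ℂ, (fun w => fderiv ℝ F₁ w v) =ᶠ[𝓝 z] fun w => fderiv ℝ F₂ w v := fun v => by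
    filter_upwards [h.eventuallyEq_nhds] with w hw
    rw [hw.fderiv_eq]
  rw [planeLaplacian, planeLaplacian, (key 1).fderiv_eq, (key Complex.I).fderiv_eq]

theorem extChartAt_target_mem_nhds_of_interior {x : S} (hx : halfPlaneℝ.IsInteriorPoint x) :
    (extChartAt halfPlaneℝ x).target ∈ 𝓝 (extChartAt halfPlaneℝ x x) :=
  mem_interior_iff_mem_nhds.1 (ModelWithCorners.isInteriorPoint_iff.1 hx)

theorem contDiffAt_polarSq (g : P.ComplexGauge) {α : ι} {x₀ : S} {z : ℂ}
    (hz : (extChartAt halfPlaneℝ x₀).target ∈ 𝓝 z)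
    (hU : (extChartAt halfPlaneℝ x₀).symm z ∈ P.U α) :
    ContDiffAt ℝ 2 (fun z => g.polarSq B α ((extChartAt halfPlaneℝ x₀).symm z)) z := by
  have h1 := (contDiffAt_polarLog_comp (contDiffAt_comp_extChartAt_symm (P.isOpen α) (g.smooth α)
    hz hU)).const_smul (-Complex.I)
  have h2 := h1.of_le two_le_infty
  exact ((LinearMap.toContinuousBilinearMap B.form).contDiff.contDiffAt.comp z h2).clm_apply h2

/-- The squared length of `ξ` is subharmonic in every chart. -/
theorem planeLaplacian_polarSq_nonneg (hG : IsCompactConnectedUnitary G)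
    (hAu : IsVortex Φ dvol A u) (hAu' : IsVortex Φ dvol A' u') (hg : g.Maps A u A' u')
    {α : ι} {x₀ : S} {z : ℂ} (hz : (extChartAt halfPlaneℝ x₀).target ∈ 𝓝 z)
    (hU : (extChartAt halfPlaneℝ x₀).symm z ∈ P.U α)
    (hi : halfPlaneℝ.IsInteriorPoint ((extChartAt halfPlaneℝ x₀).symm z)) :
    0 ≤ planeLaplacian (fun z => g.polarSq B α ((extChartAt halfPlaneℝ x₀).symm z)) z := by
  set ψ := (extChartAt halfPlaneℝ x₀).symm with hψ
  set x := ψ z with hx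
  have hzx := extChartAt_target_mem_nhds_of_interior hi
  have h1 := (bochner_interior hG hAu hAu' hg hU hzx).1
  set τ : ℂ → ℂ := fun w => extChartAt halfPlaneℝ x (ψ w) with hτ
  have hτa : AnalyticAt ℂ τ z := by
    have k1 : ContMDiffAt 𝓘(ℂ, ℂ) halfPlaneℂ ∞ (extChartAt halfPlaneℂ x₀).symm z :=
      (contMDiffOn_extChartAt_symm (I := halfPlaneℂ) (n := ∞) x₀).contMDiffAt hz
    have k2 : ContMDiffAt halfPlaneℂ 𝓘(ℂ, ℂ) ∞ (extChartAt halfPlaneℂ x)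
        ((extChartAt halfPlaneℂ x₀).symm z) := contMDiffAt_extChartAt
    have k3 := k2.comp z k1
    rw [contMDiffAt_iff_contDiffAt] at k3
    have k4 : ContDiffAt ℂ 1 τ z := k3.of_le (by exact_mod_cast le_top)
    rw [Complex.analyticAt_iff_eventually_differentiableAt]
    exact (k4.eventually (by simp)).mono fun w hw => hw.differentiableAt one_ne_zero
  have hc : ContinuousAt ψ z := (hasMFDerivAt_chartFrame hz).continuousAt
  have hcongr : (fun w => g.polarSq B α (ψ w)) =ᶠ[𝓝 z]
      fun w => g.polarSq B α ((extChartAt halfPlaneℝ x).symm (τ w)) := by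
    filter_upwards [hc.eventually (extChartAt_source_mem_nhds (I := halfPlaneℝ) x)] with w hw
    rw [hτ, PartialEquiv.left_inv _ hw]
  rw [planeLaplacian_congr hcongr, planeLaplacian_comp (ψ := τ)
    (F := fun w => g.polarSq B α ((extChartAt halfPlaneℝ x).symm w)) ?_ hτa]
  · exact mul_nonneg (Complex.normSq_nonneg _) h1
  · exact contDiffAt_polarSq g hzx (by rw [extChartAt_to_inv]; exact hU)

/-- At an interior maximum the squared length of `ξ` is locally constant. -/
theorem eventually_polarSq_eq (hG : IsCompactConnectedUnitary G)
    (hAu : IsVortex Φ dvol A u) (hAu' : IsVortex Φ dvol A' u') (hg : g.Maps A u A' u')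
    {α : ι} {x₀ : S} (hx : x₀ ∈ P.U α) (hi : halfPlaneℝ.IsInteriorPoint x₀)
    (hmax : ∀ y ∈ P.U α, g.polarSq B α y ≤ g.polarSq B α x₀) :
    ∀ᶠ y in 𝓝 x₀, g.polarSq B α y = g.polarSq B α x₀ := by
  have hz := extChartAt_target_mem_nhds_of_interior hi
  have hop : IsOpen (P.U α ∩ halfPlaneℝ.interior S) :=
    (P.isOpen α).inter (halfPlaneℝ.isOpen_interior (n := ∞) (by simp))
  obtain ⟨R, hR, hball⟩ := Metric.eventually_nhds_iff_ball.1 (eventually_chart hop ⟨hx, hi⟩ hz)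
  have h0 : (extChartAt halfPlaneℝ x₀).symm (extChartAt halfPlaneℝ x₀ x₀) = x₀ :=
    extChartAt_to_inv x₀
  have h1 := eqOn_of_planeLaplacian_nonneg
    (F := fun z => g.polarSq B α ((extChartAt halfPlaneℝ x₀).symm z))
    (fun z hz => contDiffAt_polarSq g (hball z hz).1 (hball z hz).2.1)
    (fun z hz => planeLaplacian_polarSq_nonneg hG hAu hAu' hg (hball z hz).1 (hball z hz).2.1
      (hball z hz).2.2)
    (fun z hz => by simp only [h0]; exact hmax _ (hball z hz).2.1)
  simp only [h0] at h1
  filter_upwards [extChartAt_source_mem_nhds (I := halfPlaneℝ) x₀,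
    (continuousAt_extChartAt (I := halfPlaneℝ) x₀).eventually
      (Metric.ball_mem_nhds _ (half_pos hR))] with y hy1 hy2
  rw [← h1 _ hy2, PartialEquiv.left_inv _ hy1]

/-- Where the squared length of `ξ` is locally constant, the unitary part of `g` does the same to
the pair `(A, u)` as `g` itself. -/
theorem unitaryPart_maps_of_eventually_eq (hG : IsCompactConnectedUnitary G)
    (hAu : IsVortex Φ dvol A u) (hAu' : IsVortex Φ dvol A' u') (hg : g.Maps A u A' u')
    {α : ι} {x₀ : S} (hx : x₀ ∈ P.U α) (hi : halfPlaneℝ.IsInteriorPoint x₀) {c : ℝ}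
    (hconst : ∀ᶠ y in 𝓝 x₀, g.polarSq B α y = c) :
    u'.map α x₀ = ρ.act ((g.unitaryPart hG).map α x₀) (u.map α x₀) ∧
      ∀ v : TangentSpace halfPlaneℝ x₀, A'.form01 α x₀ v
        = gaugeForm ((g.unitaryPart hG).map α) x₀ (A.form01 α x₀ v)
          (dbarEnd ((g.unitaryPart hG).map α) x₀ v) := by
  have hz := extChartAt_target_mem_nhds_of_interior hi
  set z₀ := extChartAt halfPlaneℝ x₀ x₀ with hz₀
  set ψ := (extChartAt halfPlaneℝ x₀).symm with hψ
  have hψ0 : ψ z₀ = x₀ := extChartAt_to_inv x₀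
  have hc : Filter.Tendsto ψ (𝓝 z₀) (𝓝 x₀) := by
    have : ContinuousAt ψ z₀ := continuousAt_extChartAt_symm x₀
    rwa [ContinuousAt, hψ0] at this
  have h0 : planeLaplacian (fun z => g.polarSq B α (ψ z)) z₀ = 0 := by
    rw [planeLaplacian_congr (F₂ := fun _ => c) (hc.eventually hconst)]
    simp [planeLaplacian]
  obtain ⟨h1, h2⟩ := (bochner_interior hG hAu hAu' hg hx hz).2 h0
  have hmem := g.mem α x₀ hx
  refine ⟨?_, ?_⟩
  · have hχ : expGL (polarLog (g.map α x₀ : V →L[ℂ] V)) ∈ complexification G :=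
      expGL_mem_complexification (polarLog_mem hG hmem)
    have hk := (g.unitaryPart hG).mem α x₀ hx
    have h3 : g.map α x₀ = (g.unitaryPart hG).map α x₀
        * expGL (polarLog (g.map α x₀ : V →L[ℂ] V)) := by
      change _ = g.map α x₀ * expGL (-polarLog (g.map α x₀ : V →L[ℂ] V)) * _
      rw [mul_assoc, ← expGL_add_of_comm (Commute.refl (polarLog (g.map α x₀ : V →L[ℂ] V))).neg_left,
        neg_add_cancel, expGL_zero, mul_one]
    rw [(hg α x₀ hx).1, h3, ρ.mul_act _ hk _ hχ, h2]
  · have hskew : ∀ v : ℂ, star (A.form α x₀ ![v]) = -A.form α x₀ ![v] := fun v =>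
      star_eq_neg_of_mem_lieAlg hG (A.mem α x₀ hx v)
    have hχd : DifferentiableAt ℝ (fun z => polarLog (g.map α (ψ z) : V →L[ℂ] V)) z₀ :=
      (contDiffAt_polarLog_comp (contDiffAt_comp_extChartAt_symm (P.isOpen α) (g.smooth α) hz
        (by rw [extChartAt_to_inv]; exact hx))).differentiableAt (by simp)
    have key : ∀ ax ay : ℂ → V →L[ℂ] V, ax z₀ = A.form α x₀ ![(1 : ℂ)] →
        ay z₀ = A.form α x₀ ![Complex.I] →
        covDz ax ay (fun z => polarLog (g.map α (ψ z) : V →L[ℂ] V)) z₀ = 0 →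
        fderiv ℝ (fun z => polarLog (g.map α (ψ z) : V →L[ℂ] V)) z₀ 1
            + (A.form α x₀ ![(1 : ℂ)] * polarLog (g.map α x₀ : V →L[ℂ] V)
              - polarLog (g.map α x₀ : V →L[ℂ] V) * A.form α x₀ ![(1 : ℂ)]) = 0 ∧
          fderiv ℝ (fun z => polarLog (g.map α (ψ z) : V →L[ℂ] V)) z₀ Complex.I
            + (A.form α x₀ ![Complex.I] * polarLog (g.map α x₀ : V →L[ℂ] V)
              - polarLog (g.map α x₀ : V →L[ℂ] V) * A.form α x₀ ![Complex.I]) = 0 := by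
      intro ax ay hax hay hcov
      have k := covariantDerivative_eq_zero_of_covDz (fun w => polarLog_isSelfAdjoint _) hχd
        (by rw [hax]; exact hskew 1) (by rw [hay]; exact hskew Complex.I) hcov
      simpa only [hax, hay, hψ0] using k
    obtain ⟨h3, h4⟩ := key _ _ (chartForm_self A hz 1) (chartForm_self A hz Complex.I) h1
    -- The covariant derivative is linear in the direction.
    have h5 : ∀ v : ℂ, fderiv ℝ (fun z => polarLog (g.map α (ψ z) : V →L[ℂ] V)) z₀ v
        + (A.form α x₀ ![v] * polarLog (g.map α x₀ : V →L[ℂ] V)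
          - polarLog (g.map α x₀ : V →L[ℂ] V) * A.form α x₀ ![v]) = 0 := fun v => by
      have hv : v = v.re • (1 : ℂ) + v.im • Complex.I := by simp
      have ha : A.form α x₀ ![v] = v.re • A.form α x₀ ![(1 : ℂ)]
          + v.im • A.form α x₀ ![Complex.I] := by
        have k1 := (A.form α x₀).toAlternatingMap.map_vecCons_add ![] (v.re • (1 : ℂ))
          (v.im • Complex.I)
        have k2 := (A.form α x₀).toAlternatingMap.map_vecCons_smul ![] v.re (1 : ℂ)
        have k3 := (A.form α x₀).toAlternatingMap.map_vecCons_smul ![] v.im Complex.I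
        refine Eq.trans ?_ (k1.trans (congrArg₂ (fun a b => a + b) k2 k3))
        exact congrArg (fun w : ℂ => A.form α x₀ ![w]) hv
      have hd : fderiv ℝ (fun z => polarLog (g.map α (ψ z) : V →L[ℂ] V)) z₀ v
          = v.re • fderiv ℝ (fun z => polarLog (g.map α (ψ z) : V →L[ℂ] V)) z₀ 1
            + v.im • fderiv ℝ (fun z => polarLog (g.map α (ψ z) : V →L[ℂ] V)) z₀ Complex.I := by
        conv_lhs => rw [hv]
        rw [map_add, map_smul, map_smul]
      have k4 := congrArg₂ (fun a b => v.re • a + v.im • b) h3 h4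
      simp only [smul_zero, add_zero] at k4
      rw [ha, hd, ← k4]
      simp only [smul_add, smul_sub, add_mul, mul_add, smul_mul_assoc, mul_smul_comm]
      abel
    intro v
    have h6 := fun v : ℂ => gaugeForm_unitaryPart hG hx hz (h5 v)
    rw [(hg α x₀ hx).2 v, PrincipalBundle.Connection.form01, dbarEnd, dbarEnd, gaugeForm_half,
      gaugeForm_half]
    have e1 := h6 v
    have e2 := h6 (tangentJ halfPlaneℝ x₀ v)
    exact congrArg₂ (fun a b => (1 / 2 : ℂ) • (a + Complex.I • b)) e1.symm e2.symm

theorem gaugeEquivalent_of_unitary (hG : IsCompactConnectedUnitary G) {k : P.ComplexGauge}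
    (hk : k.IsUnitaryOn univ) (h : k.Maps A u A' u') : GaugeEquivalent A u A' u' :=
  ⟨k, hk, fun α x hx => ⟨(h α x hx).1, eq_gaugeForm_of_form01 hG hk hx (h α x hx).2⟩⟩

/-- Either `g` is unitary everywhere, or the squared length of `ξ` is a positive constant and the
surface has no boundary. -/
theorem isUnitaryOn_or_const [CompactSpace S] [ConnectedSpace S] (hG : IsCompactConnectedUnitary G)
    (hAu : IsVortex Φ dvol A u) (hAu' : IsVortex Φ dvol A' u') (hg : g.Maps A u A' u')
    (hbdry : g.IsUnitaryOn (halfPlaneℝ.boundary S)) :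
    g.IsUnitaryOn univ ∨ ((∀ x : S, halfPlaneℝ.IsInteriorPoint x) ∧
      ∃ c, ∀ α, ∀ x ∈ P.U α, g.polarSq B α x = c) := by
  choose a ha using P.cover
  set f : S → ℝ := fun x => g.polarSq B (a x) x with hf
  have hfα : ∀ α, ∀ x ∈ P.U α, g.polarSq B α x = f x := fun α x hx =>
    g.polarSq_eq hG B ⟨hx, ha x⟩
  have hfc : Continuous f := continuous_iff_continuousAt.2 fun x => by
    refine (g.continuousAt_polarSq B (ha x)).congr ?_
    filter_upwards [(P.isOpen _).mem_nhds (ha x)] with y hy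
    exact hfα _ _ hy
  obtain ⟨x₁, -, hmax⟩ := isCompact_univ.exists_isMaxOn (univ_nonempty (α := S)) hfc.continuousOn
  have hmax' : ∀ y, f y ≤ f x₁ := fun y => hmax (mem_univ y)
  rcases le_or_gt (f x₁) 0 with hM | hM
  · left
    intro α x hx
    refine mem_of_polarLog_eq_zero hG (g.mem α x hx.1) (g.polarLog_eq_zero_of_polarSq hG B hx.1 ?_)
    exact le_antisymm ((hfα α x hx.1).trans_le ((hmax' x).trans hM)) (g.polarSq_nonneg hG B hx.1)
  · right
    have hint : ∀ x, f x = f x₁ → halfPlaneℝ.IsInteriorPoint x := fun x hx => by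
      rw [ModelWithCorners.isInteriorPoint_iff_not_isBoundaryPoint]
      intro hb
      have h1 := polarLog_eq_zero_of_mem hG (hbdry (a x) x ⟨ha x, hb⟩)
      have h2 : f x = 0 := by rw [hf]; simp [PrincipalBundle.ComplexGauge.polarSq, h1]
      exact hM.ne' (hx ▸ h2)
    have hopen : IsOpen {x | f x = f x₁} := by
      rw [isOpen_iff_mem_nhds]
      intro x hx
      have hx' : f x = f x₁ := hx
      have h1 := eventually_polarSq_eq (B := B) hG hAu hAu' hg (ha x) (hint x hx) fun y hy => by
        rw [hfα _ y hy]
        exact (hmax' y).trans hx'.ge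
      filter_upwards [h1, (P.isOpen _).mem_nhds (ha x)] with y hy1 hy2
      rw [← hfα _ y hy2, hy1]
      exact hx'
    have huniv : {x | f x = f x₁} = univ :=
      IsClopen.eq_univ ⟨isClosed_eq hfc continuous_const, hopen⟩ ⟨x₁, rfl⟩
    have hall : ∀ x, f x = f x₁ := fun x => (huniv ▸ mem_univ x : x ∈ {x | f x = f x₁})
    exact ⟨fun x => hint x (hall x), f x₁, fun α x hx => (hfα α x hx).trans (hall x)⟩

end Global

end

theorem mainTheorem5
    {V : Type*} [NormedAddCommGroup V] [InnerProductSpace ℂ V] [FiniteDimensional ℂ V]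
    [CompleteSpace V]
    (G : Subgroup (V →L[ℂ] V)ˣ) (hG : IsCompactConnectedUnitary G) (B : InvariantInnerProduct G)
    {E : Type*} [NormedAddCommGroup E] [NormedSpace ℂ E] [FiniteDimensional ℂ E]
    {X : Type*} [TopologicalSpace X] [CompactSpace X] [T2Space X] [ChartedSpace E X]
    [IsManifold 𝓘(ℂ, E) ∞ X]
    (Ω : KahlerForm E X) (ρ : HolomorphicAction E X (complexification G)) (Φ : MomentMap B Ω ρ)
    {S : Type*} [TopologicalSpace S] [CompactSpace S] [T2Space S] [ConnectedSpace S]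
    [ChartedSpace HalfPlane S] [IsManifold halfPlaneℂ ∞ S]
    (dvol : AreaForm S)
    {ι : Type*} (P : PrincipalBundle G S ι)
    (A A' : P.Connection) (u u' : P.AssocSection ρ)
    (hAu : IsVortex Φ dvol A u) (hAu' : IsVortex Φ dvol A' u')
    (g : P.ComplexGauge) (hg : g.Maps A u A' u')
    (hbdry : g.IsUnitaryOn (halfPlaneℝ.boundary S)) :
    GaugeEquivalent A u A' u' ∧
      ((halfPlaneℝ.boundary S).Nonempty → g.IsUnitaryOn univ) := by
  have : IsManifold halfPlaneℝ ∞ S := isManifold_halfPlane S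
  have hX : IsManifold 𝓘(ℝ, E) ∞ X := isManifold_real_of_complex E X
  have : IsManifold 𝓘(ℝ, E) 1 X := IsManifold.of_le (n := ∞) (by exact_mod_cast le_top)
  rcases isUnitaryOn_or_const hG hAu hAu' hg hbdry with h | ⟨hint, c, hc⟩
  · exact ⟨gaugeEquivalent_of_unitary hG h hg, fun _ => h⟩
  · refine ⟨gaugeEquivalent_of_unitary hG (g.unitaryPart_isUnitaryOn hG univ) fun α x hx => ?_,
      fun ⟨x, hx⟩ => ?_⟩
    · refine unitaryPart_maps_of_eventually_eq (c := c) hG hAu hAu' hg hx (hint x) ?_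
      filter_upwards [(P.isOpen α).mem_nhds hx] with y hy
      exact hc α y hy
    · exact absurd hx ((ModelWithCorners.isInteriorPoint_iff_not_isBoundaryPoint x).1 (hint x))
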